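/- **Setting.** Let $s\ge 1$ be an integer, $d,D\in\mathbb R$ with $|d+D|<1/2$ and $|D|<1/2$, and let $\phi(z)=1-\sum_{k=1}^p\phi_kz^k$, $\theta(z)=1-\sum_{k=1}^q\theta_kz^k$, $\Phi(z)=1-\sum_{k=1}^P\Phi_kz^k$, $\Theta(z)=1-\sum_{k=1}^Q\Theta_kz^k$ be real polynomials such that $\Phi(z^s)\phi(z)$ and $\Theta(z^s)\theta(z)$ have no common zeros in $\mathbb C$. Let $\{\epsilon_t\}_{t\in\mathbb Z}$ be a white noise with mean $0$ and constant finite variance that is a GARCH$(r,m)$ process: $\epsilon_t=\sqrt{h_t}\,\eta_t$, where $h_t\ge 0$ is a function of $\epsilon_{t-1},\epsilon_{t-2},\dots$, the variable $\eta_t$ is independent of $\epsilon_{t-1},\epsilon_{t-2},\dots$ and has a fixed law with mean $0$ and variance $1$, and $$h_t=\alpha_0+\sum_{i=1}^m\alpha_i\epsilon_{t-i}^2+\sum_{j=1}^r\beta_jh_{t-j},\qquad \alpha_0>0,\ \alpha_i,\beta_j\ge 0,\ \sum_{i=1}^m\alpha_i+\sum_{j=1}^r\beta_j<1 .$$ Let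 $B$ be the backward operator, and for $(x,y)\in\mathbb R^2$ let $\nabla^{(x,y)}=(1-B)^x(1-B^s)^y$, expanded as a power series in $B$ by the binomial series. All infinite sums of random variables are mean-square limits of partial sums. A *SARFIMA process* (driven by $\epsilon$) is a zero-mean process $\{X_t\}_{t\in\mathbb Z}$ with finite second moments for which $U_t=\nabla^{(d,D)}X_t$ converges and satisfies $\Phi(B^s)\phi(B)U_t=\Theta(B^s)\theta(B)\epsilon_t$. Say that $X$ has *no component of period $s$* if $\frac1n\sum_{k=0}^{n-1}X_{t-sk}\to 0$ in mean square for every $t$ (this holds for every zero-mean second-order stationary process that has a spectral density). A spectral density of a second-order stationary process $Y$ is an integrable $f\ge 0$ on $[-\pi,\pi]$ with $\mathrm{Cov}(Y_{t+k},Y_t)=\int_{-\pi}^{\pi}e^{ik\omega}f(\omega)\,d\omega$ for all $k$. **(a)** If $\Phi(z^s)\phi(z)\ne0$ for $|z|=1$, then there is a second-order stationary SARFIMA process $X$ with no component of period $s$. It is unique: every second-order stationary SARFIMA process, which in case $D>0$ or $d+D>0$ has no component of period $s$, coincides with $X$ almost surely. It has the representation $$X_t=\sum_{j=-\infty}^{\infty}\psi_j\,\nabla^{(-d,-D)}\epsilon_{t-j},$$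 where $\psi_j$ are the coefficients of the Laurent expansion $\sum_{j\in\mathbb Z}\psi_jz^j=\dfrac{\Theta(z^s)\theta(z)}{\Phi(z^s)\phi(z)}$ in some annulus around $|z|=1$, and $(\psi_j)$ is the only real sequence for which this representation holds. If moreover $\Phi(z^s)\phi(z)\ne0$ for $|z|\le1$, then $\psi_j=0$ for $j<0$, so that the representation is causal. The process $X$ is strictly stationary and ergodic. **(b)** If $\Theta(z^s)\theta(z)\ne0$ for $|z|\le1$, then every second-order stationary SARFIMA process $X$ is invertible (each $\epsilon_t$ is a mean-square limit of finite linear combinations of $X_t,X_{t-1},\dots$), and $$\sum_{j=0}^\infty\psi_j^*V_{t-j}=\epsilon_t,\qquad V_t=\frac{\Phi(B^s)\phi(B)}{\Theta(B^s)\theta(B)}X_t=\sum_{k=0}^\infty c_kX_{t-k},\qquad \sum_{k=0}^\infty c_kz^k=\frac{\Phi(z^s)\phi(z)}{\Theta(z^s)\theta(z)}\quad(|z|\le1),$$ where $\psi_j^*=\pi_j+\sum_{i=1}^\infty\pi_i^{(s)}\pi_{j-is}$ with $\pi_l=\dfrac{\Gamma(l-d)}{\Gamma(l+1)\Gamma(-d)}$,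 $\pi_k^{(s)}=\dfrac{\Gamma(k-D)}{\Gamma(k+1)\Gamma(-D)}$ for $l,k\ge0$, and $\pi_l=0$ for $l<0$ (for $d=0$ or $D=0$ these quotients are read as their limits $1,0,0,\dots$). **(c)** Let $X$ be a second-order stationary SARFIMA process which, in case $D>0$ or $d+D>0$, has no component of period $s$, and let $U_t=\nabla^{(d,D)}X_t$. If $f_U$ is a spectral density of $U$ (one exists when $\Phi(z^s)\phi(z)\ne 0$ for $|z|=1$), then $X$ has the spectral density $$f_X(\omega)=f_U(\omega)\left|2\sin\left(\tfrac{s\omega}{2}\right)\right|^{-2D}\left|2\sin\left(\tfrac{\omega}{2}\right)\right|^{-2d},\qquad\omega\in[-\pi,\pi].$$ -/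

import Mathlib

open MeasureTheory ProbabilityTheory Filter Topology Polynomial

noncomputable section

namespace SarfimaGarch

/-! ### Lag polynomials and the backward operator -/

/-- The lag polynomial `1 - c₁ z - c₂ z² - ⋯ - cₙ zⁿ` (`c i` is the coefficient of lag `i + 1`). -/
def lagPoly {n : ℕ} (c : Fin n → ℝ) : ℝ[X] :=
  1 - ∑ i : Fin n, C (c i) * X ^ ((i : ℕ) + 1)

/-- The multiplicative seasonal polynomial `z ↦ A(z^s) a(z)`, where `A` and `a` are the lag
polynomials with coefficients `A` (seasonal) and `a` (non-seasonal). -/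
def seasonalPoly {m n : ℕ} (s : ℕ) (A : Fin m → ℝ) (a : Fin n → ℝ) : ℝ[X] :=
  expand ℝ s (lagPoly A) * lagPoly a

/-- `P(B) Y`, for a polynomial `P` in the backward operator `(B Y)_t = Y_{t-1}`. -/
def polyBack {Ω : Type*} (P : ℝ[X]) (Y : ℤ → Ω → ℝ) (t : ℤ) (ω : Ω) : ℝ :=
  ∑ k ∈ Finset.range (P.natDegree + 1), P.coeff k * Y (t - k) ω

/-! ### Fractional filters -/

/-- The coefficient `(-1)^j binom(x, j)` of `B^j` in `(1 - B)^x`. -/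
def fracCoeff (x : ℝ) (j : ℕ) : ℝ :=
  (-1) ^ j * Ring.choose x j

/-- The coefficient of `B^n` in the power series `(1 - B)^d (1 - B^s)^D`. -/
def nablaCoeff (s : ℕ) (d D : ℝ) (n : ℕ) : ℝ :=
  PowerSeries.coeff n
    (PowerSeries.mk (fracCoeff d) *
      PowerSeries.mk (fun k => if s ∣ k then fracCoeff D (k / s) else 0))

/-- The weights `π_l = Γ(l - x) / (Γ(l + 1) Γ(-x))`; at `x = 0`, where numerator and denominator
may have a pole, they are given their limiting values `1, 0, 0, …`. -/
def piCoeff (x : ℝ) (l : ℕ) : ℝ :=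
  if x = 0 then (if l = 0 then 1 else 0)
  else Real.Gamma (l - x) / (Real.Gamma (l + 1) * Real.Gamma (-x))

/-- `ψ*_j = π_j + ∑_{i ≥ 1} π_i^{(s)} π_{j - i s}`, where `π_l = 0` for `l < 0`
(so that only the terms with `i s ≤ j` remain). -/
def psiStar (s : ℕ) (d D : ℝ) (j : ℕ) : ℝ :=
  piCoeff d j + ∑ i ∈ Finset.Icc 1 (j / s), piCoeff D i * piCoeff d (j - i * s)

/-! ### Processes indexed by `ℤ` -/

section Processes

variable {Ω : Type*} [MeasurableSpace Ω]

/-- `V_t = ∑_{j ≥ 0} a_j Y_{t-j}` for every `t`, the series converging in mean square. -/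
def IsFilterOf (μ : Measure Ω) (a : ℕ → ℝ) (Y V : ℤ → Ω → ℝ) : Prop :=
  ∀ t : ℤ, MemLp (V t) 2 μ ∧
    Tendsto (fun n : ℕ =>
      eLpNorm (fun ω => (∑ j ∈ Finset.range n, a j * Y (t - j) ω) - V t ω) 2 μ) atTop (𝓝 0)

/-- `V_t = ∑_{j ∈ ℤ} a_j Y_{t-j}` for every `t`, the series converging in mean square. -/
def IsTwoSidedFilterOf (μ : Measure Ω) (a : ℤ → ℝ) (Y V : ℤ → Ω → ℝ) : Prop :=
  ∀ t : ℤ, MemLp (V t) 2 μ ∧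
    Tendsto (fun n : ℕ =>
      eLpNorm (fun ω => (∑ j ∈ Finset.Icc (-(n : ℤ)) n, a j * Y (t - j) ω) - V t ω) 2 μ)
      atTop (𝓝 0)

/-- Second-order stationarity. -/
structure IsSecondOrderStationary (μ : Measure Ω) (Y : ℤ → Ω → ℝ) : Prop where
  memLp : ∀ t, MemLp (Y t) 2 μ
  mean : ∀ t, ∫ ω, Y t ω ∂μ = ∫ ω, Y 0 ω ∂μ
  cov : ∀ t k : ℤ, covariance (Y (t + k)) (Y t) μ = covariance (Y k) (Y 0) μ

/-- The law of the whole path of a process, a measure on `ℤ → ℝ`. -/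
def pathLaw (μ : Measure Ω) (Y : ℤ → Ω → ℝ) : Measure (ℤ → ℝ) :=
  μ.map (fun ω t => Y t ω)

/-- Strict stationarity: the law of the path is invariant under all time shifts. -/
def IsStrictlyStationary (μ : Measure Ω) (Y : ℤ → Ω → ℝ) : Prop :=
  (∀ t, AEMeasurable (Y t) μ) ∧ ∀ k : ℤ, pathLaw μ (fun t => Y (t + k)) = pathLaw μ Y

/-- Ergodicity: the time shift is ergodic for the law of the path. -/
def IsErgodic (μ : Measure Ω) (Y : ℤ → Ω → ℝ) : Prop :=
  (∀ t, AEMeasurable (Y t) μ) ∧ Ergodic (fun (x : ℤ → ℝ) (t : ℤ) => x (t + 1)) (pathLaw μ Y)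

/-- White noise with mean `0` and variance `σ2`. -/
structure IsWhiteNoise (μ : Measure Ω) (ε : ℤ → Ω → ℝ) (σ2 : ℝ) : Prop where
  memLp : ∀ t, MemLp (ε t) 2 μ
  mean : ∀ t, ∫ ω, ε t ω ∂μ = 0
  var : ∀ t, variance (ε t) μ = σ2
  uncorrelated : ∀ t u, t ≠ u → covariance (ε t) (ε u) μ = 0

/-- The σ-algebra generated by the past `ε_{t-1}, ε_{t-2}, …`. -/
abbrev past (ε : ℤ → Ω → ℝ) (t : ℤ) : MeasurableSpace Ω :=
  ⨆ u : {u : ℤ // u < t}, MeasurableSpace.comap (ε u) inferInstance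

/-- `ε` is a GARCH process with conditional variance `h`: given the past, `ε_t` is distributed as
`√h_t ξ` with `ξ ~ ν`, for a fixed law `ν` with mean `0` and variance `1`. That is, `h_t ≥ 0` is a
function of the past, and `ε_t = √h_t η_t` with `η_t ~ ν` independent of the past. Moreover
`h_t = α₀ + ∑_i α_i ε_{t-i}² + ∑_j β_j h_{t-j}`. -/
structure IsGARCH (μ : Measure Ω) {m r : ℕ} (α0 : ℝ) (α : Fin m → ℝ) (β : Fin r → ℝ)
    (ν : Measure ℝ) (ε h : ℤ → Ω → ℝ) : Prop where
  law_memLp : MemLp (fun x : ℝ => x) 2 ν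
  law_mean : ∫ x, x ∂ν = 0
  law_var : ∫ x, x ^ 2 ∂ν = 1
  measurable : ∀ t, Measurable (ε t)
  h_nonneg : ∀ t, ∀ᵐ ω ∂μ, 0 ≤ h t ω
  h_adapted : ∀ t, Measurable[past ε t] (h t)
  recursion : ∀ t, ∀ᵐ ω ∂μ,
    h t ω = α0 + ∑ i : Fin m, α i * ε (t - ((i : ℕ) + 1)) ω ^ 2
      + ∑ j : Fin r, β j * h (t - ((j : ℕ) + 1)) ω
  conditional_law : ∀ t, ∃ η : Ω → ℝ, Measurable η ∧ μ.map η = ν ∧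
    Indep (MeasurableSpace.comap η inferInstance) (past ε t) μ ∧
    ∀ᵐ ω ∂μ, ε t ω = √(h t ω) * η ω

/-- `X` is a zero-mean process with `∇^{(d, D)} X = U` and `Φ(B^s) φ(B) U = Θ(B^s) θ(B) ε`. -/
structure IsSARFIMA (μ : Measure Ω) {p q P Q : ℕ} (s : ℕ) (d D : ℝ)
    (φ : Fin p → ℝ) (θ : Fin q → ℝ) (Φ : Fin P → ℝ) (Θ : Fin Q → ℝ)
    (ε X U : ℤ → Ω → ℝ) : Prop where
  memLp : ∀ t, MemLp (X t) 2 μ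
  mean : ∀ t, ∫ ω, X t ω ∂μ = 0
  diff : IsFilterOf μ (nablaCoeff s d D) X U
  sarma : ∀ t, ∀ᵐ ω ∂μ,
    polyBack (seasonalPoly s Φ φ) U t ω = polyBack (seasonalPoly s Θ θ) ε t ω

/-- `X` has no component of period `s`: its averages along lags that are multiples of `s` tend to
zero in mean square. -/
def HasNoPeriodicComponent (μ : Measure Ω) (s : ℕ) (X : ℤ → Ω → ℝ) : Prop :=
  ∀ t : ℤ, Tendsto (fun n : ℕ =>
    eLpNorm (fun ω => (n : ℝ)⁻¹ * ∑ k ∈ Finset.range n, X (t - (s : ℤ) * k) ω) 2 μ) atTop (𝓝 0)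

/-- Invertibility: `ε_t` is a mean-square limit of linear combinations of `X_t, X_{t-1}, …`. -/
def IsInvertible (μ : Measure Ω) (X ε : ℤ → Ω → ℝ) : Prop :=
  ∀ t : ℤ, ∀ δ : ENNReal, 0 < δ → ∃ (n : ℕ) (c : ℕ → ℝ),
    eLpNorm (fun ω => ε t ω - ∑ j ∈ Finset.range n, c j * X (t - j) ω) 2 μ < δ

/-- `f` is a spectral density of `Y` on `[-π, π]`: `Cov(Y_{t+k}, Y_t) = ∫ e^{ikλ} f(λ) dλ`. -/
structure IsSpectralDensity (μ : Measure Ω) (Y : ℤ → Ω → ℝ) (f : ℝ → ℝ) : Prop where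
  nonneg : ∀ x ∈ Set.Icc (-Real.pi) Real.pi, 0 ≤ f x
  integrable : IntegrableOn f (Set.Icc (-Real.pi) Real.pi)
  cov : ∀ t k : ℤ, ((covariance (Y (t + k)) (Y t) μ : ℝ) : ℂ) =
    ∫ x in Set.Icc (-Real.pi) Real.pi, Complex.exp (Complex.I * k * x) * (f x : ℂ)

end Processes

/-- `∑_{j ∈ ℤ} ψ_j z^j` is the Laurent expansion of `F` in some annulus around `|z| = 1`. -/
def IsLaurentExpansion (ψ : ℤ → ℝ) (F : ℂ → ℂ) : Prop :=
  ∃ r R : ℝ, 0 ≤ r ∧ r < 1 ∧ 1 < R ∧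
    ∀ z : ℂ, r < ‖z‖ → ‖z‖ < R → HasSum (fun j : ℤ => (ψ j : ℂ) * z ^ j) (F z)

end SarfimaGarch

end

noncomputable section

namespace SarfimaGarch

/-! Everything takes place in `L²`. A stationary sequence has a spectral measure `F` on the unit
circle (`exists_hasSpec`), and a summable filter acts as multiplication by its symbol, so norms of
filtered sequences are integrals of `|symbol|²` against `F`. The ARMA part is then inverted by
multiplying symbols, the Laurent coefficients of a rational function without poles on the circle
being summable.

The coefficients of `∇^{(d,D)}` need not be summable, so `∇^{(d,D)}` is approached through its Abel
sums `(1 - rB)^d (1 - (rB)^s)^D`, `r < 1`, whose symbols are continuous. By `exists_nabla_bound` the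
values on the circle of radius `r`, and the ratios of boundary values to them, are dominated by `C
(1 + |boundary value|)`. If `F` does not charge the `s`-th roots of unity, Fatou's lemma and
dominated convergence show that `U = ∇^{(d,D)} X` has spectral measure `|∇^{(d,D)}|² F` and that `X`
is recovered from `U` (`AbelFilt.inv`). This gives uniqueness and the spectral density. The mass of
`F` on the roots of unity is exactly the component of period `s`. When `D ≤ 0` and `d + D ≤ 0` the
symbol is bounded below, so `U` would inherit such a component and no assumption on `X` is needed.

Existence requires true convergence of the partial sums of `∇^{(d,D)} W` for `W = ∇^{(-d,-D)} ε`,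
that is, in `L²` of the circle with weight `w = |∇^{(-d,-D)}|²`. This follows the Helson–Szegő
argument: `|d + D|, |D| < 1/2` yield an analytic function comparable to `w` whose real part
dominates a multiple of `w` (`exists_accretive`), so truncations of power series are uniformly
bounded in the weighted norm (`exists_partialSymb_bound`). Uniform boundedness and Abel summability
together give convergence (`tendsto_of_abel_of_bound`). The solution is `X = ψ(B) W`, and a
biorthogonal system to `W` (`exists_dual`) determines the weights `ψ`. For invertibility,
`∇^{(d,D)}` is applied to the causal filter `Φφ/Θθ` of `X`.

For ergodicity, the standardized GARCH innovations are i.i.d., hence a Bernoulli shift, which is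
mixing. Iterating the variance recursion contracts in `L¹` by `∑ α + ∑ β < 1`, so `h`, then `ε`,
then `X` are measurable stationary functions of the innovations (`isFactor_innov`), and these
inherit stationarity and ergodicity. -/

instance instMeasurableSpaceCircle : MeasurableSpace Circle := borel Circle
instance instBorelSpaceCircle : BorelSpace Circle := ⟨rfl⟩

/-! ### Symbols of summable sequences -/

/-- The function `z ↦ ∑ a_j z^j` on the unit circle. -/
def symb (a : ℤ → ℝ) (z : Circle) : ℂ := ∑' j, (a j : ℂ) * (z : ℂ) ^ j

/-- The convolution of two sequences indexed by `ℤ`. -/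
def conv (a b : ℤ → ℝ) (m : ℤ) : ℝ := ∑' i, a (m - i) * b i

/-- Arc length on the circle. -/
def arcLength : Measure Circle :=
  (volume.restrict (Set.Icc (-Real.pi) Real.pi)).map Circle.exp

instance : IsFiniteMeasure arcLength := by unfold arcLength; infer_instance

lemma norm_symb_term (a : ℤ → ℝ) (z : Circle) (j : ℤ) : ‖(a j : ℂ) * (z : ℂ) ^ j‖ = |a j| := by
  rw [norm_mul, norm_zpow, Circle.norm_coe, one_zpow, mul_one, Complex.norm_real, Real.norm_eq_abs]

lemma hasSum_symb {a : ℤ → ℝ} (ha : Summable a) (z : Circle) :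
    HasSum (fun j => (a j : ℂ) * (z : ℂ) ^ j) (symb a z) := by
  apply Summable.hasSum
  apply Summable.of_norm
  simpa only [norm_symb_term] using ha.abs

lemma continuous_symb {a : ℤ → ℝ} (ha : Summable a) : Continuous (symb a) := by
  apply continuous_tsum (u := fun j => |a j|)
  · intro j
    refine continuous_const.mul ?_
    exact Continuous.zpow₀ (by fun_prop) j (fun z => Or.inl z.coe_ne_zero)
  · exact ha.abs
  · intro j z
    exact (norm_symb_term a z j).le

lemma continuous_coe_zpow (k : ℤ) : Continuous (fun z : Circle => (z : ℂ) ^ k) :=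
  Continuous.zpow₀ (by fun_prop) k (fun z => Or.inl z.coe_ne_zero)

lemma norm_symb_le {a : ℤ → ℝ} (ha : Summable a) (z : Circle) : ‖symb a z‖ ≤ ∑' j, |a j| := by
  have := norm_tsum_le_tsum_norm (f := fun j => (a j : ℂ) * (z : ℂ) ^ j)
    (by simpa only [norm_symb_term] using ha.abs)
  simp only [norm_symb_term] at this
  exact this

lemma integral_arcLength (f : Circle → ℂ) (hf : AEStronglyMeasurable f arcLength) :
    ∫ z, f z ∂arcLength = ∫ x in Set.Icc (-Real.pi) Real.pi, f (Circle.exp x) := by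
  unfold arcLength at *
  rw [integral_map (by fun_prop) hf]

lemma integral_zpow_arcLength (k : ℤ) :
    ∫ z : Circle, (z : ℂ) ^ k ∂arcLength = if k = 0 then 2 * Real.pi else 0 := by
  rw [integral_arcLength _ (continuous_coe_zpow k).aestronglyMeasurable,
    integral_Icc_eq_integral_Ioc, ← intervalIntegral.integral_of_le (by linarith [Real.pi_pos])]
  have h1 : ∀ x : ℝ, ((Circle.exp x : Circle) : ℂ) ^ k = Complex.exp ((k * Complex.I) * x) := by
    intro x
    rw [Circle.coe_exp, ← Complex.exp_int_mul]
    ring_nf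
  simp_rw [h1]
  split_ifs with hk
  · subst hk
    simp
    ring
  · rw [integral_exp_mul_complex (by simpa using hk)]
    have : Complex.exp (k * Complex.I * (Real.pi : ℝ)) =
        Complex.exp (k * Complex.I * ((-Real.pi : ℝ))) := by
      rw [Complex.exp_eq_exp_iff_exists_int]
      exact ⟨k, by push_cast; ring⟩
    rw [this]
    simp

/-- Termwise integration is allowed by absolute summability, and orthogonality of the characters
isolates one coefficient. -/
lemma integral_symb_mul_zpow {a : ℤ → ℝ} (ha : Summable a) (k : ℤ) :
    ∫ z : Circle, symb a z * (z : ℂ) ^ (-k) ∂arcLength = 2 * Real.pi * a k := by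
  have h := hasSum_integral_of_summable_integral_norm (μ := arcLength)
    (F := fun (j : ℤ) (z : Circle) => (a j : ℂ) * (z : ℂ) ^ (j - k)) ?_ ?_
  · have h2 : ∀ z : Circle, ∑' j, (a j : ℂ) * (z : ℂ) ^ (j - k) = symb a z * (z : ℂ) ^ (-k) := by
      intro z
      rw [symb, ← tsum_mul_right]
      congr 1; ext j
      rw [sub_eq_add_neg, zpow_add₀ z.coe_ne_zero, mul_assoc]
    simp_rw [h2] at h
    refine h.unique ?_
    convert hasSum_single k ?_ using 1
    · rw [integral_const_mul, integral_zpow_arcLength]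
      simp; ring
    · intro j hj
      rw [integral_const_mul, integral_zpow_arcLength, if_neg (by omega)]
      simp
  · intro j
    exact ((continuous_const.mul (continuous_coe_zpow _))).integrable_of_hasCompactSupport
      (HasCompactSupport.of_compactSpace _)
  · simp only [norm_mul, Complex.norm_real, norm_zpow, Circle.norm_coe, one_zpow, mul_one,
      integral_const, smul_eq_mul]
    exact ha.abs.mul_left _

/-- A summable sequence is determined by its symbol. -/
lemma eq_of_symb_eq {a b : ℤ → ℝ} (ha : Summable a) (hb : Summable b)
    (h : ∀ z, symb a z = symb b z) : a = b := by
  ext k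
  have h1 := integral_symb_mul_zpow ha k
  simp_rw [h, integral_symb_mul_zpow hb k] at h1
  have : (2 * Real.pi : ℂ) ≠ 0 := by simp [Real.pi_ne_zero]
  exact_mod_cast (mul_left_cancel₀ this h1).symm

/-- `(j, i) ↦ (j - i, i)`. -/
def shearEquiv : ℤ × ℤ ≃ ℤ × ℤ where
  toFun p := (p.1 - p.2, p.2)
  invFun p := (p.1 + p.2, p.2)
  left_inv p := by simp
  right_inv p := by simp

lemma summable_shear {a b : ℤ → ℝ} (ha : Summable a) (hb : Summable b) :
    Summable (fun p : ℤ × ℤ => a (p.1 - p.2) * b p.2) :=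
  (shearEquiv.summable_iff (f := fun p : ℤ × ℤ => a p.1 * b p.2)).mpr
    (summable_mul_of_summable_norm ha.norm hb.norm)

lemma summable_conv {a b : ℤ → ℝ} (ha : Summable a) (hb : Summable b) : Summable (conv a b) :=
  (summable_shear ha hb).prod

/-! ### Two-sided filters of bounded sequences in a Hilbert space -/

section Filters

variable {H : Type*} [NormedAddCommGroup H] [InnerProductSpace ℝ H]

/-- The sequence `t ↦ ∑_j a_j Y_{t-j}`. -/
def filt (a : ℤ → ℝ) (Y : ℤ → H) (t : ℤ) : H := ∑' j, a j • Y (t - j)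

/-- Boundedness of a sequence in `H`. -/
def BddSeq (Y : ℤ → H) : Prop := ∃ M, ∀ t, ‖Y t‖ ≤ M

/-- Regrouping a summable double series along the lines `j + i = m`; it serves both for products of
symbols and for compositions of filters. -/
lemma tsum_shear {E : Type*} [NormedAddCommGroup E] [CompleteSpace E] {f : ℤ × ℤ → E}
    (hf : Summable f) : ∑' j, ∑' i, f (j, i) = ∑' m, ∑' i, f (m - i, i) := by
  have h2 : Summable (f ∘ shearEquiv) := shearEquiv.summable_iff.mpr hf
  rw [← hf.tsum_prod, ← shearEquiv.tsum_eq f]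
  exact h2.tsum_prod

lemma symb_conv {a b : ℤ → ℝ} (ha : Summable a) (hb : Summable b) (z : Circle) :
    symb (conv a b) z = symb a z * symb b z := by
  have hs : Summable (fun p : ℤ × ℤ => ((a p.1 : ℂ) * (z : ℂ) ^ p.1) * ((b p.2 : ℂ) * (z : ℂ) ^ p.2)) :=
    summable_mul_of_summable_norm (f := fun j : ℤ => (a j : ℂ) * (z : ℂ) ^ j)
      (g := fun j : ℤ => (b j : ℂ) * (z : ℂ) ^ j) (hasSum_symb ha z).summable.norm (hasSum_symb hb z).summable.norm
  have h1 := tsum_shear hs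
  have h2 : ∑' j : ℤ, ∑' i : ℤ, ((a j : ℂ) * (z : ℂ) ^ j) * ((b i : ℂ) * (z : ℂ) ^ i) =
      symb a z * symb b z := by
    have h3 : ∀ j : ℤ, ∑' i : ℤ, ((a j : ℂ) * (z : ℂ) ^ j) * ((b i : ℂ) * (z : ℂ) ^ i) =
        ((a j : ℂ) * (z : ℂ) ^ j) * symb b z := fun j => tsum_mul_left
    rw [tsum_congr h3, tsum_mul_right]
    rfl
  rw [← h2, h1, symb]
  congr 1; ext m
  rw [conv, Complex.ofReal_tsum, ← tsum_mul_right]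
  congr 1; ext i
  have : (z : ℂ) ^ m = (z : ℂ) ^ (m - i) * (z : ℂ) ^ i := by
    rw [← zpow_add₀ z.coe_ne_zero]; congr 1; ring
  rw [this]; push_cast; ring

section

variable [CompleteSpace H]

lemma summable_filt {a : ℤ → ℝ} (ha : Summable a) {Y : ℤ → H} (hY : BddSeq Y) (t : ℤ) :
    Summable (fun j => a j • Y (t - j)) := by
  obtain ⟨M, hM⟩ := hY
  apply Summable.of_norm_bounded (ha.abs.mul_right M)
  intro j
  rw [norm_smul]
  exact mul_le_mul_of_nonneg_left (hM _) (abs_nonneg _)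

lemma hasSum_filt {a : ℤ → ℝ} (ha : Summable a) {Y : ℤ → H} (hY : BddSeq Y) (t : ℤ) :
    HasSum (fun j => a j • Y (t - j)) (filt a Y t) := (summable_filt ha hY t).hasSum

lemma filt_conv {a b : ℤ → ℝ} (ha : Summable a) (hb : Summable b) {Y : ℤ → H} (hY : BddSeq Y)
    (t : ℤ) : filt a (filt b Y) t = filt (conv a b) Y t := by
  have hs : Summable (fun p : ℤ × ℤ => (a p.1 * b p.2) • Y (t - p.1 - p.2)) := by
    obtain ⟨M, hM⟩ := hY
    have h := (summable_mul_of_summable_norm ha.norm hb.norm)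
    apply Summable.of_norm_bounded (h.norm.mul_right M)
    intro p
    rw [norm_smul]
    exact mul_le_mul_of_nonneg_left (hM _) (norm_nonneg _)
  have h1 := tsum_shear hs
  simp only at h1
  have h2 : filt a (filt b Y) t = ∑' j, ∑' i, (a j * b i) • Y (t - j - i) := by
    simp only [filt]
    congr 1; ext j
    rw [← (summable_filt hb hY (t - j)).tsum_const_smul]
    simp_rw [mul_smul]
  rw [h2, h1, filt]
  congr 1; ext m
  have h3 : Summable fun i : ℤ => a (m - i) * b i := (summable_shear ha hb).prod_factor m
  have h4 : ∀ i : ℤ, t - (m - i) - i = t - m := fun i => by ring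
  simp_rw [h4]
  rw [conv, h3.tsum_smul_const]

/-- Filters compose as their symbols multiply. -/
lemma filt_filt {a b c : ℤ → ℝ} (ha : Summable a) (hb : Summable b) (hc : Summable c)
    (h : ∀ z, symb a z * symb b z = symb c z) {Y : ℤ → H} (hY : BddSeq Y) :
    filt a (filt b Y) = filt c Y := by
  have : conv a b = c :=
    eq_of_symb_eq (summable_conv ha hb) hc fun z => by rw [symb_conv ha hb, h]
  ext t
  rw [filt_conv ha hb hY, this]

lemma filt_comm {a b : ℤ → ℝ} (ha : Summable a) (hb : Summable b) {Y : ℤ → H} (hY : BddSeq Y) :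
    filt a (filt b Y) = filt b (filt a Y) := by
  rw [filt_filt ha hb (summable_conv ha hb) (fun z => (symb_conv ha hb z).symm) hY,
    filt_filt hb ha (summable_conv ha hb)
      (fun z => by rw [symb_conv ha hb z, mul_comm]) hY]

lemma filt_sub {a b : ℤ → ℝ} (ha : Summable a) (hb : Summable b) {Y : ℤ → H} (hY : BddSeq Y)
    (t : ℤ) : filt (a - b) Y t = filt a Y t - filt b Y t := by
  simp only [filt, Pi.sub_apply, sub_smul]
  exact (summable_filt ha hY t).tsum_sub (summable_filt hb hY t)

end

lemma symb_sub {a b : ℤ → ℝ} (ha : Summable a) (hb : Summable b) (z : Circle) :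
    symb (a - b) z = symb a z - symb b z := by
  simp only [symb, Pi.sub_apply, Complex.ofReal_sub, sub_mul]
  exact (hasSum_symb ha z).summable.tsum_sub (hasSum_symb hb z).summable

/-- The identity filter. -/
def unitSeq : ℤ → ℝ := Pi.single 0 1

lemma summable_unitSeq : Summable unitSeq :=
  summable_of_ne_finset_zero (s := {0}) fun j hj => by
    simp [unitSeq, Pi.single_apply] at *; exact hj

lemma symb_unitSeq (z : Circle) : symb unitSeq z = 1 := by
  rw [symb, tsum_eq_single 0]
  · simp [unitSeq]
  · intro j hj; simp [unitSeq, hj]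

lemma filt_unitSeq (Y : ℤ → H) : filt unitSeq Y = Y := by
  ext t
  rw [filt, tsum_eq_single 0]
  · simp [unitSeq]
  · intro j hj; simp [unitSeq, hj]

/-! ### One-sided sequences -/

/-- Extension of a sequence indexed by `ℕ` by zero. -/
def extNat (a : ℕ → ℝ) (j : ℤ) : ℝ := if 0 ≤ j then a j.toNat else 0

@[simp] lemma extNat_natCast (a : ℕ → ℝ) (n : ℕ) : extNat a n = a n := by simp [extNat]

lemma extNat_of_neg (a : ℕ → ℝ) {j : ℤ} (hj : j < 0) : extNat a j = 0 := by
  simp [extNat, not_le.mpr hj]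

lemma extNat_eq_zero (a : ℕ → ℝ) (j : ℤ) (hj : j ∉ Set.range ((↑) : ℕ → ℤ)) : extNat a j = 0 := by
  apply extNat_of_neg
  by_contra h
  exact hj ⟨j.toNat, by omega⟩

lemma summable_extNat {a : ℕ → ℝ} : Summable (extNat a) ↔ Summable a := by
  rw [← Function.Injective.summable_iff Nat.cast_injective (extNat_eq_zero a)]
  simp [Function.comp_def]

lemma symb_extNat (a : ℕ → ℝ) (z : Circle) : symb (extNat a) z = ∑' n, (a n : ℂ) * (z : ℂ) ^ n := by
  rw [symb, ← Function.Injective.tsum_eq (g := ((↑) : ℕ → ℤ)) Nat.cast_injective]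
  · simp
  · intro j hj
    by_contra h
    rw [Function.mem_support] at hj
    simp [extNat_eq_zero a j h] at hj

lemma filt_extNat (a : ℕ → ℝ) (Y : ℤ → H) (t : ℤ) :
    filt (extNat a) Y t = ∑' n : ℕ, a n • Y (t - n) := by
  rw [filt, ← Function.Injective.tsum_eq (g := ((↑) : ℕ → ℤ)) Nat.cast_injective]
  · simp
  · intro j hj
    by_contra h
    rw [Function.mem_support] at hj
    simp [extNat_eq_zero a j h] at hj

/-- Truncation of a sequence. -/
def trunc (n : ℕ) (a : ℕ → ℝ) (k : ℕ) : ℝ := if k < n then a k else 0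

lemma summable_trunc (n : ℕ) (a : ℕ → ℝ) : Summable (trunc n a) :=
  summable_of_ne_finset_zero (s := Finset.range n) fun j hj => by
    simp only [trunc, Finset.mem_range] at *; simp [hj]

lemma filt_trunc (n : ℕ) (a : ℕ → ℝ) (Y : ℤ → H) (t : ℤ) :
    filt (extNat (trunc n a)) Y t = ∑ k ∈ Finset.range n, a k • Y (t - k) := by
  rw [filt_extNat, tsum_eq_sum (s := Finset.range n)]
  · apply Finset.sum_congr rfl
    intro k hk
    simp [trunc, Finset.mem_range.mp hk]
  · intro j hj
    simp only [trunc, Finset.mem_range] at *; simp [hj]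

lemma symb_trunc (n : ℕ) (a : ℕ → ℝ) (z : Circle) :
    symb (extNat (trunc n a)) z = ∑ k ∈ Finset.range n, (a k : ℂ) * (z : ℂ) ^ k := by
  rw [symb_extNat, tsum_eq_sum (s := Finset.range n)]
  · apply Finset.sum_congr rfl
    intro k hk
    simp [trunc, Finset.mem_range.mp hk]
  · intro j hj
    simp only [trunc, Finset.mem_range] at *; simp [hj]

/-- The coefficients of a polynomial, as a summable sequence indexed by `ℤ`. -/
def polySeq (p : ℝ[X]) : ℤ → ℝ := extNat (trunc (p.natDegree + 1) p.coeff)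

lemma summable_polySeq (p : ℝ[X]) : Summable (polySeq p) :=
  summable_extNat.mpr (summable_trunc _ _)

lemma symb_polySeq (p : ℝ[X]) (z : Circle) : symb (polySeq p) z = aeval (z : ℂ) p := by
  rw [polySeq, symb_trunc, aeval_eq_sum_range]
  simp [Algebra.smul_def]

lemma filt_polySeq (p : ℝ[X]) (Y : ℤ → H) (t : ℤ) :
    filt (polySeq p) Y t = ∑ k ∈ Finset.range (p.natDegree + 1), p.coeff k • Y (t - k) := by
  rw [polySeq, filt_trunc]

end Filters

/-! ### Spectral measures -/

section Spectral

variable {H : Type*} [NormedAddCommGroup H] [InnerProductSpace ℝ H]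

/-- `F` is a spectral measure of the sequence `Y`. -/
def HasSpec (Y : ℤ → H) (F : Measure Circle) : Prop :=
  ∀ t u, ((inner ℝ (Y t) (Y u) : ℝ) : ℂ) = ∫ z : Circle, (z : ℂ) ^ (t - u) ∂F

/-- `g` is a cross-spectral density of `Y` and `Z` with respect to `F`. -/
def CrossSpec (Y Z : ℤ → H) (F : Measure Circle) (g : Circle → ℂ) : Prop :=
  Integrable g F ∧
    ∀ t u, ((inner ℝ (Y t) (Z u) : ℝ) : ℂ) = ∫ z : Circle, (z : ℂ) ^ (t - u) * g z ∂F

variable {F : Measure Circle}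

lemma integrable_of_continuous [IsFiniteMeasure F] {E : Type*} [NormedAddCommGroup E]
    {g : Circle → E} (hg : Continuous g) : Integrable g F :=
  hg.integrable_of_hasCompactSupport (HasCompactSupport.of_compactSpace _)

lemma norm_zpow_mul (k : ℤ) (z : Circle) (w : ℂ) : ‖(z : ℂ) ^ k * w‖ = ‖w‖ := by
  rw [norm_mul, norm_zpow, Circle.norm_coe, one_zpow, one_mul]

lemma integrable_zpow_mul (k : ℤ) {g : Circle → ℂ} (hg : Integrable g F) :
    Integrable (fun z : Circle => (z : ℂ) ^ k * g z) F := by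
  refine hg.mono ((continuous_coe_zpow k).aestronglyMeasurable.mul hg.aestronglyMeasurable) ?_
  exact Eventually.of_forall fun z => (norm_zpow_mul k z (g z)).le

lemma conj_coe_zpow (z : Circle) (k : ℤ) :
    (starRingEnd ℂ) ((z : ℂ) ^ k) = (z : ℂ) ^ (-k) := by
  rw [map_zpow₀, ← Circle.coe_inv_eq_conj, Circle.coe_inv, inv_zpow, zpow_neg]

lemma CrossSpec.symm {Y Z : ℤ → H} {g : Circle → ℂ} (h : CrossSpec Y Z F g) :
    CrossSpec Z Y F (fun z => (starRingEnd ℂ) (g z)) := by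
  refine ⟨(LinearIsometryEquiv.integrable_comp_iff Complex.conjLIE).mpr h.1, fun t u => ?_⟩
  rw [real_inner_comm, ← Complex.conj_ofReal, h.2 u t, ← integral_conj]
  congr 1; ext z
  rw [map_mul, conj_coe_zpow, neg_sub]

/-- A delay by `j` in the second argument multiplies the integrand by `z^j`. Cross-spectra are used
so that the two arguments of an inner product can be filtered one at a time. -/
lemma CrossSpec.filt_right [CompleteSpace H] {Y Z : ℤ → H} {g : Circle → ℂ}
    (h : CrossSpec Y Z F g) (hZ : BddSeq Z) {a : ℤ → ℝ} (ha : Summable a) :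
    CrossSpec Y (filt a Z) F (fun z => symb a z * g z) := by
  refine ⟨?_, fun t u => ?_⟩
  · exact h.1.bdd_mul (continuous_symb ha).aestronglyMeasurable
      (Eventually.of_forall (norm_symb_le ha))
  · have h1 : HasSum (fun j => ((inner ℝ (Y t) (a j • Z (u - j)) : ℝ) : ℂ))
        ((inner ℝ (Y t) (filt a Z u) : ℝ) : ℂ) :=
      Complex.hasSum_ofReal.mpr ((innerSL ℝ (Y t)).hasSum (hasSum_filt ha hZ u))
    have h2 := hasSum_integral_of_summable_integral_norm (μ := F)
      (F := fun (j : ℤ) (z : Circle) => (a j : ℂ) * ((z : ℂ) ^ (t - (u - j)) * g z)) ?_ ?_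
    · have h3 : (fun j => ((inner ℝ (Y t) (a j • Z (u - j)) : ℝ) : ℂ)) = fun j =>
          ∫ z : Circle, (a j : ℂ) * ((z : ℂ) ^ (t - (u - j)) * g z) ∂F := by
        ext j
        rw [inner_smul_right, Complex.ofReal_mul, h.2, integral_const_mul]
      rw [h3] at h1
      rw [h1.unique h2]
      · congr 1; ext z
        simp only [symb]
        rw [ ← tsum_mul_right, ← tsum_mul_left]
        congr 1; ext j
        have : (z : ℂ) ^ (t - (u - j)) = (z : ℂ) ^ (t - u) * (z : ℂ) ^ j := by
          rw [← zpow_add₀ z.coe_ne_zero]; congr 1; ring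
        rw [this]; ring
    · intro j
      exact (integrable_zpow_mul _ h.1).const_mul _
    · simp only [norm_mul, norm_zpow, Circle.norm_coe, one_zpow, one_mul, Complex.norm_real,
        integral_const_mul]
      exact ha.norm.mul_right _

lemma CrossSpec.filt_left [CompleteSpace H] {Y Z : ℤ → H} {g : Circle → ℂ}
    (h : CrossSpec Y Z F g) (hY : BddSeq Y) {a : ℤ → ℝ} (ha : Summable a) :
    CrossSpec (filt a Y) Z F (fun z => (starRingEnd ℂ) (symb a z) * g z) := by
  have := (h.symm.filt_right hY ha).symm
  simpa only [map_mul, Complex.conj_conj] using this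

lemma HasSpec.crossSpec [IsFiniteMeasure F] {Y : ℤ → H} (h : HasSpec Y F) :
    CrossSpec Y Y F (fun _ => 1) :=
  ⟨integrable_const _, fun t u => by simpa using h t u⟩

lemma HasSpec.norm_sq {Y : ℤ → H} (h : HasSpec Y F) (t : ℤ) : ‖Y t‖ ^ 2 = F.real Set.univ := by
  have := h t t
  simp only [sub_self, zpow_zero, integral_const, real_inner_self_eq_norm_sq] at this
  have h2 : (((‖Y t‖ ^ 2 : ℝ)) : ℂ) = ((F.real Set.univ : ℝ) : ℂ) := by simpa using this
  exact_mod_cast h2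

lemma HasSpec.bddSeq {Y : ℤ → H} (h : HasSpec Y F) : BddSeq Y :=
  ⟨√(F.real Set.univ), fun t => by rw [← h.norm_sq t, Real.sqrt_sq (norm_nonneg _)]⟩

lemma HasSpec.inner_filt [CompleteSpace H] [IsFiniteMeasure F] {Y : ℤ → H} (h : HasSpec Y F)
    {a b : ℤ → ℝ} (ha : Summable a) (hb : Summable b) (t u : ℤ) :
    ((inner ℝ (filt a Y t) (filt b Y u) : ℝ) : ℂ) =
      ∫ z : Circle, (z : ℂ) ^ (t - u) * ((starRingEnd ℂ) (symb a z) * symb b z) ∂F := by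
  have := ((h.crossSpec.filt_right h.bddSeq hb).filt_left h.bddSeq ha).2 t u
  simpa only [mul_one] using this

lemma HasSpec.inner_filt_self [CompleteSpace H] [IsFiniteMeasure F] {Y : ℤ → H} (h : HasSpec Y F)
    {a : ℤ → ℝ} (ha : Summable a) (t u : ℤ) :
    ((inner ℝ (filt a Y t) (filt a Y u) : ℝ) : ℂ) =
      ∫ z : Circle, (z : ℂ) ^ (t - u) * (‖symb a z‖ ^ 2 : ℝ) ∂F := by
  rw [h.inner_filt ha ha]
  congr 1; ext z
  rw [Complex.conj_mul']
  push_cast; rfl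

lemma HasSpec.norm_filt_sq [CompleteSpace H] [IsFiniteMeasure F] {Y : ℤ → H} (h : HasSpec Y F)
    {a : ℤ → ℝ} (ha : Summable a) (t : ℤ) :
    ‖filt a Y t‖ ^ 2 = ∫ z, ‖symb a z‖ ^ 2 ∂F := by
  have := h.inner_filt_self ha t t
  simp only [sub_self, zpow_zero, one_mul, real_inner_self_eq_norm_sq] at this
  rw [integral_complex_ofReal] at this
  exact_mod_cast this

lemma HasSpec.norm_filt_sub_sq [CompleteSpace H] [IsFiniteMeasure F] {Y : ℤ → H}
    (h : HasSpec Y F) {a b : ℤ → ℝ} (ha : Summable a) (hb : Summable b) (t : ℤ) :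
    ‖filt a Y t - filt b Y t‖ ^ 2 = ∫ z, ‖symb a z - symb b z‖ ^ 2 ∂F := by
  have hab : Summable (a - b) := ha.sub hb
  rw [← filt_sub ha hb h.bddSeq, h.norm_filt_sq hab]
  simp_rw [← symb_sub ha hb]

lemma HasSpec.norm_filt_sub_self_sq [CompleteSpace H] [IsFiniteMeasure F] {Y : ℤ → H}
    (h : HasSpec Y F) {a : ℤ → ℝ} (ha : Summable a) (t : ℤ) :
    ‖filt a Y t - Y t‖ ^ 2 = ∫ z, ‖symb a z - 1‖ ^ 2 ∂F := by
  have := h.norm_filt_sub_sq ha summable_unitSeq t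
  simpa only [filt_unitSeq, symb_unitSeq] using this

lemma integral_withDensity_ofReal {f : Circle → ℝ} (hf : Measurable f) (h0 : ∀ z, 0 ≤ f z)
    (g : Circle → ℂ) :
    ∫ z, g z ∂(F.withDensity fun z => ENNReal.ofReal (f z)) = ∫ z, g z * (f z : ℝ) ∂F := by
  rw [integral_withDensity_eq_integral_toReal_smul (by fun_prop)
    (Eventually.of_forall fun _ => ENNReal.ofReal_lt_top)]
  congr 1; ext z
  rw [ENNReal.toReal_ofReal (h0 z), Complex.real_smul, mul_comm]

lemma HasSpec.hasSpec_filt [CompleteSpace H] [IsFiniteMeasure F] {Y : ℤ → H} (h : HasSpec Y F)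
    {a : ℤ → ℝ} (ha : Summable a) :
    HasSpec (filt a Y) (F.withDensity fun z => ENNReal.ofReal (‖symb a z‖ ^ 2)) := by
  intro t u
  have hm : Measurable fun z => ‖symb a z‖ ^ 2 := ((continuous_symb ha).norm.pow 2).measurable
  rw [h.inner_filt_self ha, integral_withDensity_ofReal hm fun z => sq_nonneg _]

end Spectral

/-! ### Existence of spectral measures -/

section Herglotz

variable {H : Type*} [NormedAddCommGroup H] [InnerProductSpace ℝ H]

/-- The periodogram of `Y_0, …, Y_{N-1}`. -/
def periodogram (Y : ℤ → H) (N : ℕ) (z : Circle) : ℝ :=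
  (‖∑ j ∈ Finset.range N, ((z : ℂ) ^ (j : ℤ)).re • Y j‖ ^ 2 +
    ‖∑ j ∈ Finset.range N, ((z : ℂ) ^ (j : ℤ)).im • Y j‖ ^ 2) / (2 * Real.pi * N)

lemma continuous_periodogram (Y : ℤ → H) (N : ℕ) : Continuous (periodogram Y N) := by
  unfold periodogram
  refine Continuous.div_const (Continuous.add ?_ ?_) _
  · refine ((continuous_finsetSum _ fun j _ => ?_).norm).pow 2
    exact (Complex.continuous_re.comp (continuous_coe_zpow j)).smul continuous_const
  · refine ((continuous_finsetSum _ fun j _ => ?_).norm).pow 2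
    exact (Complex.continuous_im.comp (continuous_coe_zpow j)).smul continuous_const

lemma periodogram_nonneg (Y : ℤ → H) (N : ℕ) (z : Circle) : 0 ≤ periodogram Y N z := by
  have := Real.pi_pos
  unfold periodogram; positivity

/-- As `H` is a real space, `‖∑ z^j Y_j‖²` is represented by the real and imaginary parts of `z^j`
separately. The remaining imaginary part of the double sum is antisymmetric in `(j, l)` and vanishes
because `γ` is even. -/
lemma periodogram_eq {Y : ℤ → H} {γ : ℤ → ℝ} (h : ∀ t u, inner ℝ (Y t) (Y u) = γ (t - u))
    (N : ℕ) (z : Circle) :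
    (periodogram Y N z : ℂ) = (∑ j ∈ Finset.range N, ∑ l ∈ Finset.range N,
      (γ (j - l) : ℂ) * (z : ℂ) ^ ((l : ℤ) - j)) / (2 * Real.pi * N) := by
  have h1 : ∀ f : ℕ → ℝ, ‖∑ j ∈ Finset.range N, f j • Y j‖ ^ 2 =
      ∑ j ∈ Finset.range N, ∑ l ∈ Finset.range N, f j * f l * γ (j - l) := by
    intro f
    rw [← real_inner_self_eq_norm_sq, sum_inner]
    refine Finset.sum_congr rfl fun j _ => ?_
    rw [inner_sum]
    refine Finset.sum_congr rfl fun l _ => ?_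
    rw [inner_smul_left, inner_smul_right, h]
    simp; ring
  have hsymm : ∀ m, γ (-m) = γ m := fun m => by
    rw [← zero_sub, ← h, real_inner_comm, h, sub_zero]
  have key : ∀ j l : ℕ, (z : ℂ) ^ ((l : ℤ) - j) =
      (((z : ℂ) ^ (j : ℤ)).re * ((z : ℂ) ^ (l : ℤ)).re + ((z : ℂ) ^ (j : ℤ)).im * ((z : ℂ) ^ (l : ℤ)).im : ℝ) +
      (((z : ℂ) ^ (j : ℤ)).re * ((z : ℂ) ^ (l : ℤ)).im - ((z : ℂ) ^ (j : ℤ)).im * ((z : ℂ) ^ (l : ℤ)).re : ℝ)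
        * Complex.I := by
    intro j l
    rw [sub_eq_add_neg, zpow_add₀ z.coe_ne_zero, ← conj_coe_zpow]
    generalize (z : ℂ) ^ (j : ℤ) = w
    generalize (z : ℂ) ^ (l : ℤ) = w'
    apply Complex.ext <;> simp <;> ring
  have hzero : ∑ j ∈ Finset.range N, ∑ l ∈ Finset.range N, γ (j - l) *
      (((z : ℂ) ^ (j : ℤ)).re * ((z : ℂ) ^ (l : ℤ)).im -
        ((z : ℂ) ^ (j : ℤ)).im * ((z : ℂ) ^ (l : ℤ)).re) = 0 := by
    have : ∀ x : ℝ, x = -x → x = 0 := fun x hx => by linarith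
    apply this
    conv_lhs => rw [Finset.sum_comm]
    rw [← Finset.sum_neg_distrib]
    refine Finset.sum_congr rfl fun j _ => ?_
    rw [← Finset.sum_neg_distrib]
    refine Finset.sum_congr rfl fun l _ => ?_
    rw [← hsymm, neg_sub]
    ring
  rw [periodogram]
  push_cast
  congr 1
  have h2 := h1 fun j => ((z : ℂ) ^ (j : ℤ)).re
  have h3 := h1 fun j => ((z : ℂ) ^ (j : ℤ)).im
  rw [← Complex.ofReal_pow, ← Complex.ofReal_pow, h2, h3]
  simp_rw [key, mul_add, ← mul_assoc, Finset.sum_add_distrib, ← Finset.sum_mul]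
  have h4 := congrArg (fun x : ℝ => (x : ℂ)) hzero
  simp only [Complex.ofReal_sum, Complex.ofReal_mul, Complex.ofReal_zero] at h4
  rw [h4, zero_mul, add_zero]
  push_cast
  rw [← Finset.sum_add_distrib]
  refine Finset.sum_congr rfl fun j _ => ?_
  rw [← Finset.sum_add_distrib]
  refine Finset.sum_congr rfl fun l _ => ?_
  ring

/-- The number of `j < N` with `0 ≤ j - k < N`. -/
def overlap (N : ℕ) (k : ℤ) : ℕ :=
  ((Finset.range N).filter fun j : ℕ => 0 ≤ (j : ℤ) - k ∧ (j : ℤ) - k < N).card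

lemma tendsto_overlap (k : ℤ) :
    Tendsto (fun N : ℕ => (overlap N k : ℝ) / N) atTop (𝓝 1) := by
  have h1 : ∀ N : ℕ, (overlap N k : ℝ) ≤ N := fun N => by
    exact_mod_cast (Finset.card_filter_le _ _).trans (Finset.card_range N).le
  have h2 : ∀ N : ℕ, (N : ℝ) - k.natAbs ≤ overlap N k := fun N => by
    have : Finset.Ico k.toNat (N - (-k).toNat) ⊆
        (Finset.range N).filter fun j : ℕ => 0 ≤ (j : ℤ) - k ∧ (j : ℤ) - k < N := by
      intro j hj
      simp only [Finset.mem_Ico, Finset.mem_filter, Finset.mem_range] at *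
      omega
    have h3 := Finset.card_le_card this
    rw [Nat.card_Ico] at h3
    have h4 : N ≤ overlap N k + k.natAbs := by unfold overlap; omega
    have : (N : ℝ) ≤ overlap N k + k.natAbs := by exact_mod_cast h4
    linarith
  have h3 : Tendsto (fun N : ℕ => 1 - (k.natAbs : ℝ) / N) atTop (𝓝 1) := by
    simpa using (tendsto_const_nhds (x := (1 : ℝ))).sub
      (tendsto_const_div_atTop_nhds_zero_nat (k.natAbs : ℝ))
  refine tendsto_of_tendsto_of_tendsto_of_le_of_le' h3 tendsto_const_nhds ?_ ?_
  · filter_upwards [eventually_gt_atTop 0] with N hN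
    have : (0 : ℝ) < N := by exact_mod_cast hN
    rw [le_div_iff₀ this, sub_mul, div_mul_cancel₀ _ this.ne']
    linarith [h2 N]
  · filter_upwards with N
    exact div_le_one_of_le₀ (h1 N) (Nat.cast_nonneg _)

/-- Only pairs with `j - l = k` survive integration, leaving the covariance times the Fejér factor,
which tends to `1`. -/
lemma integral_zpow_mul_periodogram {Y : ℤ → H} {γ : ℤ → ℝ}
    (h : ∀ t u, inner ℝ (Y t) (Y u) = γ (t - u)) (N : ℕ) (k : ℤ) :
    ∫ z : Circle, (z : ℂ) ^ k * (periodogram Y N z : ℝ) ∂arcLength =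
      γ k * (overlap N k : ℝ) / N := by
  have h1 : ∀ z : Circle, (z : ℂ) ^ k * (periodogram Y N z : ℝ) =
      ∑ j ∈ Finset.range N, ∑ l ∈ Finset.range N,
        ((γ (j - l) : ℂ) / (2 * Real.pi * N)) * (z : ℂ) ^ (k + ((l : ℤ) - j)) := by
    intro z
    rw [periodogram_eq h, Finset.sum_div, Finset.mul_sum]
    refine Finset.sum_congr rfl fun j _ => ?_
    rw [Finset.sum_div, Finset.mul_sum]
    refine Finset.sum_congr rfl fun l _ => ?_
    rw [zpow_add₀ z.coe_ne_zero]
    ring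
  simp_rw [h1]
  have hi : ∀ (c : ℂ) (m : ℤ), Integrable (fun z : Circle => c * (z : ℂ) ^ m) arcLength :=
    fun c m => integrable_of_continuous (continuous_const.mul (continuous_coe_zpow m))
  rw [integral_finsetSum _ fun j _ => integrable_finsetSum _ fun l _ => hi _ _]
  have h2 : ∀ j ∈ Finset.range N, ∫ z : Circle, ∑ l ∈ Finset.range N,
      ((γ (j - l) : ℂ) / (2 * Real.pi * N)) * (z : ℂ) ^ (k + ((l : ℤ) - j)) ∂arcLength =
      if 0 ≤ (j : ℤ) - k ∧ (j : ℤ) - k < N then (γ k : ℂ) / N else 0 := by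
    intro j _
    rw [integral_finsetSum _ fun l _ => hi _ _]
    simp_rw [integral_const_mul, integral_zpow_arcLength]
    split_ifs with hj
    · rw [Finset.sum_eq_single ((j : ℤ) - k).toNat]
      · have h3 : ((((j : ℤ) - k).toNat : ℕ) : ℤ) = j - k := Int.toNat_of_nonneg hj.1
        rw [h3, if_pos (by ring)]
        have : (Real.pi : ℂ) ≠ 0 := by simp [Real.pi_ne_zero]
        push_cast
        rw [show (j : ℤ) - (j - k) = k by ring]
        by_cases hN : (N : ℂ) = 0
        · simp [hN]
        · field_simp
      · intro l _ hl
        rw [if_neg (by omega)]; simp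
      · intro hl
        simp only [Finset.mem_range] at hl
        omega
    · refine Finset.sum_eq_zero fun l hl => ?_
      rw [Finset.mem_range] at hl
      rw [if_neg (by omega)]; simp
  rw [Finset.sum_congr rfl h2, ← Finset.sum_filter, Finset.sum_const, ← overlap]
  simp; ring

/-- Herglotz's theorem: a stationary sequence has a spectral measure. -/
theorem exists_hasSpec {Y : ℤ → H} {γ : ℤ → ℝ} (h : ∀ t u, inner ℝ (Y t) (Y u) = γ (t - u)) :
    ∃ F : Measure Circle, IsFiniteMeasure F ∧ HasSpec Y F := by
  have hγ0 : ∀ t, ‖Y t‖ ^ 2 = γ 0 := fun t => by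
    rw [← real_inner_self_eq_norm_sq, h, sub_self]
  by_cases h0 : γ 0 = 0
  · refine ⟨0, inferInstance, fun t u => ?_⟩
    have : Y t = 0 := by
      have := hγ0 t
      rw [h0] at this
      simpa using this
    simp [this]
  have hpos : 0 < γ 0 := lt_of_le_of_ne (by rw [← hγ0 0]; positivity) (Ne.symm h0)
  -- Dividing by `γ 0` gives probability measures, and the sample size `N + 1` avoids the empty
  -- sample.
  set ν : ℕ → Measure Circle := fun N =>
    arcLength.withDensity fun z => ENNReal.ofReal (periodogram Y (N + 1) z / γ 0) with hν
  have hint : ∀ (N : ℕ) (k : ℤ), ∫ z : Circle, (z : ℂ) ^ k ∂(ν N) =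
      γ k / γ 0 * ((overlap (N + 1) k : ℝ) / (N + 1 : ℕ) : ℝ) := by
    intro N k
    rw [hν, integral_withDensity_ofReal
      ((continuous_periodogram Y (N + 1)).div_const _).measurable
      fun z => div_nonneg (periodogram_nonneg _ _ _) hpos.le]
    have : ∀ z : Circle, (z : ℂ) ^ k * ((periodogram Y (N + 1) z / γ 0 : ℝ) : ℂ) =
        ((z : ℂ) ^ k * (periodogram Y (N + 1) z : ℝ)) / γ 0 := fun z => by push_cast; ring
    simp_rw [this]
    rw [integral_div, integral_zpow_mul_periodogram h]
    push_cast; ring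
  have hprob : ∀ N, IsProbabilityMeasure (ν N) := fun N => by
    have h1 := hint N 0
    have h2 : overlap (N + 1) 0 = N + 1 := by
      unfold overlap
      rw [Finset.filter_true_of_mem, Finset.card_range]
      intro j hj
      rw [Finset.mem_range] at hj
      omega
    have h3 : ((N + 1 : ℕ) : ℂ) ≠ 0 := Nat.cast_ne_zero.mpr (by omega)
    have h4 : (γ 0 : ℂ) ≠ 0 := by exact_mod_cast h0
    rw [h2] at h1
    have h5 : ((((N + 1 : ℕ) : ℝ) / ((N + 1 : ℕ) : ℝ) : ℝ) : ℂ) = 1 := by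
      rw [div_self (Nat.cast_ne_zero.mpr (by omega))]; simp
    rw [h5] at h1
    simp only [zpow_zero, integral_const, mul_one, div_self h4] at h1
    have h6 : (ν N).real Set.univ = 1 := by
      have : (((ν N).real Set.univ : ℝ) : ℂ) = 1 := by simpa using h1
      exact_mod_cast this
    refine ⟨?_⟩
    rw [Measure.real] at h6
    exact (ENNReal.toReal_eq_one_iff _).mp h6
  let P : ℕ → ProbabilityMeasure Circle := fun N => ⟨ν N, hprob N⟩
  -- Probability measures on the compact circle form a compact space, so an ultrafilter limit exists
  -- without extracting a subsequence.
  let u : Ultrafilter (ProbabilityMeasure Circle) := Ultrafilter.map P (hyperfilter ℕ)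
  obtain ⟨Q, -, hQ⟩ := isCompact_univ.ultrafilter_le_nhds u (by simp)
  have hT : Tendsto P (hyperfilter ℕ : Filter ℕ) (𝓝 Q) := hQ
  have hle : (hyperfilter ℕ : Filter ℕ) ≤ atTop := Nat.hyperfilter_le_atTop
  have hlim : ∀ k : ℤ, ∫ z : Circle, (z : ℂ) ^ k ∂(Q : Measure Circle) = γ k / γ 0 := by
    intro k
    have h1 := (ProbabilityMeasure.tendsto_iff_forall_integral_rclike_tendsto ℂ).mp hT
      (BoundedContinuousFunction.mkOfCompact ⟨fun z : Circle => (z : ℂ) ^ k, continuous_coe_zpow k⟩)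
    refine tendsto_nhds_unique h1 ?_
    have h2 : ∀ N, ∫ z : Circle, (z : ℂ) ^ k ∂((P N : ProbabilityMeasure Circle) : Measure Circle) =
      γ k / γ 0 * ((overlap (N + 1) k : ℝ) / (N + 1 : ℕ) : ℝ) := fun N => hint N k
    simp only [BoundedContinuousFunction.mkOfCompact_apply, ContinuousMap.coe_mk]
    simp_rw [h2]
    have h3 := (Complex.continuous_ofReal.tendsto _).comp
      ((tendsto_overlap k).comp (tendsto_add_atTop_nat 1))
    have h4 := (h3.mono_left hle).const_mul ((γ k : ℂ) / γ 0)
    simpa using h4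
  refine ⟨ENNReal.ofReal (γ 0) • (Q : Measure Circle), ?_, fun t u => ?_⟩
  · exact Measure.smul_finite _ ENNReal.ofReal_ne_top
  · rw [h, integral_smul_measure, hlim, ENNReal.toReal_ofReal hpos.le, Complex.real_smul,
      mul_div_cancel₀]
    exact_mod_cast h0

end Herglotz

/-! ### The fractional filter as an analytic function -/

/-- The function `(1 - ζ)^d (1 - ζ^s)^D`. -/
def nabla (s : ℕ) (d D : ℝ) (ζ : ℂ) : ℂ := (1 - ζ) ^ (d : ℂ) * (1 - ζ ^ s) ^ (D : ℂ)

lemma hasSum_fracCoeff (x : ℝ) {ζ : ℂ} (hζ : ‖ζ‖ < 1) :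
    HasSum (fun n => (fracCoeff x n : ℂ) * ζ ^ n) ((1 - ζ) ^ (x : ℂ)) := by
  have h := (Complex.one_add_cpow_hasFPowerSeriesOnBall_zero (a := (x : ℂ))).hasSum
    (y := -ζ) (by
      rw [← ENNReal.ofReal_one, Metric.eball_ofReal]
      simpa using hζ)
  rw [zero_add, ← sub_eq_add_neg] at h
  refine (congrArg (HasSum · ((1 - ζ) ^ (x : ℂ))) (funext fun n => ?_)).mp h
  rw [binomialSeries_apply, List.ofFn_const, List.prod_replicate, smul_eq_mul, fracCoeff,
    ← Complex.ofReal_choose, neg_pow]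
  push_cast; ring

lemma hasSum_nablaCoeff {s : ℕ} (hs : 0 < s) (d D : ℝ) {ζ : ℂ} (hζ : ‖ζ‖ < 1) :
    HasSum (fun n => (nablaCoeff s d D n : ℂ) * ζ ^ n) (nabla s d D ζ) := by
  have h1 := hasSum_fracCoeff d hζ
  have hζs : ‖ζ ^ s‖ < 1 := by
    rw [norm_pow]; exact pow_lt_one₀ (norm_nonneg _) hζ hs.ne'
  have h2 : HasSum (fun k => ((if s ∣ k then fracCoeff D (k / s) else 0 : ℝ) : ℂ) * ζ ^ k)
      ((1 - ζ ^ s) ^ (D : ℂ)) := by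
    have hinj : Function.Injective (fun k : ℕ => s * k) := fun a b h =>
      Nat.eq_of_mul_eq_mul_left hs h
    rw [← hinj.hasSum_iff]
    · convert hasSum_fracCoeff D hζs using 1
      ext k
      simp [Nat.mul_div_cancel_left _ hs, pow_mul]
    · intro k hk
      rw [if_neg]
      · simp
      · rintro ⟨j, rfl⟩
        exact hk ⟨j, rfl⟩
  have h3 := hasSum_sum_range_mul_of_summable_norm h1.summable.norm h2.summable.norm
  rw [h1.tsum_eq, h2.tsum_eq] at h3
  refine (congrArg (HasSum · (nabla s d D ζ)) (funext fun n => ?_)).mp h3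
  symm
  rw [nablaCoeff, PowerSeries.coeff_mul, Finset.Nat.sum_antidiagonal_eq_sum_range_succ_mk]
  push_cast
  rw [Finset.sum_mul]
  refine Finset.sum_congr rfl fun k hk => ?_
  have hk' : k ≤ n := Nat.lt_succ_iff.mp (Finset.mem_range.mp hk)
  rw [PowerSeries.coeff_mk, PowerSeries.coeff_mk]
  have : ζ ^ n = ζ ^ k * ζ ^ (n - k) := by rw [← pow_add, Nat.add_sub_cancel' hk']
  rw [this]; ring

/-- The coefficients of `(1 - r z)^d (1 - (r z)^s)^D`. -/
def radCoeff (s : ℕ) (d D r : ℝ) (n : ℕ) : ℝ := nablaCoeff s d D n * r ^ n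

lemma summable_radCoeff {s : ℕ} (hs : 0 < s) (d D : ℝ) {r : ℝ} (h0 : 0 ≤ r) (h1 : r < 1) :
    Summable (radCoeff s d D r) := by
  have h := (hasSum_nablaCoeff hs d D (ζ := (r : ℂ))
    (by rwa [Complex.norm_real, Real.norm_of_nonneg h0])).summable
  rw [← Complex.summable_ofReal]
  convert h using 1
  ext n; simp [radCoeff]

lemma norm_mul_circle_lt {r : ℝ} (h0 : 0 ≤ r) (h1 : r < 1) (z : Circle) : ‖(r : ℂ) * z‖ < 1 := by
  rwa [norm_mul, Circle.norm_coe, mul_one, Complex.norm_real, Real.norm_of_nonneg h0]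

/-- The filter `(1 - r B)^d (1 - (r B)^s)^D`, as a sequence indexed by `ℤ`. -/
def radSeq (s : ℕ) (d D r : ℝ) : ℤ → ℝ := extNat (radCoeff s d D r)

lemma summable_radSeq {s : ℕ} (hs : 0 < s) (d D : ℝ) {r : ℝ} (h0 : 0 ≤ r) (h1 : r < 1) :
    Summable (radSeq s d D r) := summable_extNat.mpr (summable_radCoeff hs d D h0 h1)

lemma symb_radSeq {s : ℕ} (hs : 0 < s) (d D : ℝ) {r : ℝ} (h0 : 0 ≤ r) (h1 : r < 1) (z : Circle) :
    symb (radSeq s d D r) z = nabla s d D (r * z) := by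
  rw [radSeq, symb_extNat, ← (hasSum_nablaCoeff hs d D (norm_mul_circle_lt h0 h1 z)).tsum_eq]
  congr 1; ext n
  simp [radCoeff]; ring

lemma one_sub_ne_zero_of_norm_lt {ζ : ℂ} (hζ : ‖ζ‖ < 1) : 1 - ζ ≠ 0 := by
  intro h
  rw [sub_eq_zero] at h
  rw [← h] at hζ
  simp at hζ

lemma norm_pow_lt_one {s : ℕ} (hs : 0 < s) {ζ : ℂ} (hζ : ‖ζ‖ < 1) : ‖ζ ^ s‖ < 1 := by
  rw [norm_pow]; exact pow_lt_one₀ (norm_nonneg _) hζ hs.ne'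

lemma nabla_neg (s : ℕ) (d D : ℝ) (ζ : ℂ) : nabla s (-d) (-D) ζ = (nabla s d D ζ)⁻¹ := by
  rw [nabla, nabla, mul_inv]
  push_cast
  rw [Complex.cpow_neg, Complex.cpow_neg]

lemma nabla_ne_zero {s : ℕ} {d D : ℝ} {ζ : ℂ} (h1 : 1 - ζ ≠ 0) (h2 : 1 - ζ ^ s ≠ 0) :
    nabla s d D ζ ≠ 0 := by
  simp [nabla, Complex.cpow_eq_zero_iff, h1, h2]

/-- The roots of unity of order dividing `s`. -/
def unitRoots (s : ℕ) : Set Circle := {z | (z : ℂ) ^ s = 1}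

lemma measurableSet_unitRoots (s : ℕ) : MeasurableSet (unitRoots s) :=
  (isClosed_eq (by fun_prop) continuous_const).measurableSet

lemma one_sub_pow_ne_zero {s : ℕ} {z : Circle} (hz : z ∉ unitRoots s) : 1 - (z : ℂ) ^ s ≠ 0 :=
  fun h => hz (sub_eq_zero.mp h).symm

lemma one_sub_ne_zero {s : ℕ} {z : Circle} (hz : z ∉ unitRoots s) : 1 - (z : ℂ) ≠ 0 := by
  intro h
  apply hz
  rw [unitRoots, Set.mem_ofPred_eq, ← sub_eq_zero.mp h, one_pow]

lemma nabla_circle_ne_zero {s : ℕ} {z : Circle} (hz : z ∉ unitRoots s) (d D : ℝ) :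
    nabla s d D z ≠ 0 := nabla_ne_zero (one_sub_ne_zero hz) (one_sub_pow_ne_zero hz)

lemma nabla_rad_ne_zero {s : ℕ} (hs : 0 < s) (d D : ℝ) {r : ℝ} (h0 : 0 ≤ r) (h1 : r < 1)
    (z : Circle) : nabla s d D (r * z) ≠ 0 := by
  have h := norm_mul_circle_lt h0 h1 z
  exact nabla_ne_zero (one_sub_ne_zero_of_norm_lt h)
    (one_sub_ne_zero_of_norm_lt (norm_pow_lt_one hs h))

/-- In the closed unit disc, real part `1` forces `ζ = 1`. Hence the principal branches in `nabla`
are holomorphic away from the roots of unity. -/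
lemma mem_slitPlane_one_sub {ζ : ℂ} (h1 : ‖ζ‖ ≤ 1) (h2 : 1 - ζ ≠ 0) :
    0 < (1 - ζ).re := by
  have h3 := Complex.re_le_norm ζ
  rw [Complex.sub_re, Complex.one_re, sub_pos]
  refine lt_of_le_of_ne (h3.trans h1) fun h => h2 ?_
  have h4 : ‖ζ‖ ^ 2 = ζ.re * ζ.re + ζ.im * ζ.im := by
    rw [← Complex.normSq_eq_norm_sq, Complex.normSq_apply]
  have h5 : ζ.im = 0 := by
    have := norm_nonneg ζ
    rw [h] at h4
    nlinarith [sq_nonneg ζ.im]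
  apply Complex.ext <;> simp [h, h5]

lemma differentiableAt_nabla {s : ℕ} (d D : ℝ) {ζ : ℂ} (h0 : ‖ζ‖ ≤ 1) (h1 : 1 - ζ ≠ 0)
    (h2 : 1 - ζ ^ s ≠ 0) : DifferentiableAt ℂ (nabla s d D) ζ := by
  have h3 : ‖ζ ^ s‖ ≤ 1 := by rw [norm_pow]; exact pow_le_one₀ (norm_nonneg _) h0
  refine DifferentiableAt.mul ?_ ?_
  · refine DifferentiableAt.cpow (by fun_prop) (by fun_prop) ?_
    exact Or.inl (mem_slitPlane_one_sub h0 h1)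
  · refine DifferentiableAt.cpow (by fun_prop) (by fun_prop) ?_
    exact Or.inl (mem_slitPlane_one_sub h3 h2)

lemma tendsto_nabla_rad {s : ℕ} (d D : ℝ) {z : Circle} (hz : z ∉ unitRoots s) :
    Tendsto (fun r : ℝ => nabla s d D (r * z)) (𝓝[<] 1) (𝓝 (nabla s d D z)) := by
  have h1 := (differentiableAt_nabla d D z.norm_coe.le (one_sub_ne_zero hz)
    (one_sub_pow_ne_zero hz)).continuousAt
  have h2 : Tendsto (fun r : ℝ => (r : ℂ) * z) (𝓝[<] 1) (𝓝 z) := by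
    have : Continuous fun r : ℝ => (r : ℂ) * z := by fun_prop
    have h3 := (this.tendsto 1).mono_left (nhdsWithin_le_nhds (s := Set.Iio 1))
    simpa using h3
  exact h1.tendsto.comp h2

lemma measurable_nabla (s : ℕ) (d D : ℝ) : Measurable fun z : Circle => nabla s d D z := by
  unfold nabla
  have : Measurable fun z : Circle => (z : ℂ) :=
    (Continuous.measurable (by fun_prop))
  fun_prop

/-! ### Comparison of the boundary values with the values on smaller circles -/

/-- The polynomial `1 + ζ + ⋯ + ζ^{s-1}`. -/
def geomPoly (s : ℕ) (ζ : ℂ) : ℂ := ∑ i ∈ Finset.range s, ζ ^ i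

lemma one_sub_mul_geomPoly (s : ℕ) (ζ : ℂ) : (1 - ζ) * geomPoly s ζ = 1 - ζ ^ s := by
  have := mul_geom_sum ζ s
  rw [geomPoly]; linear_combination -this

lemma continuous_geomPoly (s : ℕ) : Continuous (geomPoly s) := by
  unfold geomPoly; fun_prop

lemma norm_geomPoly_le (s : ℕ) {ζ : ℂ} (h : ‖ζ‖ ≤ 1) : ‖geomPoly s ζ‖ ≤ s := by
  refine (norm_sum_le _ _).trans ?_
  calc ∑ i ∈ Finset.range s, ‖ζ ^ i‖ ≤ ∑ i ∈ Finset.range s, (1 : ℝ) :=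
        Finset.sum_le_sum fun i _ => by rw [norm_pow]; exact pow_le_one₀ (norm_nonneg _) h
    _ = s := by simp

/-- Factoring `1 - ζ^s` separates the singularity at `1`, of order `d + D`, from those at the other
roots of unity, of order `D`. -/
lemma norm_nabla {s : ℕ} (d D : ℝ) {ζ : ℂ} (h : 1 - ζ ≠ 0) :
    ‖nabla s d D ζ‖ = ‖1 - ζ‖ ^ (d + D) * ‖geomPoly s ζ‖ ^ D := by
  rw [nabla, norm_mul, Complex.norm_cpow_real, Complex.norm_cpow_real, ← one_sub_mul_geomPoly,
    norm_mul, Real.mul_rpow (norm_nonneg _) (norm_nonneg _), ← mul_assoc,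
    Real.rpow_add (norm_pos_iff.mpr h)]

/-- The distance from `rz` to `w` is at least `1 - r`, which is the distance from `rz` to `z`; then
the triangle inequality applies. -/
lemma norm_sub_rad_le {r : ℝ} (h0 : 0 ≤ r) (h1 : r ≤ 1) (z : Circle) {w : ℂ} (hw : ‖w‖ = 1) :
    ‖w - z‖ ≤ 2 * ‖w - r * z‖ := by
  have h2 : ‖(r : ℂ) * z‖ = r := by
    rw [norm_mul, Circle.norm_coe, mul_one, Complex.norm_real, Real.norm_of_nonneg h0]
  have h3 : 1 - r ≤ ‖w - r * z‖ := by
    have := norm_sub_norm_le w (r * z)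
    rwa [hw, h2] at this
  have h4 : ‖(r : ℂ) * z - z‖ = 1 - r := by
    have : (r : ℂ) * z - z = ((r - 1 : ℝ) : ℂ) * z := by push_cast; ring
    rw [this, norm_mul, Circle.norm_coe, mul_one, Complex.norm_real, Real.norm_eq_abs,
      abs_of_nonpos (by linarith)]
    ring
  have h5 : w - z = (w - r * z) + (r * z - z) := by ring
  calc ‖w - z‖ ≤ ‖w - r * z‖ + ‖(r : ℂ) * z - z‖ := by rw [h5]; exact norm_add_le _ _
    _ ≤ _ := by rw [h4]; linarith

lemma geomPoly_eq_prod {s : ℕ} (hs : 0 < s) {ζ : ℂ} (h : 1 - ζ ≠ 0) :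
    geomPoly s ζ = ∏ w ∈ (nthRootsFinset s (1 : ℂ)).erase 1, (ζ - w) := by
  have h1 := congrArg (Polynomial.eval ζ)
    (X_pow_sub_one_eq_prod hs (Complex.isPrimitiveRoot_exp s hs.ne'))
  rw [eval_prod] at h1
  simp only [eval_sub, eval_pow, eval_X, eval_one, eval_C] at h1
  have h2 : (1 : ℂ) ∈ nthRootsFinset s (1 : ℂ) := by
    rw [mem_nthRootsFinset hs, one_pow]
  rw [← Finset.mul_prod_erase _ _ h2] at h1
  have h3 := one_sub_mul_geomPoly s ζ
  apply mul_left_cancel₀ h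
  linear_combination h3 - h1

lemma norm_geomPoly_le_rad {s : ℕ} (hs : 0 < s) {r : ℝ} (h0 : 0 ≤ r) (h1 : r < 1) {z : Circle}
    (hz : 1 - (z : ℂ) ≠ 0) :
    ‖geomPoly s z‖ ≤ 2 ^ ((nthRootsFinset s (1 : ℂ)).erase 1).card * ‖geomPoly s (r * z)‖ := by
  rw [geomPoly_eq_prod hs hz,
    geomPoly_eq_prod hs (one_sub_ne_zero_of_norm_lt (norm_mul_circle_lt h0 h1 z)),
    norm_prod, norm_prod, ← Finset.prod_const, ← Finset.prod_mul_distrib]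
  refine Finset.prod_le_prod (fun _ _ => norm_nonneg _) fun w hw => ?_
  rw [norm_sub_rev, norm_sub_rev _ w]
  refine norm_sub_rad_le h0 h1.le z ?_
  have := (mem_nthRootsFinset hs _).mp (Finset.mem_of_mem_erase hw)
  exact Complex.norm_eq_one_of_pow_eq_one this hs.ne'

/-- The two functions have no common zero, since `geomPoly s 1 = s`; compactness makes this
quantitative. -/
lemma exists_pos_le_or_le {s : ℕ} (hs : 0 < s) :
    ∃ δ > 0, ∀ z : Circle, δ ≤ ‖1 - (z : ℂ)‖ ∨ δ ≤ ‖geomPoly s z‖ := by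
  have hc : Continuous fun z : Circle => max ‖1 - (z : ℂ)‖ ‖geomPoly s z‖ := by
    have := continuous_geomPoly s
    fun_prop
  obtain ⟨z₀, -, hz₀⟩ := isCompact_univ.exists_isMinOn ⟨(1 : Circle), Set.mem_univ _⟩ hc.continuousOn
  refine ⟨_, ?_, fun z => le_max_iff.mp (hz₀ (Set.mem_univ z))⟩
  by_cases h : 1 - (z₀ : ℂ) = 0
  · refine lt_max_of_lt_right (norm_pos_iff.mpr ?_)
    rw [← sub_eq_zero.mp h, geomPoly]
    simpa using hs.ne'
  · exact lt_max_of_lt_left (norm_pos_iff.mpr h)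

lemma rpow_le_add_rpow {δ L x : ℝ} (hδ : 0 < δ) (h1 : δ ≤ x) (h2 : x ≤ L) (e : ℝ) :
    x ^ e ≤ δ ^ e + L ^ e := by
  have hx : 0 < x := hδ.trans_le h1
  rcases le_total 0 e with he | he
  · have := Real.rpow_le_rpow hx.le h2 he
    linarith [Real.rpow_pos_of_pos hδ e]
  · have := Real.rpow_le_rpow_of_nonpos hδ h1 he
    linarith [Real.rpow_pos_of_pos (hx.trans_le h2) e]

/-- Typically `x` is a value on the unit circle and `y` one on a smaller circle. For `e ≥ 0` both
quantities are bounded by constants, for `e ≤ 0` by multiples of `x ^ e`; the majorant `1 + x ^ e`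
covers zeros and poles alike. -/
lemma exists_rpow_bound {K L : ℝ} (hK : 0 < K) (hL : 0 < L) (e : ℝ) :
    ∃ C > 0, ∀ x y : ℝ, 0 < x → 0 < y → x ≤ K * y → y ≤ L →
      x ^ e / y ^ e ≤ C * (1 + x ^ e) ∧ y ^ e ≤ C * (1 + x ^ e) := by
  have k1 := Real.rpow_pos_of_pos hK e
  have k2 := Real.rpow_pos_of_pos hL (-e)
  have k3 := Real.rpow_pos_of_pos hL e
  have k4 := Real.rpow_pos_of_pos hK (-e)
  refine ⟨K ^ e + L ^ (-e) + L ^ e + K ^ (-e), by positivity, fun x y hx hy hxy hyL => ?_⟩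
  have hxe := Real.rpow_pos_of_pos hx e
  have hye := Real.rpow_pos_of_pos hy e
  rcases le_total 0 e with he | he
  · have h1 : x ^ e ≤ K ^ e * y ^ e := by
      rw [← Real.mul_rpow hK.le hy.le]; exact Real.rpow_le_rpow hx.le hxy he
    have h2 : y ^ e ≤ L ^ e := Real.rpow_le_rpow hy.le hyL he
    constructor
    · rw [div_le_iff₀ hye]
      nlinarith [mul_pos hxe hye]
    · nlinarith
  · have h1 : L ^ e ≤ y ^ e := Real.rpow_le_rpow_of_nonpos hy hyL he
    have h2 : K ^ e * y ^ e ≤ x ^ e := by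
      rw [← Real.mul_rpow hK.le hy.le]; exact Real.rpow_le_rpow_of_nonpos hx hxy he
    have h3 : L ^ (-e) * L ^ e = 1 := by rw [← Real.rpow_add hL]; simp
    have h4 : K ^ (-e) * K ^ e = 1 := by rw [← Real.rpow_add hK]; simp
    constructor
    · have h5 : x ^ e / y ^ e ≤ L ^ (-e) * x ^ e := by
        rw [div_le_iff₀ hye]
        nlinarith [mul_le_mul_of_nonneg_left h1 (mul_pos k2 hxe).le]
      nlinarith
    · have h5 : y ^ e ≤ K ^ (-e) * x ^ e := by
        nlinarith [mul_le_mul_of_nonneg_left h2 k4.le]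
      nlinarith

/-- One of the two factors stays between positive constants, so its power can be absorbed into `C`.
-/
lemma exists_one_add_rpow_mul_bound {δ L L' : ℝ} (hδ : 0 < δ) (hL : 0 < L) (hL' : 0 < L')
    (a b : ℝ) :
    ∃ C > 0, ∀ x y : ℝ, 0 < x → 0 < y → x ≤ L → y ≤ L' → (δ ≤ x ∨ δ ≤ y) →
      (1 + x ^ a) * (1 + y ^ b) ≤ C * (1 + x ^ a * y ^ b) ∧ x ^ a * y ^ b ≤ C * (x ^ a + y ^ b) := by
  have aux : ∀ (L a b : ℝ), 0 < L → ∃ C > 0, ∀ x y : ℝ, 0 < x → 0 < y → x ≤ L → δ ≤ x →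
      (1 + x ^ a) * (1 + y ^ b) ≤ C * (1 + x ^ a * y ^ b) ∧ x ^ a * y ^ b ≤ C * (x ^ a + y ^ b) := by
    intro L a b hL
    have m1 := Real.rpow_pos_of_pos hδ a
    have m2 := Real.rpow_pos_of_pos hL a
    have m3 := Real.rpow_pos_of_pos hδ (-a)
    have m4 := Real.rpow_pos_of_pos hL (-a)
    refine ⟨(1 + (δ ^ a + L ^ a)) * (1 + (δ ^ (-a) + L ^ (-a))), by positivity,
      fun x y hx hy hxL hxδ => ?_⟩
    have h1 := rpow_le_add_rpow hδ hxδ hxL a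
    have h2 := rpow_le_add_rpow hδ hxδ hxL (-a)
    have hxa := Real.rpow_pos_of_pos hx a
    have hxa' := Real.rpow_pos_of_pos hx (-a)
    have hyb := Real.rpow_pos_of_pos hy b
    have h3 : x ^ (-a) * x ^ a = 1 := by rw [← Real.rpow_add hx]; simp
    set M := δ ^ a + L ^ a
    set M' := δ ^ (-a) + L ^ (-a)
    have hM' : 0 < M' := by positivity
    have hM : 0 < M := by positivity
    have h4 : y ^ b ≤ M' * (x ^ a * y ^ b) := by
      calc y ^ b = x ^ (-a) * (x ^ a * y ^ b) := by rw [← mul_assoc, h3, one_mul]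
        _ ≤ _ := mul_le_mul_of_nonneg_right h2 (by positivity)
    constructor
    · calc (1 + x ^ a) * (1 + y ^ b) ≤ (1 + M) * (1 + M' * (x ^ a * y ^ b)) := by gcongr
        _ ≤ (1 + M) * ((1 + M') * (1 + x ^ a * y ^ b)) := by
            gcongr
            nlinarith [mul_pos hxa hyb]
        _ = _ := by ring
    · calc x ^ a * y ^ b ≤ M * y ^ b := by gcongr
        _ ≤ ((1 + M) * (1 + M')) * y ^ b := by
            gcongr
            nlinarith [mul_pos hM hM']
        _ ≤ _ := by gcongr; linarith
  obtain ⟨C₁, hC₁, h₁⟩ := aux L a b hL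
  obtain ⟨C₂, hC₂, h₂⟩ := aux L' b a hL'
  refine ⟨C₁ + C₂, by positivity, fun x y hx hy hxL hyL h => ?_⟩
  have hxa := Real.rpow_pos_of_pos hx a
  have hyb := Real.rpow_pos_of_pos hy b
  rcases h with h | h
  · obtain ⟨k1, k2⟩ := h₁ x y hx hy hxL h
    constructor <;> nlinarith [mul_pos hxa hyb]
  · obtain ⟨k1, k2⟩ := h₂ y x hy hx hyL h
    constructor <;> nlinarith [mul_pos hxa hyb]

lemma geomPoly_ne_zero {s : ℕ} {ζ : ℂ} (h : 1 - ζ ^ s ≠ 0) : geomPoly s ζ ≠ 0 := by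
  rw [← one_sub_mul_geomPoly] at h
  exact right_ne_zero_of_mul h

lemma norm_one_sub_le {ζ : ℂ} (h : ‖ζ‖ ≤ 1) : ‖1 - ζ‖ ≤ 2 := by
  have := norm_sub_le (1 : ℂ) ζ
  rw [norm_one] at this
  linarith

/-- Uniform comparison of the fractional filter on the unit circle and on smaller circles. -/
lemma exists_nabla_bound {s : ℕ} (hs : 0 < s) (d D : ℝ) :
    ∃ C > 0, ∀ z : Circle, z ∉ unitRoots s → ∀ r : ℝ, 0 ≤ r → r < 1 →
      ‖nabla s d D z‖ / ‖nabla s d D (r * z)‖ ≤ C * (1 + ‖nabla s d D z‖) ∧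
      ‖nabla s d D (r * z)‖ ≤ C * (1 + ‖nabla s d D z‖) := by
  obtain ⟨δ, hδ, hδ'⟩ := exists_pos_le_or_le hs
  have hs' : (0 : ℝ) < s := by exact_mod_cast hs
  obtain ⟨C₁, hC₁, h₁⟩ := exists_rpow_bound (K := 2) (L := 2) two_pos two_pos (d + D)
  obtain ⟨C₂, hC₂, h₂⟩ := exists_rpow_bound
    (K := 2 ^ ((nthRootsFinset s (1 : ℂ)).erase 1).card) (L := s) (by positivity) hs' D
  obtain ⟨C₃, hC₃, h₃⟩ := exists_one_add_rpow_mul_bound hδ two_pos hs' (d + D) D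
  refine ⟨C₁ * C₂ * C₃, by positivity, fun z hz r h0 h1 => ?_⟩
  have hrz := norm_mul_circle_lt h0 h1 z
  have n1 := one_sub_ne_zero hz
  have n2 := one_sub_ne_zero_of_norm_lt hrz
  have n3 := geomPoly_ne_zero (one_sub_pow_ne_zero hz)
  have n4 := geomPoly_ne_zero (one_sub_ne_zero_of_norm_lt (norm_pow_lt_one hs hrz))
  rw [norm_nabla d D n1, norm_nabla d D n2]
  have b1 := h₁ _ _ (norm_pos_iff.mpr n1) (norm_pos_iff.mpr n2)
    (norm_sub_rad_le h0 h1.le z norm_one) (norm_one_sub_le hrz.le)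
  have b2 := h₂ _ _ (norm_pos_iff.mpr n3) (norm_pos_iff.mpr n4)
    (norm_geomPoly_le_rad hs h0 h1 n1) (norm_geomPoly_le s hrz.le)
  have b3 := (h₃ _ _ (norm_pos_iff.mpr n1) (norm_pos_iff.mpr n3)
    (norm_one_sub_le z.norm_coe.le) (norm_geomPoly_le s z.norm_coe.le) (hδ' z)).1
  set x := ‖1 - (z : ℂ)‖ ^ (d + D)
  set y := ‖geomPoly s z‖ ^ D
  set x' := ‖1 - (r : ℂ) * z‖ ^ (d + D)
  set y' := ‖geomPoly s (r * z)‖ ^ D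
  have hx : 0 < x := Real.rpow_pos_of_pos (norm_pos_iff.mpr n1) _
  have hy : 0 < y := Real.rpow_pos_of_pos (norm_pos_iff.mpr n3) _
  have hx' : 0 < x' := Real.rpow_pos_of_pos (norm_pos_iff.mpr n2) _
  have hy' : 0 < y' := Real.rpow_pos_of_pos (norm_pos_iff.mpr n4) _
  have hfin : (C₁ * (1 + x)) * (C₂ * (1 + y)) ≤ C₁ * C₂ * C₃ * (1 + x * y) := by
    calc (C₁ * (1 + x)) * (C₂ * (1 + y)) = C₁ * C₂ * ((1 + x) * (1 + y)) := by ring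
      _ ≤ C₁ * C₂ * (C₃ * (1 + x * y)) := by gcongr
      _ = _ := by ring
  constructor
  · rw [mul_div_mul_comm]
    refine le_trans (mul_le_mul b1.1 b2.1 (by positivity) (by positivity)) hfin
  · exact le_trans (mul_le_mul b1.2 b2.2 (by positivity) (by positivity)) hfin

/-- If the filter has no zero on the unit circle, it is bounded below on smaller circles. -/
lemma exists_le_norm_nabla {s : ℕ} (hs : 0 < s) {d D : ℝ} (h1 : d + D ≤ 0) (h2 : D ≤ 0) :
    ∃ c > 0, ∀ z : Circle, ∀ r : ℝ, 0 ≤ r → r < 1 → c ≤ ‖nabla s d D (r * z)‖ := by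
  have hs' : (0 : ℝ) < s := by exact_mod_cast hs
  refine ⟨2 ^ (d + D) * (s : ℝ) ^ D, by positivity, fun z r h0 hr => ?_⟩
  have hrz := norm_mul_circle_lt h0 hr z
  have n2 := one_sub_ne_zero_of_norm_lt hrz
  have n4 := geomPoly_ne_zero (one_sub_ne_zero_of_norm_lt (norm_pow_lt_one hs hrz))
  rw [norm_nabla d D n2]
  refine mul_le_mul ?_ ?_ (by positivity) (by positivity)
  · exact Real.rpow_le_rpow_of_nonpos (norm_pos_iff.mpr n2) (norm_one_sub_le hrz.le) h1
  · exact Real.rpow_le_rpow_of_nonpos (norm_pos_iff.mpr n4) (norm_geomPoly_le s hrz.le) h2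

/-! ### Integrability of fractional filters on the circle -/

lemma norm_one_sub_exp (x : ℝ) : ‖1 - ((Circle.exp x : Circle) : ℂ)‖ = |2 * Real.sin (x / 2)| := by
  rw [norm_sub_rev, Circle.coe_exp, mul_comm, Complex.norm_exp_I_mul_ofReal_sub_one,
    Real.norm_eq_abs]

lemma coe_exp_pow (x : ℝ) (s : ℕ) :
    ((Circle.exp x : Circle) : ℂ) ^ s = ((Circle.exp (s * x) : Circle) : ℂ) := by
  rw [Circle.coe_exp, Circle.coe_exp, ← Complex.exp_nat_mul]
  push_cast; ring_nf

/-- For negative `e`, Jordan's inequality compares the function with a power of `x` on `(0, π]`;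
evenness and periodicity give all other intervals. -/
lemma intervalIntegrable_sin_rpow {e : ℝ} (he : -1 < e) (a b : ℝ) :
    IntervalIntegrable (fun x => |2 * Real.sin (x / 2)| ^ e) volume a b := by
  have hpi := Real.pi_pos
  have hper : Function.Periodic (fun x : ℝ => |2 * Real.sin (x / 2)| ^ e) (2 * Real.pi) := by
    intro x
    have : (x + 2 * Real.pi) / 2 = x / 2 + Real.pi := by ring
    simp only [this, Real.sin_add_pi, mul_neg, abs_neg]
  have hmeas : Measurable fun x : ℝ => |2 * Real.sin (x / 2)| ^ e := by fun_prop
  have hpos : IntervalIntegrable (fun x => |2 * Real.sin (x / 2)| ^ e) volume 0 Real.pi := by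
    rcases le_total 0 e with h | h
    · apply Continuous.intervalIntegrable
      exact Continuous.rpow_const (by fun_prop) fun x => Or.inr h
    · refine ((intervalIntegral.intervalIntegrable_rpow' he).const_mul
        ((2 / Real.pi) ^ e)).mono_fun hmeas.aestronglyMeasurable ?_
      rw [Set.uIoc_of_le hpi.le]
      filter_upwards [ae_restrict_mem measurableSet_Ioc] with x hx
      have h1 := Real.mul_le_sin (x := x / 2) (by linarith [hx.1]) (by linarith [hx.2])
      have h2 : 2 / Real.pi * x ≤ |2 * Real.sin (x / 2)| := by
        refine le_trans ?_ (le_abs_self _)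
        calc 2 / Real.pi * x = 2 * (2 / Real.pi * (x / 2)) := by ring
          _ ≤ _ := by linarith
      have h3 : 0 < 2 / Real.pi * x := mul_pos (by positivity) hx.1
      rw [Real.norm_of_nonneg (by positivity), ← Real.mul_rpow (by positivity) hx.1.le,
        Real.norm_of_nonneg (by positivity)]
      exact Real.rpow_le_rpow_of_nonpos h3 h2 h
  have hneg : IntervalIntegrable (fun x => |2 * Real.sin (x / 2)| ^ e) volume (-Real.pi) 0 := by
    rw [IntervalIntegrable.iff_comp_neg]
    simp only [neg_neg, neg_zero]
    refine hpos.symm.congr fun x _ => ?_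
    simp only [neg_div, Real.sin_neg, mul_neg, abs_neg]
  refine hper.intervalIntegrable (t := -Real.pi) (by positivity) ?_ a b
  rw [show -Real.pi + 2 * Real.pi = Real.pi by ring]
  exact hneg.trans hpos

lemma integrable_norm_one_sub_pow_rpow {s : ℕ} (hs : 0 < s) {e : ℝ} (he : -1 < e) :
    Integrable (fun z : Circle => ‖1 - (z : ℂ) ^ s‖ ^ e) arcLength := by
  have hm : Measurable fun z : Circle => ‖1 - (z : ℂ) ^ s‖ ^ e := by
    have : Measurable fun z : Circle => ‖1 - (z : ℂ) ^ s‖ := Continuous.measurable (by fun_prop)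
    fun_prop
  rw [arcLength, integrable_map_measure hm.aestronglyMeasurable (by fun_prop)]
  simp only [Function.comp_def, coe_exp_pow, norm_one_sub_exp]
  change IntegrableOn _ _ _
  have hpi := Real.pi_pos
  rw [integrableOn_Icc_iff_integrableOn_Ioc,
    ← intervalIntegrable_iff_integrableOn_Ioc_of_le (by linarith)]
  have hs' : (s : ℝ) ≠ 0 := by exact_mod_cast hs.ne'
  have h := (intervalIntegrable_sin_rpow he (s * -Real.pi) (s * Real.pi)).comp_mul_left (c := s)
  rwa [mul_div_cancel_left₀ _ hs', mul_div_cancel_left₀ _ hs'] at h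

lemma unitRoots_preimage_countable {s : ℕ} (hs : 0 < s) :
    (Circle.exp ⁻¹' unitRoots s).Countable := by
  refine (Set.countable_range fun n : ℤ => n * (2 * Real.pi) / s).mono ?_
  intro x hx
  have hs' : (s : ℝ) ≠ 0 := by exact_mod_cast hs.ne'
  rw [Set.mem_preimage, unitRoots, Set.mem_ofPred_eq, coe_exp_pow, Circle.coe_exp,
    Complex.exp_eq_one_iff] at hx
  obtain ⟨n, hn⟩ := hx
  refine ⟨n, ?_⟩
  have h2 : (((s : ℝ) * x : ℝ) : ℂ) = ((n * (2 * Real.pi) : ℝ) : ℂ) := by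
    have hI := Complex.I_ne_zero
    apply mul_right_cancel₀ hI
    rw [hn]; push_cast; ring
  have h3 : (s : ℝ) * x = n * (2 * Real.pi) := by exact_mod_cast h2
  simp only
  rw [← h3]; field_simp

lemma arcLength_unitRoots {s : ℕ} (hs : 0 < s) : arcLength (unitRoots s) = 0 := by
  rw [arcLength, Measure.map_apply (by fun_prop) (measurableSet_unitRoots s)]
  exact Measure.absolutelyContinuous_of_le Measure.restrict_le_self
    ((unitRoots_preimage_countable hs).measure_zero _)

lemma integrable_norm_nabla_sq {s : ℕ} (hs : 0 < s) {d D : ℝ} (h1 : -(1 / 2) < d + D)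
    (h2 : -(1 / 2) < D) : Integrable (fun z : Circle => ‖nabla s d D z‖ ^ 2) arcLength := by
  obtain ⟨δ, hδ, hδ'⟩ := exists_pos_le_or_le hs
  have hs' : (0 : ℝ) < s := by exact_mod_cast hs
  -- Powers of `geomPoly` are controlled by those of `1 - z^s`, since `|1 - z^s| ≤ 2 |geomPoly|`.
  -- The latter are integrable by the substitution `x ↦ s x`, as `2D > -1`.
  obtain ⟨C₁, hC₁, h₁⟩ := exists_rpow_bound (K := 2) (L := s) two_pos hs' (2 * D)
  obtain ⟨C₂, hC₂, h₂⟩ := exists_one_add_rpow_mul_bound hδ two_pos hs' (2 * (d + D)) (2 * D)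
  have i1 := integrable_norm_one_sub_pow_rpow (s := 1) one_pos (e := 2 * (d + D)) (by linarith)
  have i2 := integrable_norm_one_sub_pow_rpow hs (e := 2 * D) (by linarith)
  refine ((i1.add (((integrable_const (1 : ℝ)).add i2).const_mul C₁)).const_mul C₂).mono
    ((measurable_nabla s d D).norm.pow_const 2).aestronglyMeasurable ?_
  have hae : ∀ᵐ z ∂arcLength, z ∉ unitRoots s :=
    measure_eq_zero_iff_ae_notMem.mp (arcLength_unitRoots hs)
  filter_upwards [hae] with z hz
  have n1 := one_sub_ne_zero hz
  have n0 := one_sub_pow_ne_zero hz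
  have n3 := geomPoly_ne_zero n0
  have b1 := (h₁ _ _ (norm_pos_iff.mpr n0) (norm_pos_iff.mpr n3) (by
    rw [← one_sub_mul_geomPoly, norm_mul]
    exact mul_le_mul_of_nonneg_right (norm_one_sub_le z.norm_coe.le) (norm_nonneg _))
    (norm_geomPoly_le s z.norm_coe.le)).2
  have b2 := (h₂ _ _ (norm_pos_iff.mpr n1) (norm_pos_iff.mpr n3)
    (norm_one_sub_le z.norm_coe.le) (norm_geomPoly_le s z.norm_coe.le) (hδ' z)).2
  rw [Real.norm_of_nonneg (sq_nonneg _), norm_nabla d D n1, mul_pow,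
    ← Real.rpow_natCast (‖1 - (z : ℂ)‖ ^ (d + D)) 2, ← Real.rpow_natCast (‖geomPoly s z‖ ^ D) 2,
    ← Real.rpow_mul (norm_nonneg _), ← Real.rpow_mul (norm_nonneg _)]
  simp only [pow_one, Pi.add_apply]
  push_cast
  rw [mul_comm (d + D) 2, mul_comm D 2]
  refine b2.trans (le_trans ?_ (le_abs_self _))
  gcongr

/-! ### Accretivity -/

lemma arg_sub_arg_eq {x y : ℂ} (hx : 0 < x.re) (hy : 0 < y.re) :
    (x / y).arg = x.arg - y.arg := by
  have hx0 : x ≠ 0 := by rintro rfl; simp at hx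
  have hy0 : y ≠ 0 := by rintro rfl; simp at hy
  have h1 := abs_lt.mp (Complex.abs_arg_lt_pi_div_two_iff.mpr (Or.inl hx))
  have h2 := abs_lt.mp (Complex.abs_arg_lt_pi_div_two_iff.mpr (Or.inl hy))
  have hpi := Real.pi_pos
  have h3 : y⁻¹.arg = -y.arg := by
    rw [Complex.arg_inv, if_neg (by linarith)]
  rw [div_eq_mul_inv, Complex.arg_mul hx0 (inv_ne_zero hy0), h3, sub_eq_add_neg]
  rw [h3]
  constructor <;> linarith

/-- The quotient `(1 - ρw)/(1 - w) = ρ + (1 - ρ)/(1 - w)` has positive real part. -/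
lemma abs_arg_sub_arg_lt {ρ : ℝ} (h0 : 0 ≤ ρ) (h1 : ρ < 1) {w : ℂ} (hw : ‖w‖ = 1)
    (hw1 : 1 - w ≠ 0) : |(1 - ρ * w).arg - (1 - w).arg| < Real.pi / 2 := by
  have hlt : ‖(ρ : ℂ) * w‖ < 1 := by
    rwa [norm_mul, hw, mul_one, Complex.norm_real, Real.norm_of_nonneg h0]
  have r1 := mem_slitPlane_one_sub hw.le hw1
  have r2 := mem_slitPlane_one_sub hlt.le (one_sub_ne_zero_of_norm_lt hlt)
  rw [← arg_sub_arg_eq r2 r1, Complex.abs_arg_lt_pi_div_two_iff]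
  left
  have h5 : (1 - ρ * w) / (1 - w) = ρ + ((1 - ρ : ℝ) : ℂ) * (1 - w)⁻¹ := by
    field_simp; push_cast; ring
  rw [h5, Complex.add_re, Complex.ofReal_re, Complex.re_ofReal_mul, Complex.inv_re]
  have : 0 < (1 - w).re / Complex.normSq (1 - w) := div_pos r1 (Complex.normSq_pos.mpr hw1)
  have : 0 < (1 - ρ) * ((1 - w).re / Complex.normSq (1 - w)) := mul_pos (by linarith) this
  linarith

/-- Away from the singularity the quotient `(1 - ρw)/(1 - w)` tends to `1` uniformly as `ρ → 1`. -/
lemma exists_abs_arg_sub_arg_le {δ η : ℝ} (hδ : 0 < δ) (hη : 0 < η) :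
    ∃ κ > 0, ∀ ρ : ℝ, 0 ≤ ρ → ρ < 1 → 1 - ρ < κ → ∀ w : ℂ, ‖w‖ = 1 → δ ≤ ‖1 - w‖ →
      |(1 - ρ * w).arg - (1 - w).arg| ≤ η := by
  have hc := Complex.continuousAt_arg Complex.one_mem_slitPlane
  rw [Metric.continuousAt_iff] at hc
  obtain ⟨κ, hκ, h⟩ := hc η hη
  refine ⟨κ * δ, by positivity, fun ρ h0 h1 hρ w hw hwδ => ?_⟩
  have hw1 : 1 - w ≠ 0 := norm_pos_iff.mp (hδ.trans_le hwδ)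
  have hlt : ‖(ρ : ℂ) * w‖ < 1 := by
    rwa [norm_mul, hw, mul_one, Complex.norm_real, Real.norm_of_nonneg h0]
  have r1 := mem_slitPlane_one_sub hw.le hw1
  have r2 := mem_slitPlane_one_sub hlt.le (one_sub_ne_zero_of_norm_lt hlt)
  rw [← arg_sub_arg_eq r2 r1]
  have h2 : dist ((1 - ρ * w) / (1 - w)) 1 < κ := by
    have h5 : (1 - ρ * w) / (1 - w) - 1 = ((1 - ρ : ℝ) : ℂ) * w / (1 - w) := by
      field_simp; push_cast; ring
    rw [dist_eq_norm, h5, norm_div, norm_mul, hw, mul_one, Complex.norm_real,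
      Real.norm_of_nonneg (by linarith), div_lt_iff₀ (hδ.trans_le hwδ)]
    exact hρ.trans_le (mul_le_mul_of_nonneg_left hwδ hκ.le)
  have h3 := h h2
  rw [Complex.arg_one, dist_zero_right, Real.norm_eq_abs] at h3
  exact h3.le

lemma exists_abs_arg_geomPoly_le {s : ℕ} (hs : 0 < s) {η : ℝ} (hη : 0 < η) :
    ∃ κ > 0, ∀ w : ℂ, ‖1 - w‖ < κ → |(geomPoly s w).arg| < η := by
  have h1 : geomPoly s 1 = s := by simp [geomPoly]
  have hc : ContinuousAt (fun w => (geomPoly s w).arg) 1 := by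
    refine ContinuousAt.comp (g := Complex.arg) ?_ (continuous_geomPoly s).continuousAt
    refine Complex.continuousAt_arg ?_
    rw [h1]
    exact Or.inl (by simpa using hs)
  rw [Metric.continuousAt_iff] at hc
  obtain ⟨κ, hκ, h⟩ := hc η hη
  refine ⟨κ, hκ, fun w hw => ?_⟩
  have h2 := h (x := w) (by rwa [dist_eq_norm, norm_sub_rev])
  rwa [h1, Complex.natCast_arg, dist_zero_right, Real.norm_eq_abs] at h2

lemma arg_one_sub_pow {s : ℕ} {w : ℂ} (hw : ‖w‖ ≤ 1) (hw1 : 1 - w ≠ 0)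
    (h : |(geomPoly s w).arg| < Real.pi / 2) (hg : geomPoly s w ≠ 0) :
    (1 - w ^ s).arg = (1 - w).arg + (geomPoly s w).arg := by
  have h1 := abs_lt.mp (Complex.abs_arg_lt_pi_div_two_iff.mpr
    (Or.inl (mem_slitPlane_one_sub hw hw1)))
  have h2 := abs_lt.mp h
  rw [← one_sub_mul_geomPoly, Complex.arg_mul hw1 hg]
  constructor <;> linarith

/-- The argument of `(1 - ρz)^d (1 - (ρz)^s)^D / ((1 - z)^d (1 - z^s)^D)`. -/
def argDiff (s : ℕ) (d D ρ : ℝ) (z : ℂ) : ℝ :=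
  d * ((1 - ρ * z).arg - (1 - z).arg) + D * ((1 - (ρ * z) ^ s).arg - (1 - z ^ s).arg)

/-- Away from `1` and for `ρ` near `1`, the term with `d` is negligible and the other is at most
`|D| π/2`. Near `1` both argument differences are nearly equal, and the total is about `|d + D|
π/2`. Treating the two regions separately is essential because `|d|` itself may exceed `1/2`. The
threshold `π/4` makes the square of the ratio have positive real part. -/
lemma exists_abs_argDiff_le {s : ℕ} (hs : 0 < s) {d D : ℝ} (h1 : |d + D| < 1 / 2)
    (h2 : |D| < 1 / 2) :
    ∃ ρ θ : ℝ, 0 ≤ ρ ∧ ρ < 1 ∧ θ < Real.pi / 4 ∧ ∀ z : Circle, z ∉ unitRoots s →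
      |argDiff s d D ρ z| ≤ θ := by
  have hpi := Real.pi_pos
  obtain ⟨k, hk1, hk2, hk3⟩ : ∃ k, |d + D| ≤ k ∧ |D| ≤ k ∧ k < 1 / 2 :=
    ⟨max |d + D| |D|, le_max_left _ _, le_max_right _ _, max_lt h1 h2⟩
  set A := |d| + 2 * |D| + 1 with hA
  have hApos : 0 < A := by positivity
  -- The errors add up to at most `A * η`, which is half of the gap `(1/2 - k) π/2` between `k π/2`
  -- and `π/4`. The bound `π/4` keeps the arguments of `geomPoly` below `π/2`.
  set η := min (Real.pi / 4) ((1 / 2 - k) * (Real.pi / 4) / A) with hη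
  have hηpos : 0 < η := lt_min (by positivity) (div_pos (mul_pos (by linarith) (by positivity)) hApos)
  have hηA : A * η ≤ (1 / 2 - k) * (Real.pi / 4) := by
    have := min_le_right (Real.pi / 4) ((1 / 2 - k) * (Real.pi / 4) / A)
    rw [← hη, le_div_iff₀ hApos] at this
    linarith
  have hη4 : η ≤ Real.pi / 4 := min_le_left _ _
  obtain ⟨κ₂, hκ₂, g2⟩ := exists_abs_arg_geomPoly_le hs hηpos
  obtain ⟨κ₁, hκ₁, g1⟩ := exists_abs_arg_sub_arg_le (δ := κ₂ / 2) (half_pos hκ₂) hηpos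
  -- With `1 - ρ < κ₂ / 2`, the point `ρz` is within `κ₂` of `1` whenever `z` is within `κ₂ / 2`.
  obtain ⟨ρ, hρ0, hρ1, hρκ⟩ : ∃ ρ : ℝ, 0 ≤ ρ ∧ ρ < 1 ∧ 1 - ρ < min κ₁ (κ₂ / 2) := by
    have hm : 0 < min κ₁ (κ₂ / 2) := lt_min hκ₁ (half_pos hκ₂)
    refine ⟨max 0 (1 - min κ₁ (κ₂ / 2) / 2), le_max_left _ _, max_lt one_pos (by linarith), ?_⟩
    have := le_max_right 0 (1 - min κ₁ (κ₂ / 2) / 2)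
    linarith
  refine ⟨ρ, k * (Real.pi / 2) + (1 / 2 - k) * (Real.pi / 4), hρ0, hρ1, by nlinarith, ?_⟩
  intro z hz
  have n1 := one_sub_ne_zero hz
  have n0 := one_sub_pow_ne_zero hz
  have hrz := norm_mul_circle_lt hρ0 hρ1 z
  have hα := (abs_arg_sub_arg_lt hρ0 hρ1 z.norm_coe n1).le
  have hzs : ‖(z : ℂ) ^ s‖ = 1 := by rw [norm_pow, Circle.norm_coe, one_pow]
  have hβ := (abs_arg_sub_arg_lt (pow_nonneg hρ0 s) (pow_lt_one₀ hρ0 hρ1 hs.ne') hzs n0).le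
  have hpow : ((ρ : ℂ) * z) ^ s = ((ρ ^ s : ℝ) : ℂ) * (z : ℂ) ^ s := by
    rw [mul_pow]; push_cast; rfl
  rw [argDiff]
  rcases le_or_gt (κ₂ / 2) ‖1 - (z : ℂ)‖ with hcase | hcase
  · have hα' := g1 ρ hρ0 hρ1 (hρκ.trans_le (min_le_left _ _)) z z.norm_coe hcase
    rw [hpow]
    set α := (1 - ρ * (z : ℂ)).arg - (1 - (z : ℂ)).arg
    set β := (1 - ((ρ ^ s : ℝ) : ℂ) * (z : ℂ) ^ s).arg - (1 - (z : ℂ) ^ s).arg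
    calc |d * α + D * β| ≤ |d| * |α| + |D| * |β| := by
          rw [← abs_mul, ← abs_mul]; exact abs_add_le _ _
      _ ≤ A * η + k * (Real.pi / 2) := by
          have e1 : |d| * |α| ≤ A * η := by
            apply mul_le_mul _ hα' (abs_nonneg _) hApos.le
            have := abs_nonneg D; rw [hA]; linarith
          have e2 : |D| * |β| ≤ k * (Real.pi / 2) :=
            mul_le_mul hk2 hβ (abs_nonneg _) ((abs_nonneg _).trans hk2)
          linarith
      _ ≤ _ := by linarith
  · have c1 := g2 z (by linarith)
    have hρκ2 := hρκ.trans_le (min_le_right _ _)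
    have c2 := g2 (ρ * z) (by
      have e : 1 - (ρ : ℂ) * z = (1 - z) + ((1 - ρ : ℝ) : ℂ) * z := by push_cast; ring
      have e2 := norm_add_le (1 - (z : ℂ)) (((1 - ρ : ℝ) : ℂ) * z)
      rw [← e, norm_mul, Circle.norm_coe, mul_one, Complex.norm_real,
        Real.norm_of_nonneg (by linarith)] at e2
      linarith)
    have m1 := arg_one_sub_pow (s := s) z.norm_coe.le n1 (by linarith) (geomPoly_ne_zero n0)
    have m2 := arg_one_sub_pow (s := s) hrz.le (one_sub_ne_zero_of_norm_lt hrz) (by linarith)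
      (geomPoly_ne_zero (one_sub_ne_zero_of_norm_lt (norm_pow_lt_one hs hrz)))
    rw [m1, m2]
    set α := (1 - ρ * (z : ℂ)).arg - (1 - (z : ℂ)).arg with hαdef
    set γ₁ := (geomPoly s z).arg
    set γ₂ := (geomPoly s (ρ * z)).arg
    have e0 : d * α + D * ((1 - ρ * (z : ℂ)).arg + γ₂ - ((1 - (z : ℂ)).arg + γ₁)) =
        (d + D) * α + D * (γ₂ - γ₁) := by rw [hαdef]; ring
    rw [e0]
    calc |(d + D) * α + D * (γ₂ - γ₁)| ≤ |d + D| * |α| + |D| * |γ₂ - γ₁| := by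
          rw [← abs_mul, ← abs_mul]; exact abs_add_le _ _
      _ ≤ k * (Real.pi / 2) + A * η := by
          have e1 : |d + D| * |α| ≤ k * (Real.pi / 2) :=
            mul_le_mul hk1 hα (abs_nonneg _) ((abs_nonneg _).trans hk1)
          have e3 : |γ₂ - γ₁| ≤ 2 * η := by
            have := abs_sub γ₂ γ₁
            linarith
          have e2 : |D| * |γ₂ - γ₁| ≤ A * η := by
            calc |D| * |γ₂ - γ₁| ≤ |D| * (2 * η) := mul_le_mul_of_nonneg_left e3 (abs_nonneg _)
              _ = (2 * |D|) * η := by ring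
              _ ≤ A * η := by
                  apply mul_le_mul_of_nonneg_right _ hηpos.le
                  have := abs_nonneg d; rw [hA]; linarith
          linarith
      _ ≤ _ := by linarith

/-- The product is `exp E` with `Im E = argDiff`, so its square has argument `2 * argDiff`. -/
lemma re_nabla_ratio_sq {s : ℕ} {d D ρ : ℝ} {z : ℂ} (h1 : 1 - z ≠ 0) (h2 : 1 - z ^ s ≠ 0)
    (h3 : 1 - ρ * z ≠ 0) (h4 : 1 - (ρ * z) ^ s ≠ 0) :
    ((nabla s d D (ρ * z) * nabla s (-d) (-D) z) ^ 2).re =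
      ‖nabla s d D (ρ * z) * nabla s (-d) (-D) z‖ ^ 2 * Real.cos (2 * argDiff s d D ρ z) := by
  set E : ℂ := d * (Complex.log (1 - ρ * z) - Complex.log (1 - z)) +
    D * (Complex.log (1 - (ρ * z) ^ s) - Complex.log (1 - z ^ s)) with hE
  have e1 : nabla s d D (ρ * z) * nabla s (-d) (-D) z = Complex.exp E := by
    simp only [nabla]
    rw [Complex.cpow_def_of_ne_zero h1, Complex.cpow_def_of_ne_zero h2,
      Complex.cpow_def_of_ne_zero h3, Complex.cpow_def_of_ne_zero h4, ← Complex.exp_add,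
      ← Complex.exp_add, ← Complex.exp_add, hE]
    congr 1
    push_cast; ring
  have e2 : E.im = argDiff s d D ρ z := by
    rw [hE, argDiff]
    simp [Complex.log_im]
  rw [e1, ← Complex.exp_nat_mul, Complex.exp_re, Complex.norm_exp, ← Real.exp_nat_mul]
  congr 2
  · simp
  · simp [e2]

/-- The accretivity estimate behind the convergence of the series `∇^{(d,D)}`. -/
lemma exists_accretive {s : ℕ} (hs : 0 < s) {d D : ℝ} (h1 : |d + D| < 1 / 2)
    (h2 : |D| < 1 / 2) :
    ∃ ρ c : ℝ, 0 ≤ ρ ∧ ρ < 1 ∧ 0 < c ∧ ∀ z : Circle, z ∉ unitRoots s →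
      c * ‖nabla s (-d) (-D) z‖ ^ 2 ≤
        ((nabla s d D (ρ * z) * nabla s (-d) (-D) z) ^ 2).re := by
  obtain ⟨ρ, θ, h0, hρ, hθ, h⟩ := exists_abs_argDiff_le hs h1 h2
  have hc : Continuous fun z : Circle => ‖nabla s d D (ρ * z)‖ := by
    simp_rw [← symb_radSeq hs d D h0 hρ]
    exact (continuous_symb (summable_radSeq hs d D h0 hρ)).norm
  -- The constant is the squared minimum of the regularized factor times the cosine of the largest
  -- possible angle.
  obtain ⟨z₀, -, hz₀⟩ := isCompact_univ.exists_isMinOn ⟨(1 : Circle), Set.mem_univ _⟩ hc.continuousOn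
  have hm : 0 < ‖nabla s d D (ρ * z₀)‖ := norm_pos_iff.mpr (nabla_rad_ne_zero hs d D h0 hρ z₀)
  have hpi := Real.pi_pos
  have hcos : 0 < Real.cos (2 * max θ 0) := by
    apply Real.cos_pos_of_mem_Ioo
    have := le_max_right θ 0
    have : max θ 0 < Real.pi / 4 := max_lt hθ (by positivity)
    constructor <;> linarith
  refine ⟨ρ, ‖nabla s d D (ρ * z₀)‖ ^ 2 * Real.cos (2 * max θ 0), h0, hρ, by positivity,
    fun z hz => ?_⟩
  have hrz := norm_mul_circle_lt h0 hρ z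
  rw [re_nabla_ratio_sq (one_sub_ne_zero hz) (one_sub_pow_ne_zero hz)
    (one_sub_ne_zero_of_norm_lt hrz) (one_sub_ne_zero_of_norm_lt (norm_pow_lt_one hs hrz)),
    norm_mul, mul_pow]
  have hle : ‖nabla s d D (ρ * z₀)‖ ≤ ‖nabla s d D (ρ * z)‖ := hz₀ (Set.mem_univ z)
  have hcosle : Real.cos (2 * max θ 0) ≤ Real.cos (2 * argDiff s d D ρ z) := by
    rw [← Real.cos_abs (2 * argDiff s d D ρ z)]
    apply Real.cos_le_cos_of_nonneg_of_le_pi (abs_nonneg _)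
    · have : max θ 0 < Real.pi / 4 := max_lt hθ (by positivity)
      linarith
    · rw [abs_mul, abs_two]
      have := (h z hz).trans (le_max_left θ 0)
      linarith
  calc _ = ‖nabla s d D (ρ * z₀)‖ ^ 2 * ‖nabla s (-d) (-D) z‖ ^ 2 * Real.cos (2 * max θ 0) := by ring
    _ ≤ _ := by gcongr

/-! ### Vanishing of integrals of analytic functions -/

lemma integral_arcLength_eq_circleAverage {f : ℂ → ℂ}
    (hf : Continuous fun z : Circle => f z) :
    ∫ z : Circle, f z ∂arcLength = 2 * Real.pi * Real.circleAverage f 0 1 := by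
  have hpi := Real.pi_pos
  rw [integral_arcLength _ hf.aestronglyMeasurable,
    integral_Icc_eq_integral_Ioc, ← intervalIntegral.integral_of_le (by linarith),
    Real.circleAverage_def]
  have hper : Function.Periodic (fun x : ℝ => f (Circle.exp x)) (2 * Real.pi) := by
    intro x
    simp only [Circle.exp_add, Circle.exp_two_pi, mul_one]
  have h1 := hper.intervalIntegral_add_eq (-Real.pi) 0
  rw [show -Real.pi + 2 * Real.pi = Real.pi by ring, zero_add] at h1
  rw [h1, Complex.real_smul]
  have h2 : ∀ x : ℝ, circleMap 0 1 x = Circle.exp x := fun x => by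
    simp [circleMap, Circle.coe_exp]
  simp_rw [h2]
  push_cast
  rw [← mul_assoc, mul_inv_cancel₀ (by simp [Real.pi_ne_zero]), one_mul]

/-- The mean value property: the integrand is analytic on the closed disc and vanishes at `0`
because `l > 0`. -/
lemma integral_zpow_mul_nabla_eq_zero {s : ℕ} (hs : 0 < s) (d D d' D' : ℝ) {ρ r : ℝ}
    (hρ0 : 0 ≤ ρ) (hρ1 : ρ < 1) (hr0 : 0 ≤ r) (hr1 : r < 1) {l : ℕ} (hl : 0 < l) :
    ∫ z : Circle, (z : ℂ) ^ l * (nabla s d D (ρ * z) * nabla s d' D' (r * z)) ^ 2 ∂arcLength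
      = 0 := by
  set f : ℂ → ℂ := fun ζ => ζ ^ l * (nabla s d D (ρ * ζ) * nabla s d' D' (r * ζ)) ^ 2 with hf
  have hdiff : ∀ (d D t : ℝ), 0 ≤ t → t < 1 → ∀ ζ : ℂ, ‖ζ‖ ≤ 1 →
      DifferentiableAt ℂ (fun ζ => nabla s d D (t * ζ)) ζ := by
    intro d D t ht0 ht1 ζ hζ
    have h1 : ‖(t : ℂ) * ζ‖ < 1 := by
      rw [norm_mul, Complex.norm_real, Real.norm_of_nonneg ht0]
      calc t * ‖ζ‖ ≤ t * 1 := mul_le_mul_of_nonneg_left hζ ht0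
        _ < 1 := by linarith
    exact (differentiableAt_nabla d D h1.le (one_sub_ne_zero_of_norm_lt h1)
      (one_sub_ne_zero_of_norm_lt (norm_pow_lt_one hs h1))).comp (f := fun ζ => (t : ℂ) * ζ) ζ
      (by fun_prop)
  have hd : ∀ ζ : ℂ, ‖ζ‖ ≤ 1 → DifferentiableAt ℂ f ζ := fun ζ hζ =>
    (differentiableAt_pow l).mul (((hdiff d D ρ hρ0 hρ1 ζ hζ).mul (hdiff d' D' r hr0 hr1 ζ hζ)).pow 2)
  have hcont : Continuous fun z : Circle => f z := by
    rw [continuous_iff_continuousAt]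
    intro z
    exact (hd z z.norm_coe.le).continuousAt.comp (f := fun z : Circle => (z : ℂ)) (by fun_prop)
  have h1 := integral_arcLength_eq_circleAverage hcont
  have h2 : DiffContOnCl ℂ f (Metric.ball 0 |1|) := by
    rw [abs_one]
    apply DifferentiableOn.diffContOnCl
    rw [closure_ball _ one_ne_zero]
    intro ζ hζ
    exact (hd ζ (by simpa using hζ)).differentiableWithinAt
  rw [h2.circleAverage] at h1
  rw [h1, hf]
  simp [hl.ne']

section AbelLimit

variable {H : Type*} [NormedAddCommGroup H] [InnerProductSpace ℝ H]

/-! ### Abel summation in a Hilbert space -/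

lemma eventually_rad : ∀ᶠ r in 𝓝[<] (1 : ℝ), 0 ≤ r ∧ r < 1 := by
  filter_upwards [self_mem_nhdsWithin, Ioo_mem_nhdsLT (show (0 : ℝ) < 1 by norm_num)] with r h1 h2
  exact ⟨h2.1.le, h1⟩

/-- Abel's theorem for series in a Hilbert space. -/
lemma tendsto_abel [CompleteSpace H] {y : ℕ → H} {S : H}
    (h : Tendsto (fun n => ∑ k ∈ Finset.range n, y k) atTop (𝓝 S)) :
    Tendsto (fun r : ℝ => ∑' k, r ^ k • y k) (𝓝[<] 1) (𝓝 S) := by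
  set e : ℕ → H := fun n => ∑ k ∈ Finset.range n, y k - S with he
  have he0 : Tendsto e atTop (𝓝 0) := by
    simpa using h.sub (tendsto_const_nhds (x := S))
  obtain ⟨M, hM⟩ : ∃ M, ∀ n, ‖e n‖ ≤ M := by
    obtain ⟨M, hM⟩ := he0.norm.bddAbove_range
    exact ⟨M, fun n => hM ⟨n, rfl⟩⟩
  have hsum : ∀ r : ℝ, 0 ≤ r → r < 1 → ∀ m : ℕ, Summable fun k => r ^ k • e (k + m) := by
    intro r h0 h1 m
    apply Summable.of_norm_bounded ((summable_geometric_of_lt_one h0 h1).mul_right M)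
    intro k
    rw [norm_smul, Real.norm_of_nonneg (pow_nonneg h0 k)]
    exact mul_le_mul_of_nonneg_left (hM _) (pow_nonneg h0 k)
  have hform : ∀ r : ℝ, 0 ≤ r → r < 1 →
      ∑' k, r ^ k • y k = (1 - r) • ∑' k, r ^ k • e (k + 1) + S := by
    intro r h0 h1
    -- Summation by parts with the errors `e n` of the partial sums; the boundary term `-e 0` equals
    -- `S`.
    have hy : ∀ k, r ^ k • y k = r ^ k • e (k + 1) - r ^ k • e k := by
      intro k
      rw [← smul_sub, he]
      simp [Finset.sum_range_succ]
    simp_rw [hy]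
    rw [(hsum r h0 h1 1).tsum_sub (by simpa using hsum r h0 h1 0),
      Summable.tsum_eq_zero_add (f := fun k => r ^ k • e k) (by simpa using hsum r h0 h1 0)]
    have h2 : ∑' k, r ^ (k + 1) • e (k + 1) = r • ∑' k, r ^ k • e (k + 1) := by
      rw [← (hsum r h0 h1 1).tsum_const_smul]
      congr 1; ext k
      rw [pow_succ', mul_smul]
    rw [h2, he]
    simp only [pow_zero, one_smul, Finset.range_zero, Finset.sum_empty, zero_sub, sub_smul]
    abel
  have hlim : Tendsto (fun r : ℝ => (1 - r) • ∑' k, r ^ k • e (k + 1)) (𝓝[<] 1) (𝓝 0) := by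
    rw [Metric.tendsto_nhds]
    intro ε hε
    obtain ⟨K, hK⟩ := (Metric.tendsto_atTop.mp he0) (ε / 2) (half_pos hε)
    set B := ∑ k ∈ Finset.range K, ‖e (k + 1)‖
    have hB : Tendsto (fun r : ℝ => (1 - r) * B) (𝓝[<] 1) (𝓝 0) := by
      have : Continuous fun r : ℝ => (1 - r) * B := by fun_prop
      have h3 := (this.tendsto 1).mono_left (nhdsWithin_le_nhds (s := Set.Iio 1))
      simpa using h3
    filter_upwards [eventually_rad, hB.eventually_lt_const (half_pos hε)] with r ⟨h0, h1⟩ h2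
    rw [dist_zero_right, norm_smul, Real.norm_of_nonneg (by linarith)]
    -- The finitely many large errors contribute `(1 - r) B → 0`; the others contribute `ε / 2`
    -- after multiplication by `1 - r`.
    have hb : HasSum (fun k => (if k < K then ‖e (k + 1)‖ else 0) + ε / 2 * r ^ k)
        (B + ε / 2 * (1 - r)⁻¹) := by
      refine HasSum.add ?_ ((hasSum_geometric_of_lt_one h0 h1).mul_left _)
      have h5 : HasSum (fun k => if k < K then ‖e (k + 1)‖ else 0)
          (∑ k ∈ Finset.range K, if k < K then ‖e (k + 1)‖ else 0) :=
        hasSum_sum_of_ne_finset_zero fun k hk => by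
          rw [Finset.mem_range] at hk; simp [hk]
      rwa [Finset.sum_congr rfl fun k hk => if_pos (Finset.mem_range.mp hk)] at h5
    have h4 : ‖∑' k, r ^ k • e (k + 1)‖ ≤ B + ε / 2 * (1 - r)⁻¹ := by
      refine tsum_of_norm_bounded hb fun k => ?_
      rw [norm_smul, Real.norm_of_nonneg (pow_nonneg h0 k)]
      have hr1 : r ^ k ≤ 1 := pow_le_one₀ h0 h1.le
      have hr0 : 0 ≤ r ^ k := pow_nonneg h0 k
      split_ifs with hk
      · nlinarith [norm_nonneg (e (k + 1))]
      · have := hK (k + 1) (by omega)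
        rw [dist_zero_right] at this
        nlinarith
    calc (1 - r) * ‖∑' k, r ^ k • e (k + 1)‖ ≤ (1 - r) * (B + ε / 2 * (1 - r)⁻¹) :=
          mul_le_mul_of_nonneg_left h4 (by linarith)
      _ = (1 - r) * B + ε / 2 := by
          have : 1 - r ≠ 0 := by linarith
          field_simp
      _ < ε := by linarith
  have := hlim.add_const S
  rw [zero_add] at this
  refine this.congr' ?_
  filter_upwards [eventually_rad] with r ⟨h0, h1⟩
  rw [hform r h0 h1]

/-- `V = (1 - B)^d (1 - B^s)^D Y` in the sense of Abel summation. -/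
def AbelFilt (s : ℕ) (d D : ℝ) (Y V : ℤ → H) : Prop :=
  ∀ t, Tendsto (fun r : ℝ => filt (radSeq s d D r) Y t) (𝓝[<] 1) (𝓝 (V t))

lemma abelFilt_of_tendsto [CompleteSpace H] {s : ℕ} {d D : ℝ} {Y V : ℤ → H}
    (h : ∀ t, Tendsto (fun n => ∑ k ∈ Finset.range n, nablaCoeff s d D k • Y (t - k)) atTop
      (𝓝 (V t))) : AbelFilt s d D Y V := by
  intro t
  refine (tendsto_abel (h t)).congr fun r => ?_
  rw [radSeq, filt_extNat]
  congr 1; ext k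
  rw [radCoeff, smul_smul, mul_comm]

lemma AbelFilt.unique {s : ℕ} {d D : ℝ} {Y V V' : ℤ → H} (h : AbelFilt s d D Y V)
    (h' : AbelFilt s d D Y V') : V = V' :=
  funext fun t => tendsto_nhds_unique (h t) (h' t)

/-- Filters are continuous for bounded pointwise convergence. -/
lemma tendsto_filt {ι : Type*} {l : Filter ι} {a : ℤ → ℝ} (ha : Summable a) {Z : ι → ℤ → H}
    {V : ℤ → H} {M : ℝ} (hb : ∀ᶠ i in l, ∀ t, ‖Z i t‖ ≤ M)
    (h : ∀ t, Tendsto (fun i => Z i t) l (𝓝 (V t))) [CompleteSpace H] (t : ℤ) :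
    Tendsto (fun i => filt a (Z i) t) l (𝓝 (filt a V t)) := by
  refine tendsto_tsum_of_dominated_convergence (bound := fun j => |a j| * M) (ha.abs.mul_right M)
    (fun j => (h (t - j)).const_smul (a j)) ?_
  filter_upwards [hb] with i hi j
  rw [norm_smul]
  exact mul_le_mul_of_nonneg_left (hi _) (abs_nonneg _)

variable {F : Measure Circle} [IsFiniteMeasure F]

lemma HasSpec.norm_filt_eq [CompleteSpace H] {Y : ℤ → H} (h : HasSpec Y F) {a : ℤ → ℝ}
    (ha : Summable a) (t : ℤ) : ‖filt a Y t‖ = ‖filt a Y 0‖ := by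
  have := (h.norm_filt_sq ha t).trans (h.norm_filt_sq ha 0).symm
  exact (sq_eq_sq₀ (norm_nonneg _) (norm_nonneg _)).mp this

/-- By stationarity the norm of the filtered sequence does not depend on time, so convergence at
time `0` gives a bound uniform in `t`. `tendsto_filt` needs exactly this uniformity. -/
lemma AbelFilt.eventually_norm_le [CompleteSpace H] {s : ℕ} (hs : 0 < s) {d D : ℝ} {Y V : ℤ → H}
    (h : AbelFilt s d D Y V) (hY : HasSpec Y F) :
    ∀ᶠ r in 𝓝[<] (1 : ℝ), ∀ t, ‖filt (radSeq s d D r) Y t‖ ≤ ‖V 0‖ + 1 := by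
  filter_upwards [eventually_rad, (h 0).norm.eventually_le_const (lt_add_one _)]
    with r ⟨h0, h1⟩ h2 t
  rwa [hY.norm_filt_eq (summable_radSeq hs d D h0 h1)]

section

variable [CompleteSpace H] {s : ℕ} (hs : 0 < s) {d D : ℝ} {Y V : ℤ → H}

include hs

/-- The transfer function of an Abel filter is square integrable for the spectral measure. -/
lemma AbelFilt.integrable (h : AbelFilt s d D Y V) (hY : HasSpec Y F) (hF : F (unitRoots s) = 0) :
    Integrable (fun z : Circle => ‖nabla s d D z‖ ^ 2) F := by
  obtain ⟨r, hr⟩ := exists_seq_tendsto (𝓝[<] (1 : ℝ))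
  have hm := (measurable_nabla s d D).norm.pow_const 2
  refine ⟨hm.aestronglyMeasurable, ?_⟩
  have hae : ∀ᵐ z ∂F, z ∉ unitRoots s := measure_eq_zero_iff_ae_notMem.mp hF
  set g : ℕ → Circle → ENNReal := fun n z => ENNReal.ofReal (‖symb (radSeq s d D (r n)) z‖ ^ 2)
  have h1 : ∀ᵐ z ∂F, Tendsto (fun n => g n z) atTop (𝓝 (‖‖nabla s d D z‖ ^ 2‖ₑ)) := by
    filter_upwards [hae] with z hz
    rw [Real.enorm_of_nonneg (sq_nonneg _)]
    refine (ENNReal.continuous_ofReal.tendsto _).comp ?_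
    have h2 := ((tendsto_nabla_rad d D hz).comp hr).norm.pow 2
    refine h2.congr' ?_
    filter_upwards [hr.eventually eventually_rad] with n ⟨k0, k1⟩
    rw [symb_radSeq hs d D k0 k1]
    rfl
  have h2 : ∫⁻ z, ‖‖nabla s d D z‖ ^ 2‖ₑ ∂F = ∫⁻ z, liminf (fun n => g n z) atTop ∂F :=
    lintegral_congr_ae (h1.mono fun z hz => hz.liminf_eq.symm)
  have hgm : ∀ᶠ n in atTop, ∫⁻ z, g n z ∂F =
      ENNReal.ofReal (‖filt (radSeq s d D (r n)) Y 0‖ ^ 2) := by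
    filter_upwards [hr.eventually eventually_rad] with n ⟨k0, k1⟩
    have hsum := summable_radSeq hs d D k0 k1
    have hc : Continuous fun z => ‖symb (radSeq s d D (r n)) z‖ ^ 2 :=
      (continuous_symb hsum).norm.pow 2
    rw [hY.norm_filt_sq hsum, ofReal_integral_eq_lintegral_ofReal
      (integrable_of_continuous hc) (Eventually.of_forall fun z => sq_nonneg _)]
  have h3 : Tendsto (fun n => ∫⁻ z, g n z ∂F) atTop (𝓝 (ENNReal.ofReal (‖V 0‖ ^ 2))) := by
    refine Tendsto.congr' (hgm.mono fun n hn => hn.symm) ?_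
    exact (ENNReal.continuous_ofReal.tendsto _).comp (((h 0).comp hr).norm.pow 2)
  have hgmeas : ∀ᶠ n in atTop, AEMeasurable (g n) F := by
    filter_upwards [hr.eventually eventually_rad] with n ⟨k0, k1⟩
    have hc := (continuous_symb (summable_radSeq hs d D k0 k1)).norm.pow 2
    exact (ENNReal.continuous_ofReal.comp hc).measurable.aemeasurable
  -- Fatou's lemma bounds the integral by `‖V 0‖²`. It asks for measurability at every index, so the
  -- sequence is shifted past `n₀`.
  obtain ⟨n₀, hn₀⟩ := eventually_atTop.mp hgmeas
  have h4 : ∫⁻ z, liminf (fun n => g (n + n₀) z) atTop ∂F ≤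
      liminf (fun n => ∫⁻ z, g (n + n₀) z ∂F) atTop :=
    lintegral_liminf_le' fun n => hn₀ _ (Nat.le_add_left _ _)
  have h5 := h3.comp (tendsto_add_atTop_nat n₀)
  rw [HasFiniteIntegral]
  calc ∫⁻ z, ‖‖nabla s d D z‖ ^ 2‖ₑ ∂F = ∫⁻ z, liminf (fun n => g (n + n₀) z) atTop ∂F := by
        rw [h2]
        refine lintegral_congr fun z => ?_
        exact (liminf_nat_add (fun n => g n z) n₀).symm
    _ ≤ liminf (fun n => ∫⁻ z, g (n + n₀) z ∂F) atTop := h4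
    _ = ENNReal.ofReal (‖V 0‖ ^ 2) := h5.liminf_eq
    _ < ⊤ := ENNReal.ofReal_lt_top

/-- Passage to the limit in the spectral formula for the Abel sums; `exists_nabla_bound` and
`AbelFilt.integrable` supply the dominating function. -/
lemma AbelFilt.inner_eq (h : AbelFilt s d D Y V) (hY : HasSpec Y F) (hF : F (unitRoots s) = 0)
    (t u : ℤ) : ((inner ℝ (V t) (V u) : ℝ) : ℂ) =
      ∫ z : Circle, (z : ℂ) ^ (t - u) * (‖nabla s d D z‖ ^ 2 : ℝ) ∂F := by
  obtain ⟨C, hC, hb⟩ := exists_nabla_bound hs d D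
  have hae : ∀ᵐ z ∂F, z ∉ unitRoots s := measure_eq_zero_iff_ae_notMem.mp hF
  have hint := h.integrable hs hY hF
  have h1 : Tendsto (fun r : ℝ => ((inner ℝ (filt (radSeq s d D r) Y t)
      (filt (radSeq s d D r) Y u) : ℝ) : ℂ)) (𝓝[<] 1) (𝓝 ((inner ℝ (V t) (V u) : ℝ) : ℂ)) :=
    (Complex.continuous_ofReal.tendsto _).comp ((h t).inner (h u))
  refine tendsto_nhds_unique h1 ?_
  have h2 : Tendsto (fun r : ℝ => ∫ z : Circle, (z : ℂ) ^ (t - u) *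
      (‖symb (radSeq s d D r) z‖ ^ 2 : ℝ) ∂F) (𝓝[<] 1)
      (𝓝 (∫ z : Circle, (z : ℂ) ^ (t - u) * (‖nabla s d D z‖ ^ 2 : ℝ) ∂F)) := by
    refine tendsto_integral_filter_of_dominated_convergence
      (fun z => 2 * C ^ 2 * (1 + ‖nabla s d D z‖ ^ 2)) ?_ ?_ ?_ ?_
    · filter_upwards [eventually_rad] with r ⟨k0, k1⟩
      have hc := (continuous_symb (summable_radSeq hs d D k0 k1)).norm.pow 2
      exact ((continuous_coe_zpow _).mul
        (Complex.continuous_ofReal.comp hc)).aestronglyMeasurable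
    · filter_upwards [eventually_rad] with r ⟨k0, k1⟩
      filter_upwards [hae] with z hz
      have h3 := (hb z hz r k0 k1).2
      rw [norm_zpow_mul, symb_radSeq hs d D k0 k1, Complex.norm_real, Real.norm_of_nonneg (sq_nonneg _)]
      have h4 : ‖nabla s d D (r * z)‖ ^ 2 ≤ (C * (1 + ‖nabla s d D z‖)) ^ 2 :=
        pow_le_pow_left₀ (norm_nonneg _) h3 2
      nlinarith [sq_nonneg (1 - ‖nabla s d D z‖), sq_nonneg C, mul_nonneg (sq_nonneg C) (sq_nonneg (1 - ‖nabla s d D z‖))]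
    · exact ((integrable_const _).add hint).const_mul _
    · filter_upwards [hae] with z hz
      refine Tendsto.const_mul _ ((Complex.continuous_ofReal.tendsto _).comp ?_)
      refine ((tendsto_nabla_rad d D hz).norm.pow 2).congr' ?_
      filter_upwards [eventually_rad] with r ⟨k0, k1⟩
      rw [symb_radSeq hs d D k0 k1]
  refine h2.congr' ?_
  filter_upwards [eventually_rad] with r ⟨k0, k1⟩
  rw [hY.inner_filt_self (summable_radSeq hs d D k0 k1)]

lemma AbelFilt.hasSpec (h : AbelFilt s d D Y V) (hY : HasSpec Y F) (hF : F (unitRoots s) = 0) :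
    HasSpec V (F.withDensity fun z => ENNReal.ofReal (‖nabla s d D z‖ ^ 2)) := by
  intro t u
  rw [h.inner_eq hs hY hF,
    integral_withDensity_ofReal ((measurable_nabla s d D).norm.pow_const 2) fun z => sq_nonneg _]

/-- Inversion of Abel filters. -/
theorem AbelFilt.inv (h : AbelFilt s d D Y V) (hY : HasSpec Y F) (hF : F (unitRoots s) = 0) :
    AbelFilt s (-d) (-D) V Y := by
  obtain ⟨C, hC, hb⟩ := exists_nabla_bound hs d D
  have hae : ∀ᵐ z ∂F, z ∉ unitRoots s := measure_eq_zero_iff_ae_notMem.mp hF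
  have hint := h.integrable hs hY hF
  have hmeas := measurable_nabla s d D
  -- The two radii go to `1` one after the other: here the inverse filter is frozen at radius `ρ`,
  -- hence bounded by `M`, while the radius `r` of the direct filter tends to `1`.
  have key : ∀ ρ : ℝ, 0 ≤ ρ → ρ < 1 → ∀ t, ‖filt (radSeq s (-d) (-D) ρ) V t - Y t‖ ^ 2 =
      ∫ z : Circle, ‖symb (radSeq s (-d) (-D) ρ) z * nabla s d D z - 1‖ ^ 2 ∂F := by
    intro ρ hρ0 hρ1 t
    have hsρ := summable_radSeq hs (-d) (-D) hρ0 hρ1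
    set M := ∑' j, |radSeq s (-d) (-D) ρ j|
    have hM : ∀ z, ‖symb (radSeq s (-d) (-D) ρ) z‖ ≤ M := norm_symb_le hsρ
    have h1 := ((tendsto_filt hsρ (h.eventually_norm_le hs hY) h t).sub_const (Y t)).norm.pow 2
    refine tendsto_nhds_unique h1 ?_
    have h2 : Tendsto (fun r : ℝ => ∫ z : Circle, ‖symb (radSeq s (-d) (-D) ρ) z *
        symb (radSeq s d D r) z - 1‖ ^ 2 ∂F) (𝓝[<] 1)
        (𝓝 (∫ z : Circle, ‖symb (radSeq s (-d) (-D) ρ) z * nabla s d D z - 1‖ ^ 2 ∂F)) := by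
      refine tendsto_integral_filter_of_dominated_convergence
        (fun z => 4 * (M * C) ^ 2 * (1 + ‖nabla s d D z‖ ^ 2) + 2) ?_ ?_ ?_ ?_
      · filter_upwards [eventually_rad] with r ⟨k0, k1⟩
        have hc := continuous_symb (summable_radSeq hs d D k0 k1)
        exact ((((continuous_symb hsρ).mul hc).sub continuous_const).norm.pow 2).aestronglyMeasurable
      · filter_upwards [eventually_rad] with r ⟨k0, k1⟩
        filter_upwards [hae] with z hz
        have h3 := (hb z hz r k0 k1).2
        rw [Real.norm_of_nonneg (sq_nonneg _), symb_radSeq hs d D k0 k1]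
        have hM0 : 0 ≤ M := (norm_nonneg _).trans (hM z)
        have h4 : ‖symb (radSeq s (-d) (-D) ρ) z * nabla s d D (r * z) - 1‖ ≤
            M * C * (1 + ‖nabla s d D z‖) + 1 := by
          refine (norm_sub_le _ _).trans ?_
          rw [norm_one, norm_mul]
          have := mul_le_mul (hM z) h3 (norm_nonneg _) hM0
          linarith
        have h5 := pow_le_pow_left₀ (norm_nonneg _) h4 2
        set x := ‖nabla s d D z‖
        nlinarith [sq_nonneg (M * C * (1 + x) - 1),
          mul_nonneg (sq_nonneg (M * C)) (sq_nonneg (1 - x))]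
      · exact (((integrable_const _).add hint).const_mul _).add (integrable_const _)
      · filter_upwards [hae] with z hz
        refine ((Tendsto.const_mul _ ?_).sub_const 1).norm.pow 2
        refine (tendsto_nabla_rad d D hz).congr' ?_
        filter_upwards [eventually_rad] with r ⟨k0, k1⟩
        rw [symb_radSeq hs d D k0 k1]
    refine h2.congr' ?_
    filter_upwards [eventually_rad] with r ⟨k0, k1⟩
    have hsr := summable_radSeq hs d D k0 k1
    rw [filt_filt hsρ hsr (summable_conv hsρ hsr) (fun z => (symb_conv hsρ hsr z).symm) hY.bddSeq,
      hY.norm_filt_sub_self_sq (summable_conv hsρ hsr)]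
    simp_rw [symb_conv hsρ hsr]
  intro t
  -- Now `ρ → 1`. The bound on boundary value over inner value gives a majorant independent of `ρ`,
  -- and the integrand tends to `0` off the roots of unity.
  have h1 : Tendsto (fun ρ : ℝ => ∫ z : Circle,
      ‖symb (radSeq s (-d) (-D) ρ) z * nabla s d D z - 1‖ ^ 2 ∂F) (𝓝[<] 1) (𝓝 (∫ z : Circle, 0 ∂F)) := by
    refine tendsto_integral_filter_of_dominated_convergence
      (fun z => 4 * C ^ 2 * (1 + ‖nabla s d D z‖ ^ 2) + 2) ?_ ?_ ?_ ?_
    · filter_upwards [eventually_rad] with r ⟨k0, k1⟩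
      have hc := (continuous_symb (summable_radSeq hs (-d) (-D) k0 k1)).measurable
      exact (((hc.mul hmeas).sub_const 1).norm.pow_const 2).aestronglyMeasurable
    · filter_upwards [eventually_rad] with r ⟨k0, k1⟩
      filter_upwards [hae] with z hz
      have h3 := (hb z hz r k0 k1).1
      rw [Real.norm_of_nonneg (sq_nonneg _), symb_radSeq hs (-d) (-D) k0 k1, nabla_neg]
      have h4 : ‖(nabla s d D (r * z))⁻¹ * nabla s d D z - 1‖ ≤
          C * (1 + ‖nabla s d D z‖) + 1 := by
        refine (norm_sub_le _ _).trans ?_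
        rw [norm_one, norm_mul, norm_inv, inv_mul_eq_div]
        linarith
      have h5 := pow_le_pow_left₀ (norm_nonneg _) h4 2
      set x := ‖nabla s d D z‖
      nlinarith [sq_nonneg (C * (1 + x) - 1), mul_nonneg (sq_nonneg C) (sq_nonneg (1 - x))]
    · exact (((integrable_const _).add hint).const_mul _).add (integrable_const _)
    · filter_upwards [hae] with z hz
      have h2 : Tendsto (fun ρ : ℝ => symb (radSeq s (-d) (-D) ρ) z) (𝓝[<] 1)
          (𝓝 (nabla s (-d) (-D) z)) := by
        refine (tendsto_nabla_rad (-d) (-D) hz).congr' ?_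
        filter_upwards [eventually_rad] with r ⟨k0, k1⟩
        rw [symb_radSeq hs _ _ k0 k1]
      have h3 := ((h2.mul_const (nabla s d D z)).sub_const 1).norm.pow 2
      rwa [nabla_neg, inv_mul_cancel₀ (nabla_circle_ne_zero hz d D), sub_self, norm_zero,
        zero_pow two_ne_zero] at h3
  rw [integral_zero] at h1
  have h2 : Tendsto (fun ρ : ℝ => ‖filt (radSeq s (-d) (-D) ρ) V t - Y t‖ ^ 2) (𝓝[<] 1) (𝓝 0) := by
    refine h1.congr' ?_
    filter_upwards [eventually_rad] with r ⟨k0, k1⟩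
    rw [key r k0 k1]
  rw [tendsto_iff_norm_sub_tendsto_zero]
  have h3 := h2.sqrt
  simpa using h3

end

end AbelLimit

section Periodic

variable {H : Type*} [NormedAddCommGroup H] [InnerProductSpace ℝ H]

/-! ### Periodic components -/

/-- The averages of `Y` along lags that are multiples of `s` tend to zero. -/
def NoPeriodic (s : ℕ) (Y : ℤ → H) : Prop :=
  ∀ t : ℤ, Tendsto (fun n : ℕ => (n : ℝ)⁻¹ • ∑ k ∈ Finset.range n, Y (t - (s : ℤ) * k)) atTop (𝓝 0)

/-- The weights of the average over the lags `0, s, …, (n-1)s`. -/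
def avgSeq (s n : ℕ) (j : ℤ) : ℝ :=
  ∑ k ∈ Finset.range n, if j = (s : ℤ) * k then (n : ℝ)⁻¹ else 0

lemma summable_avgSeq (s n : ℕ) : Summable (avgSeq s n) := by
  unfold avgSeq
  refine summable_sum fun k _ => ?_
  exact summable_of_ne_finset_zero (s := {(s : ℤ) * k}) fun j hj => by
    rw [Finset.mem_singleton] at hj; simp [hj]

lemma filt_avgSeq (s n : ℕ) (Y : ℤ → H) (t : ℤ) :
    filt (avgSeq s n) Y t = (n : ℝ)⁻¹ • ∑ k ∈ Finset.range n, Y (t - (s : ℤ) * k) := by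
  simp only [filt, avgSeq, Finset.sum_smul]
  rw [Summable.tsum_finsetSum]
  · rw [Finset.smul_sum]
    refine Finset.sum_congr rfl fun k _ => ?_
    rw [tsum_eq_single ((s : ℤ) * k)]
    · simp
    · intro j hj; simp [hj]
  · intro k _
    exact summable_of_ne_finset_zero (s := {(s : ℤ) * k}) fun j hj => by
      rw [Finset.mem_singleton] at hj; simp [hj]

lemma symb_avgSeq (s n : ℕ) (z : Circle) :
    symb (avgSeq s n) z = (n : ℂ)⁻¹ * geomPoly n ((z : ℂ) ^ s) := by
  simp only [symb, avgSeq, Complex.ofReal_sum, Finset.sum_mul, geomPoly]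
  rw [Summable.tsum_finsetSum]
  · rw [Finset.mul_sum]
    refine Finset.sum_congr rfl fun k _ => ?_
    rw [tsum_eq_single ((s : ℤ) * k)]
    · simp only [if_true, zpow_mul, zpow_natCast]
      push_cast; rfl
    · intro j hj; simp [hj]
  · intro k _
    exact summable_of_ne_finset_zero (s := {(s : ℤ) * k}) fun j hj => by
      rw [Finset.mem_singleton] at hj; simp [hj]

lemma symb_avgSeq_of_mem {s n : ℕ} (hn : 0 < n) {z : Circle} (hz : z ∈ unitRoots s) :
    symb (avgSeq s n) z = 1 := by
  rw [symb_avgSeq, show (z : ℂ) ^ s = 1 from hz]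
  have : (n : ℂ) ≠ 0 := by exact_mod_cast hn.ne'
  simp [geomPoly, this]

lemma norm_symb_avgSeq_le (s n : ℕ) (z : Circle) : ‖symb (avgSeq s n) z‖ ≤ 1 := by
  have h1 : ‖(z : ℂ) ^ s‖ ≤ 1 := by rw [norm_pow, Circle.norm_coe, one_pow]
  rw [symb_avgSeq, norm_mul, norm_inv, Complex.norm_natCast]
  rcases Nat.eq_zero_or_pos n with rfl | hn
  · simp
  · have hn' : (0 : ℝ) < n := by exact_mod_cast hn
    rw [inv_mul_le_one₀ hn']
    exact norm_geomPoly_le n h1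

lemma tendsto_symb_avgSeq {s : ℕ} {z : Circle} (hz : z ∉ unitRoots s) :
    Tendsto (fun n => symb (avgSeq s n) z) atTop (𝓝 0) := by
  have h0 := one_sub_pow_ne_zero hz
  have hpos := norm_pos_iff.mpr h0
  refine squeeze_zero_norm (a := fun n : ℕ => (2 / ‖1 - (z : ℂ) ^ s‖) / n) (fun n => ?_)
    (tendsto_const_div_atTop_nhds_zero_nat _)
  rw [symb_avgSeq, norm_mul, norm_inv, Complex.norm_natCast, inv_mul_eq_div]
  gcongr
  rw [le_div_iff₀ hpos, mul_comm, ← norm_mul, one_sub_mul_geomPoly]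
  apply norm_one_sub_le
  rw [norm_pow, norm_pow, Circle.norm_coe, one_pow, one_pow]

variable [CompleteSpace H] {F : Measure Circle} [IsFiniteMeasure F] {s : ℕ} {Y V : ℤ → H}

/-- The mean ergodic theorem in spectral form: the averaging symbols are bounded by `1` and tend to
`0` off the `s`-th roots of unity. -/
lemma HasSpec.noPeriodic (hY : HasSpec Y F) (hF : F (unitRoots s) = 0) : NoPeriodic s Y := by
  intro t
  have hae : ∀ᵐ z ∂F, z ∉ unitRoots s := measure_eq_zero_iff_ae_notMem.mp hF
  have h1 : Tendsto (fun n => ∫ z, ‖symb (avgSeq s n) z‖ ^ 2 ∂F) atTop (𝓝 (∫ z : Circle, 0 ∂F)) := by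
    refine tendsto_integral_of_dominated_convergence (fun _ => 1) (fun n => ?_)
      (integrable_const _) (fun n => ?_) ?_
    · exact ((continuous_symb (summable_avgSeq s n)).norm.pow 2).aestronglyMeasurable
    · filter_upwards with z
      rw [Real.norm_of_nonneg (sq_nonneg _)]
      exact pow_le_one₀ (norm_nonneg _) (norm_symb_avgSeq_le s n z)
    · filter_upwards [hae] with z hz
      simpa using (tendsto_symb_avgSeq hz).norm.pow 2
  rw [integral_zero] at h1
  simp_rw [← hY.norm_filt_sq (summable_avgSeq s _) t] at h1
  rw [tendsto_zero_iff_norm_tendsto_zero]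
  simp_rw [← filt_avgSeq]
  simpa using h1.sqrt

lemma HasSpec.measureReal_unitRoots_le (hY : HasSpec Y F) {a : ℤ → ℝ} (ha : Summable a) {c : ℝ}
    (hc : 0 ≤ c) (h : ∀ z ∈ unitRoots s, c ≤ ‖symb a z‖) (t : ℤ) :
    c ^ 2 * F.real (unitRoots s) ≤ ‖filt a Y t‖ ^ 2 := by
  have hcont : Continuous fun z => ‖symb a z‖ ^ 2 := (continuous_symb ha).norm.pow 2
  rw [hY.norm_filt_sq ha]
  calc c ^ 2 * F.real (unitRoots s) = ∫ z in unitRoots s, c ^ 2 ∂F := by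
        rw [setIntegral_const, smul_eq_mul, mul_comm]
    _ ≤ ∫ z in unitRoots s, ‖symb a z‖ ^ 2 ∂F := by
        refine setIntegral_mono_on (integrable_const _).integrableOn
          (integrable_of_continuous hcont).integrableOn (measurableSet_unitRoots s) fun z hz => ?_
        exact pow_le_pow_left₀ hc (h z hz) 2
    _ ≤ _ := setIntegral_le_integral (integrable_of_continuous hcont)
        (Eventually.of_forall fun z => sq_nonneg _)

/-- The averaging symbol equals `1` on the roots of unity, so the mass there is at most the squared
norm of every average. -/
lemma HasSpec.unitRoots_eq_zero (hY : HasSpec Y F) (h : NoPeriodic s Y) : F (unitRoots s) = 0 := by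
  have h1 : ∀ᶠ n : ℕ in atTop, F.real (unitRoots s) ≤
      ‖(n : ℝ)⁻¹ • ∑ k ∈ Finset.range n, Y (0 - (s : ℤ) * k)‖ ^ 2 := by
    filter_upwards [eventually_gt_atTop 0] with n hn
    have := hY.measureReal_unitRoots_le (s := s) (summable_avgSeq s n) zero_le_one (fun z hz => by
      rw [symb_avgSeq_of_mem hn hz, norm_one]) 0
    rwa [filt_avgSeq, one_pow, one_mul] at this
  have h2 := ge_of_tendsto ((h 0).norm.pow 2) h1
  rw [norm_zero, zero_pow two_ne_zero] at h2
  exact (measureReal_eq_zero_iff).mp (le_antisymm h2 measureReal_nonneg)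

/-- If the filter has no zero, periodic components are inherited by the filtered sequence. -/
lemma AbelFilt.unitRoots_eq_zero (hs : 0 < s) {d D : ℝ} (hd : d + D ≤ 0) (hD : D ≤ 0)
    (h : AbelFilt s d D Y V) (hY : HasSpec Y F) (hV : NoPeriodic s V) : F (unitRoots s) = 0 := by
  obtain ⟨c, hc, hb⟩ := exists_le_norm_nabla hs hd hD
  have h1 : ∀ᶠ n : ℕ in atTop, c ^ 2 * F.real (unitRoots s) ≤
      ‖(n : ℝ)⁻¹ • ∑ k ∈ Finset.range n, V (0 - (s : ℤ) * k)‖ ^ 2 := by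
    filter_upwards [eventually_gt_atTop 0] with n hn
    have hn' := summable_avgSeq s n
    have h2 := (tendsto_filt hn' (h.eventually_norm_le hs hY) h 0).norm.pow 2
    rw [filt_avgSeq] at h2
    refine ge_of_tendsto h2 ?_
    filter_upwards [eventually_rad] with r ⟨k0, k1⟩
    have hr := summable_radSeq hs d D k0 k1
    have hz := fun z => symb_conv hn' hr z
    -- On the roots of unity the symbol of the composed filter is `nabla` at `r z`, of modulus at
    -- least `c` uniformly in `r` and `n`.
    rw [filt_filt hn' hr (summable_conv hn' hr) (fun z => (hz z).symm) hY.bddSeq]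
    refine hY.measureReal_unitRoots_le (summable_conv hn' hr) hc.le (fun z hzR => ?_) 0
    rw [hz, symb_avgSeq_of_mem hn hzR, one_mul, symb_radSeq hs d D k0 k1]
    exact hb z r k0 k1
  have h2 := ge_of_tendsto ((hV 0).norm.pow 2) h1
  rw [norm_zero, zero_pow two_ne_zero] at h2
  have h3 : F.real (unitRoots s) ≤ 0 := by
    by_contra hcon
    push Not at hcon
    have : 0 < c ^ 2 * F.real (unitRoots s) := by positivity
    linarith
  exact (measureReal_eq_zero_iff).mp (le_antisymm h3 measureReal_nonneg)

end Periodic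

/-! ### White noise -/

section WhiteNoise

variable {H : Type*} [NormedAddCommGroup H] [InnerProductSpace ℝ H] {ε : ℤ → H} {σ2 : ℝ}

/-- An orthogonal sequence of vectors of squared norm `σ2`. -/
def OrthoNoise (ε : ℤ → H) (σ2 : ℝ) : Prop :=
  ∀ t u, inner ℝ (ε t) (ε u) = if t = u then σ2 else 0

/-- The spectral measure of white noise. -/
def noiseMeasure (σ2 : ℝ) : Measure Circle := ENNReal.ofReal (σ2 / (2 * Real.pi)) • arcLength

instance : IsFiniteMeasure (noiseMeasure σ2) := Measure.smul_finite _ ENNReal.ofReal_ne_top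

lemma noiseMeasure_unitRoots {s : ℕ} (hs : 0 < s) : noiseMeasure σ2 (unitRoots s) = 0 := by
  simp [noiseMeasure, arcLength_unitRoots hs]

lemma integral_noiseMeasure (h0 : 0 ≤ σ2) {E : Type*} [NormedAddCommGroup E] [NormedSpace ℝ E]
    (f : Circle → E) :
    ∫ z, f z ∂(noiseMeasure σ2) = (σ2 / (2 * Real.pi)) • ∫ z, f z ∂arcLength := by
  rw [noiseMeasure, integral_smul_measure, ENNReal.toReal_ofReal]
  have := Real.pi_pos
  positivity

lemma OrthoNoise.hasSpec (h : OrthoNoise ε σ2) (h0 : 0 ≤ σ2) : HasSpec ε (noiseMeasure σ2) := by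
  intro t u
  rw [h, integral_noiseMeasure h0, integral_zpow_arcLength]
  have : (Real.pi : ℂ) ≠ 0 := by simp [Real.pi_ne_zero]
  split_ifs with h1 h2 h2
  · rw [Complex.real_smul]; push_cast; field_simp
  · omega
  · omega
  · simp

variable {s : ℕ} {d D : ℝ}

lemma OrthoNoise.norm_sum_sq (h : OrthoNoise ε σ2) (c : ℕ → ℝ) (n : ℕ) (t : ℤ) :
    ‖∑ k ∈ Finset.range n, c k • ε (t - k)‖ ^ 2 = σ2 * ∑ k ∈ Finset.range n, c k ^ 2 := by
  rw [← real_inner_self_eq_norm_sq, sum_inner, Finset.mul_sum]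
  refine Finset.sum_congr rfl fun j hj => ?_
  rw [inner_sum, Finset.sum_eq_single j]
  · rw [inner_smul_left, inner_smul_right, h, if_pos rfl]
    simp; ring
  · intro k _ hk
    rw [inner_smul_left, inner_smul_right, h, if_neg (by omega)]
    simp
  · intro hj'; exact absurd hj hj'

/-- The coefficients of `(1 - z)^d (1 - z^s)^D` are square summable if the function is square
integrable on the unit circle. -/
lemma OrthoNoise.summable_nablaCoeff_sq [CompleteSpace H] (h : OrthoNoise ε σ2) (h0 : 0 < σ2)
    (hs : 0 < s) (h1 : -(1 / 2) < d + D) (h2 : -(1 / 2) < D) :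
    Summable fun n => nablaCoeff s d D n ^ 2 := by
  obtain ⟨C, hC, hb⟩ := exists_nabla_bound hs d D
  have hint := integrable_norm_nabla_sq hs h1 h2
  have hae : ∀ᵐ z ∂arcLength, z ∉ unitRoots s :=
    measure_eq_zero_iff_ae_notMem.mp (arcLength_unitRoots hs)
  set K := ∫ z : Circle, 2 * C ^ 2 * (1 + ‖nabla s d D z‖ ^ 2) ∂arcLength with hK
  have hspec := h.hasSpec h0.le
  have hpi := Real.pi_pos
  -- Parseval's bound, read off from the filtered noise: its squared norm dominates `σ2` times the
  -- sum of squares and is also an integral bounded uniformly in `r` by `exists_nabla_bound`.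
  have key : ∀ r : ℝ, 0 ≤ r → r < 1 → ∀ n,
      ∑ k ∈ Finset.range n, radCoeff s d D r k ^ 2 ≤ K / (2 * Real.pi) := by
    intro r k0 k1 n
    have hsum := summable_radSeq hs d D k0 k1
    have e1 := hspec.norm_filt_sq hsum 0
    rw [integral_noiseMeasure h0.le, smul_eq_mul] at e1
    have e2 : ∫ z, ‖symb (radSeq s d D r) z‖ ^ 2 ∂arcLength ≤ K := by
      refine integral_mono_ae
        (integrable_of_continuous ((continuous_symb hsum).norm.pow 2))
        (((integrable_const _).add hint).const_mul _) ?_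
      filter_upwards [hae] with z hz
      have h3 := (hb z hz r k0 k1).2
      simp only [symb_radSeq hs d D k0 k1]
      have h4 : ‖nabla s d D (r * z)‖ ^ 2 ≤ (C * (1 + ‖nabla s d D z‖)) ^ 2 :=
        pow_le_pow_left₀ (norm_nonneg _) h3 2
      nlinarith [mul_nonneg (sq_nonneg C) (sq_nonneg (1 - ‖nabla s d D z‖))]
    have e3 : Tendsto (fun m => ‖∑ k ∈ Finset.range m, radCoeff s d D r k • ε (0 - k)‖ ^ 2) atTop
        (𝓝 (‖filt (radSeq s d D r) ε 0‖ ^ 2)) := by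
      rw [radSeq, filt_extNat]
      have hsm : Summable fun n : ℕ => radCoeff s d D r n • ε (0 - n) := by
        have h5 := (summable_filt hsum hspec.bddSeq 0).comp_injective
          (i := ((↑) : ℕ → ℤ)) Nat.cast_injective
        simpa [Function.comp_def, radSeq] using h5
      exact (hsm.hasSum.tendsto_sum_nat.norm).pow 2
    have e4 : σ2 * ∑ k ∈ Finset.range n, radCoeff s d D r k ^ 2 ≤
        ‖filt (radSeq s d D r) ε 0‖ ^ 2 := by
      refine ge_of_tendsto e3 ?_
      filter_upwards [eventually_ge_atTop n] with m hm
      rw [h.norm_sum_sq]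
      refine mul_le_mul_of_nonneg_left ?_ h0.le
      exact Finset.sum_le_sum_of_subset_of_nonneg (Finset.range_mono hm) fun _ _ _ => sq_nonneg _
    rw [e1] at e4
    have e5 : σ2 * ∑ k ∈ Finset.range n, radCoeff s d D r k ^ 2 ≤ σ2 * (K / (2 * Real.pi)) := by
      refine e4.trans ?_
      calc σ2 / (2 * Real.pi) * ∫ z, ‖symb (radSeq s d D r) z‖ ^ 2 ∂arcLength
          ≤ σ2 / (2 * Real.pi) * K := by gcongr
        _ = _ := by ring
    exact le_of_mul_le_mul_left e5 h0
  refine summable_of_sum_range_le (c := K / (2 * Real.pi)) (fun n => sq_nonneg _) fun n => ?_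
  have hlim : Tendsto (fun r : ℝ => ∑ k ∈ Finset.range n, radCoeff s d D r k ^ 2) (𝓝[<] 1)
      (𝓝 (∑ k ∈ Finset.range n, nablaCoeff s d D k ^ 2)) := by
    have : Continuous fun r : ℝ => ∑ k ∈ Finset.range n, radCoeff s d D r k ^ 2 := by
      unfold radCoeff; fun_prop
    have h6 := (this.tendsto 1).mono_left (nhdsWithin_le_nhds (s := Set.Iio 1))
    simpa [radCoeff] using h6
  refine le_of_tendsto hlim ?_
  filter_upwards [eventually_rad] with r ⟨k0, k1⟩
  exact key r k0 k1 n

lemma OrthoNoise.summable_smul [CompleteSpace H] (h : OrthoNoise ε σ2) (h0 : 0 < σ2) {c : ℕ → ℝ}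
    (hc : Summable fun n => c n ^ 2) {τ : ℕ → ℤ} (hτ : Function.Injective τ) :
    Summable fun k => c k • ε (τ k) := by
  have hσ := Real.sqrt_pos.mpr h0
  have hon : Orthonormal ℝ fun k => (√σ2)⁻¹ • ε (τ k) := by
    rw [orthonormal_iff_ite]
    intro j k
    rw [inner_smul_left, inner_smul_right, h]
    by_cases hjk : j = k
    · rw [if_pos hjk, if_pos (by rw [hjk])]
      simp only [map_inv₀, conj_trivial]
      rw [← mul_assoc, ← mul_inv, Real.mul_self_sqrt h0.le, inv_mul_cancel₀ h0.ne']
    · rw [if_neg hjk, if_neg fun he => hjk (hτ he)]; simp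
  have h1 := (hon.orthogonalFamily.summable_iff_norm_sq_summable (fun k => √σ2 * c k)).mpr (by
    simp_rw [Real.norm_eq_abs, sq_abs, mul_pow]
    exact hc.mul_left _)
  refine h1.congr fun k => ?_
  simp only [LinearIsometry.toSpanSingleton_apply, smul_smul]
  congr 1
  field_simp

end WhiteNoise

/-! ### Boundedness of partial sums in weighted `L²` -/

section Projection

variable {s : ℕ} {d D : ℝ}

lemma integrable_nabla_inv_sq (hs : 0 < s) (h1 : |d + D| < 1 / 2) (h2 : |D| < 1 / 2) :
    Integrable (fun z : Circle => ‖nabla s (-d) (-D) z‖ ^ 2) arcLength := by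
  rw [abs_lt] at h1 h2
  exact integrable_norm_nabla_sq hs (by linarith) (by linarith)

lemma continuous_nabla_rad (hs : 0 < s) (d D : ℝ) {ρ : ℝ} (h0 : 0 ≤ ρ) (h1 : ρ < 1) :
    Continuous fun z : Circle => nabla s d D (ρ * z) := by
  simp_rw [← symb_radSeq hs d D h0 h1]
  exact continuous_symb (summable_radSeq hs d D h0 h1)

/-- The second factor is only a boundary value. The vanishing is inherited from radii `r < 1` by
dominated convergence. -/
lemma integral_pow_mul_nabla_sq_eq_zero (hs : 0 < s) (h1 : |d + D| < 1 / 2) (h2 : |D| < 1 / 2)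
    {ρ : ℝ} (hρ0 : 0 ≤ ρ) (hρ1 : ρ < 1) {l : ℕ} (hl : 0 < l) :
    ∫ z : Circle, (z : ℂ) ^ l * (nabla s d D (ρ * z) * nabla s (-d) (-D) z) ^ 2 ∂arcLength = 0 := by
  obtain ⟨C, hC, hb⟩ := exists_nabla_bound hs (-d) (-D)
  have hint := integrable_nabla_inv_sq hs h1 h2
  have hae : ∀ᵐ z ∂arcLength, z ∉ unitRoots s :=
    measure_eq_zero_iff_ae_notMem.mp (arcLength_unitRoots hs)
  have hρc := continuous_nabla_rad hs d D hρ0 hρ1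
  set M := ∑' j, |radSeq s d D ρ j|
  have hM : ∀ z : Circle, ‖nabla s d D (ρ * z)‖ ≤ M := fun z => by
    rw [← symb_radSeq hs d D hρ0 hρ1]
    exact norm_symb_le (summable_radSeq hs d D hρ0 hρ1) z
  have hpow : ∀ z : Circle, ‖(z : ℂ) ^ l‖ = 1 := fun z => by
    rw [norm_pow, Circle.norm_coe, one_pow]
  have hlim : Tendsto (fun r : ℝ => ∫ z : Circle, (z : ℂ) ^ l *
      (nabla s d D (ρ * z) * nabla s (-d) (-D) (r * z)) ^ 2 ∂arcLength) (𝓝[<] 1)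
      (𝓝 (∫ z : Circle, (z : ℂ) ^ l *
      (nabla s d D (ρ * z) * nabla s (-d) (-D) z) ^ 2 ∂arcLength)) := by
    refine tendsto_integral_filter_of_dominated_convergence
      (fun z => 2 * (M * C) ^ 2 * (1 + ‖nabla s (-d) (-D) z‖ ^ 2)) ?_ ?_ ?_ ?_
    · filter_upwards [eventually_rad] with r ⟨k0, k1⟩
      have hrc := continuous_nabla_rad hs (-d) (-D) k0 k1
      exact Continuous.aestronglyMeasurable (by fun_prop)
    · filter_upwards [eventually_rad] with r ⟨k0, k1⟩
      filter_upwards [hae] with z hz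
      have hM0 : 0 ≤ M := (norm_nonneg _).trans (hM z)
      rw [norm_mul, hpow, one_mul, norm_pow, norm_mul]
      have h3 := mul_le_mul (hM z) (hb z hz r k0 k1).2 (norm_nonneg _) hM0
      have h4 := pow_le_pow_left₀ (by positivity) h3 2
      nlinarith [mul_nonneg (sq_nonneg (M * C)) (sq_nonneg (1 - ‖nabla s (-d) (-D) z‖))]
    · exact ((integrable_const _).add hint).const_mul _
    · filter_upwards [hae] with z hz
      exact (((tendsto_nabla_rad (-d) (-D) hz).const_mul _).pow 2).const_mul _
  refine tendsto_nhds_unique hlim (tendsto_const_nhds.congr' ?_)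
  filter_upwards [eventually_rad] with r ⟨k0, k1⟩
  rw [integral_zpow_mul_nabla_eq_zero hs d D (-d) (-D) hρ0 hρ1 k0 k1 hl]

/-- The polynomial `∑_{k < n} c_k z^k` on the circle. -/
def partialSymb (c : ℕ → ℝ) (n : ℕ) (z : Circle) : ℂ := ∑ k ∈ Finset.range n, (c k : ℂ) * (z : ℂ) ^ k

lemma continuous_partialSymb (c : ℕ → ℝ) (n : ℕ) : Continuous (partialSymb c n) := by
  unfold partialSymb; fun_prop

/-- On the circle the product of the conjugated head and the tail contains only powers `z^(k-j)`
with `j < n ≤ k`, each orthogonal to the analytic function `q`. -/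
lemma integral_conj_partialSymb_mul (hs : 0 < s) (h1 : |d + D| < 1 / 2) (h2 : |D| < 1 / 2)
    {ρ : ℝ} (hρ0 : 0 ≤ ρ) (hρ1 : ρ < 1) (c : ℕ → ℝ) {n m : ℕ} (hnm : n ≤ m) {q : Circle → ℂ}
    (hq : ∀ z : Circle, q z = (nabla s d D (ρ * z) * nabla s (-d) (-D) z) ^ 2)
    (hqi : Integrable q arcLength) :
    ∫ z, (starRingEnd ℂ) (partialSymb c n z) * (partialSymb c m z - partialSymb c n z) * q z
      ∂arcLength = 0 := by
  have e : ∀ z : Circle, (starRingEnd ℂ) (partialSymb c n z) *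
      (partialSymb c m z - partialSymb c n z) * q z = ∑ j ∈ Finset.range n,
        ∑ k ∈ Finset.Ico n m, ((c j : ℂ) * c k) * ((z : ℂ) ^ (k - j) * q z) := by
    intro z
    have e1 : partialSymb c m z - partialSymb c n z =
        ∑ k ∈ Finset.Ico n m, (c k : ℂ) * (z : ℂ) ^ k := by
      rw [partialSymb, partialSymb, Finset.sum_Ico_eq_sub _ hnm]
    rw [e1, partialSymb, map_sum, Finset.sum_mul_sum, Finset.sum_mul]
    refine Finset.sum_congr rfl fun j hj => ?_
    rw [Finset.sum_mul]
    refine Finset.sum_congr rfl fun k hk => ?_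
    have hjk : j ≤ k := (Finset.mem_range.mp hj).le.trans (Finset.mem_Ico.mp hk).1
    have e2 : (starRingEnd ℂ) ((z : ℂ) ^ j) * (z : ℂ) ^ k = (z : ℂ) ^ (k - j) := by
      have h3 := conj_coe_zpow z j
      rw [zpow_natCast] at h3
      rw [h3, ← zpow_natCast, ← zpow_natCast, ← zpow_add₀ z.coe_ne_zero]
      congr 1; omega
    rw [map_mul, Complex.conj_ofReal, ← e2]; ring
  simp_rw [e]
  have hi : ∀ l : ℕ, Integrable (fun z : Circle => (z : ℂ) ^ l * q z) arcLength := fun l => by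
    simpa using integrable_zpow_mul (l : ℤ) hqi
  rw [integral_finsetSum _ fun j _ => integrable_finsetSum _ fun k _ => (hi _).const_mul _]
  refine Finset.sum_eq_zero fun j hj => ?_
  rw [integral_finsetSum _ fun k _ => (hi _).const_mul _]
  refine Finset.sum_eq_zero fun k hk => ?_
  have hjk : 0 < k - j := by
    have := Finset.mem_range.mp hj
    have := (Finset.mem_Ico.mp hk).1
    omega
  rw [integral_const_mul]
  simp_rw [hq]
  rw [integral_pow_mul_nabla_sq_eq_zero hs h1 h2 hρ0 hρ1 hjk, mul_zero]

/-- With `p` the truncation of `f`, `w` the weight and `q` analytic, `|q| ≤ M² w` and `κ w ≤ Re q`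
almost everywhere. As `p̄ (f - p)` integrates to zero against `q`, one gets `κ ∫ |p|² w ≤ Re ∫ |p|²
q = Re ∫ p̄ f q ≤ M² ∫ |p| |f| w`. -/
lemma exists_partialSymb_bound (hs : 0 < s) (h1 : |d + D| < 1 / 2) (h2 : |D| < 1 / 2) :
    ∃ K > 0, ∀ (c : ℕ → ℝ) (n m : ℕ), n ≤ m →
      ∫ z, ‖partialSymb c n z‖ ^ 2 * ‖nabla s (-d) (-D) z‖ ^ 2 ∂arcLength ≤
        K * ∫ z, ‖partialSymb c m z‖ ^ 2 * ‖nabla s (-d) (-D) z‖ ^ 2 ∂arcLength := by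
  obtain ⟨ρ, κ, hρ0, hρ1, hκ, hacc⟩ := exists_accretive hs h1 h2
  have hint := integrable_nabla_inv_sq hs h1 h2
  have hae : ∀ᵐ z ∂arcLength, z ∉ unitRoots s :=
    measure_eq_zero_iff_ae_notMem.mp (arcLength_unitRoots hs)
  have hρc := continuous_nabla_rad hs d D hρ0 hρ1
  have hmeas := measurable_nabla s (-d) (-D)
  set M := ∑' j, |radSeq s d D ρ j|
  have hM : ∀ z : Circle, ‖nabla s d D (ρ * z)‖ ≤ M := fun z => by
    rw [← symb_radSeq hs d D hρ0 hρ1]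
    exact norm_symb_le (summable_radSeq hs d D hρ0 hρ1) z
  have hMpos : 0 < M := (norm_pos_iff.mpr (nabla_rad_ne_zero hs d D hρ0 hρ1 1)).trans_le (hM 1)
  set w : Circle → ℝ := fun z => ‖nabla s (-d) (-D) z‖ ^ 2
  set q : Circle → ℂ := fun z => (nabla s d D (ρ * z) * nabla s (-d) (-D) z) ^ 2 with hq
  have hqle : ∀ z, ‖q z‖ ≤ M ^ 2 * w z := fun z => by
    simp only [hq, norm_pow, norm_mul, mul_pow, w]
    have := hM z
    gcongr
  have hqi : Integrable q arcLength := by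
    refine (hint.const_mul (M ^ 2)).mono ?_ (Eventually.of_forall fun z => ?_)
    · exact ((hρc.measurable.mul hmeas).pow_const 2).aestronglyMeasurable
    · exact (hqle z).trans (le_abs_self _)
  have hwi : ∀ g : Circle → ℝ, Continuous g → Integrable (fun z => g z * w z) arcLength :=
    fun g hg => by
      obtain ⟨B, hB⟩ := (isCompact_univ.image_of_continuousOn hg.continuousOn).isBounded.exists_norm_le
      exact hint.bdd_mul hg.aestronglyMeasurable
        (Eventually.of_forall fun z => hB _ ⟨z, Set.mem_univ _, rfl⟩)
  have hqi' : ∀ g : Circle → ℂ, Continuous g → Integrable (fun z => g z * q z) arcLength :=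
    fun g hg => by
      obtain ⟨B, hB⟩ := (isCompact_univ.image_of_continuousOn hg.continuousOn).isBounded.exists_norm_le
      exact hqi.bdd_mul hg.aestronglyMeasurable
        (Eventually.of_forall fun z => hB _ ⟨z, Set.mem_univ _, rfl⟩)
  refine ⟨M ^ 4 / κ ^ 2, by positivity, fun c n m hnm => ?_⟩
  have cp := continuous_partialSymb c n
  have cf := continuous_partialSymb c m
  set p := partialSymb c n
  set f := partialSymb c m
  have cconj : Continuous fun z => (starRingEnd ℂ) (p z) := Complex.continuous_conj.comp cp
  have hpf : Integrable (fun z => (starRingEnd ℂ) (p z) * f z * q z) arcLength :=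
    hqi' _ (cconj.mul cf)
  have hpp : Integrable (fun z => ((‖p z‖ ^ 2 : ℝ) : ℂ) * q z) arcLength :=
    hqi' (fun z => ((‖p z‖ ^ 2 : ℝ) : ℂ)) (Complex.continuous_ofReal.comp (cp.norm.pow 2))
  have hpw : Integrable (fun z => ‖p z‖ ^ 2 * w z) arcLength :=
    hwi (fun z => ‖p z‖ ^ 2) (cp.norm.pow 2)
  have hfw : Integrable (fun z => ‖f z‖ ^ 2 * w z) arcLength :=
    hwi (fun z => ‖f z‖ ^ 2) (cf.norm.pow 2)
  have hz := integral_conj_partialSymb_mul hs h1 h2 hρ0 hρ1 c hnm (fun _ => rfl) hqi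
  have hsplit : ∫ z, (starRingEnd ℂ) (p z) * f z * q z ∂arcLength =
      ∫ z, ((‖p z‖ ^ 2 : ℝ) : ℂ) * q z ∂arcLength := by
    have e1 : ∀ z, (starRingEnd ℂ) (p z) * (f z - p z) * q z =
        (starRingEnd ℂ) (p z) * f z * q z - ((‖p z‖ ^ 2 : ℝ) : ℂ) * q z := fun z => by
      push_cast; rw [← Complex.conj_mul']; ring
    have hz' : ∫ z, (starRingEnd ℂ) (p z) * (f z - p z) * q z ∂arcLength = 0 := hz
    simp_rw [e1] at hz'
    rw [integral_sub hpf hpp] at hz'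
    exact sub_eq_zero.mp hz'
  have hlow : κ * ∫ z, ‖p z‖ ^ 2 * w z ∂arcLength ≤
      (∫ z, ((‖p z‖ ^ 2 : ℝ) : ℂ) * q z ∂arcLength).re := by
    have e1 : (∫ z, ((‖p z‖ ^ 2 : ℝ) : ℂ) * q z ∂arcLength).re =
        ∫ z, ‖p z‖ ^ 2 * (q z).re ∂arcLength := by
      have := integral_re (𝕜 := ℂ) hpp
      simp only [RCLike.re_eq_complex_re] at this
      rw [← this]
      congr 1; ext z
      rw [Complex.re_ofReal_mul]
    rw [e1, ← integral_const_mul]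
    refine integral_mono_ae (hpw.const_mul _) ?_ ?_
    · have := hpp.re
      refine this.congr (Eventually.of_forall fun z => ?_)
      simp only [RCLike.re_eq_complex_re, Complex.re_ofReal_mul]
    · filter_upwards [hae] with z hzR
      have := mul_le_mul_of_nonneg_left (hacc z hzR) (sq_nonneg ‖p z‖)
      calc κ * (‖p z‖ ^ 2 * w z) = ‖p z‖ ^ 2 * (κ * w z) := by ring
        _ ≤ _ := this
  have hup : (∫ z, (starRingEnd ℂ) (p z) * f z * q z ∂arcLength).re ≤
      κ / 2 * ∫ z, ‖p z‖ ^ 2 * w z ∂arcLength +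
        M ^ 4 / (2 * κ) * ∫ z, ‖f z‖ ^ 2 * w z ∂arcLength := by
    refine (Complex.re_le_norm _).trans ((norm_integral_le_integral_norm _).trans ?_)
    rw [← integral_const_mul, ← integral_const_mul, ← integral_add
      (hpw.const_mul _) (hfw.const_mul _)]
    refine integral_mono hpf.norm
      ((hpw.const_mul _).add (hfw.const_mul _)) fun z => ?_
    simp only [norm_mul, RCLike.norm_conj]
    have hw0 : 0 ≤ w z := sq_nonneg _
    -- Weighted so that half of the left side `κ ∫ |p|² w` absorbs the first term; this produces the
    -- constant `M ^ 4 / κ ^ 2`.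
    have e2 : ‖p z‖ * ‖f z‖ * M ^ 2 ≤ κ / 2 * ‖p z‖ ^ 2 + M ^ 4 / (2 * κ) * ‖f z‖ ^ 2 := by
      have e3 : κ / 2 * ‖p z‖ ^ 2 + M ^ 4 / (2 * κ) * ‖f z‖ ^ 2 - ‖p z‖ * ‖f z‖ * M ^ 2 =
          (κ * ‖p z‖ - M ^ 2 * ‖f z‖) ^ 2 / (2 * κ) := by field_simp; ring
      have : 0 ≤ (κ * ‖p z‖ - M ^ 2 * ‖f z‖) ^ 2 / (2 * κ) := by positivity
      linarith
    calc ‖p z‖ * ‖f z‖ * ‖q z‖ ≤ ‖p z‖ * ‖f z‖ * (M ^ 2 * w z) := by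
          gcongr; exact hqle z
      _ = (‖p z‖ * ‖f z‖ * M ^ 2) * w z := by ring
      _ ≤ (κ / 2 * ‖p z‖ ^ 2 + M ^ 4 / (2 * κ) * ‖f z‖ ^ 2) * w z :=
          mul_le_mul_of_nonneg_right e2 hw0
      _ = _ := by ring
  rw [hsplit] at hup
  have hfin := hlow.trans hup
  have e4 : M ^ 4 / κ ^ 2 * ∫ z, ‖f z‖ ^ 2 * w z ∂arcLength =
      (2 / κ) * (M ^ 4 / (2 * κ) * ∫ z, ‖f z‖ ^ 2 * w z ∂arcLength) := by field_simp
  rw [e4]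
  set P := ∫ z, ‖p z‖ ^ 2 * w z ∂arcLength
  set Q := M ^ 4 / (2 * κ) * ∫ z, ‖f z‖ ^ 2 * w z ∂arcLength
  have : κ * P ≤ 2 * Q := by linarith
  rw [div_mul_eq_mul_div, le_div_iff₀ hκ]
  linarith

end Projection

/-! ### A Tauberian theorem -/

section Tauber

variable {H : Type*} [NormedAddCommGroup H] [InnerProductSpace ℝ H]

/-- If partial sums are uniformly bounded as operators, Abel summability implies convergence. -/
lemma tendsto_of_abel_of_bound {w : ℕ → H} {a : ℕ → ℝ} {e : H} {K : ℝ} (hK : 0 ≤ K)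
    (hb : ∀ (c : ℕ → ℝ) (n m : ℕ), n ≤ m → ‖∑ k ∈ Finset.range n, c k • w k‖ ≤
      K * ‖∑ k ∈ Finset.range m, c k • w k‖)
    (hsum : ∀ r : ℝ, 0 ≤ r → r < 1 → Summable fun k => (a k * r ^ k) • w k)
    (h : Tendsto (fun r : ℝ => ∑' k, (a k * r ^ k) • w k) (𝓝[<] 1) (𝓝 e)) :
    Tendsto (fun n => ∑ k ∈ Finset.range n, a k • w k) atTop (𝓝 e) := by
  rw [Metric.tendsto_atTop]
  intro δ hδ
  set η := δ / (2 * (K + 1)) with hη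
  have hηpos : 0 < η := by positivity
  obtain ⟨ρ, hρ, hρ0, hρ1⟩ : ∃ ρ : ℝ, dist (∑' k, (a k * ρ ^ k) • w k) e < η / 2 ∧ 0 ≤ ρ ∧ ρ < 1 :=
    ((h.eventually (Metric.ball_mem_nhds e (half_pos hηpos))).and eventually_rad).exists
  have hs := (hsum ρ hρ0 hρ1).hasSum.tendsto_sum_nat
  obtain ⟨N, hN⟩ := (Metric.tendsto_atTop.mp hs) (η / 2) (half_pos hηpos)
  -- A finite combination `Q` close to `e`, unaffected by truncation at any `n ≥ N`.
  set q : ℕ → ℝ := fun k => if k < N then a k * ρ ^ k else 0 with hq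
  set Q := ∑ k ∈ Finset.range N, (a k * ρ ^ k) • w k with hQ
  have hqQ : ∀ n, N ≤ n → ∑ k ∈ Finset.range n, q k • w k = Q := by
    intro n hn
    rw [hQ, ← Finset.sum_subset (Finset.range_mono hn)]
    · exact Finset.sum_congr rfl fun k hk => by simp [hq, Finset.mem_range.mp hk]
    · intro k _ hk
      rw [Finset.mem_range] at hk
      simp [hq, hk]
  have hQe : ‖e - Q‖ < η := by
    have := hN N le_rfl
    rw [← dist_eq_norm, dist_comm]
    linarith [dist_triangle Q (∑' k, (a k * ρ ^ k) • w k) e]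
  refine ⟨N, fun n hn => ?_⟩
  -- The hypothesis `hb` for the coefficients `a k * r ^ k - q k`, then `m → ∞`, then `r → 1`.
  have key : ‖∑ k ∈ Finset.range n, a k • w k - Q‖ ≤ K * ‖e - Q‖ := by
    have hlim : Tendsto (fun r : ℝ => ‖∑ k ∈ Finset.range n, (a k * r ^ k) • w k - Q‖) (𝓝[<] 1)
        (𝓝 ‖∑ k ∈ Finset.range n, a k • w k - Q‖) := by
      have : Continuous fun r : ℝ => ‖∑ k ∈ Finset.range n, (a k * r ^ k) • w k - Q‖ := by
        fun_prop
      have h6 := (this.tendsto 1).mono_left (nhdsWithin_le_nhds (s := Set.Iio 1))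
      simpa using h6
    refine le_of_tendsto_of_tendsto hlim (((h.sub_const Q).norm).const_mul K) ?_
    filter_upwards [eventually_rad] with r ⟨k0, k1⟩
    have h7 := (((hsum r k0 k1).hasSum.tendsto_sum_nat.sub_const Q).norm).const_mul K
    refine ge_of_tendsto h7 ?_
    filter_upwards [eventually_ge_atTop n] with m hm
    have h8 := hb (fun k => a k * r ^ k - q k) n m hm
    simp only [sub_smul, Finset.sum_sub_distrib] at h8
    rwa [hqQ n hn, hqQ m (hn.trans hm)] at h8
  have h9 : ∑ k ∈ Finset.range n, a k • w k - e =
      (∑ k ∈ Finset.range n, a k • w k - Q) - (e - Q) := by abel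
  rw [dist_eq_norm, h9]
  calc _ ≤ ‖∑ k ∈ Finset.range n, a k • w k - Q‖ + ‖e - Q‖ := norm_sub_le _ _
    _ ≤ K * ‖e - Q‖ + ‖e - Q‖ := by linarith
    _ = (K + 1) * ‖e - Q‖ := by ring
    _ ≤ (K + 1) * η := by gcongr
    _ = δ / 2 := by rw [hη]; field_simp
    _ < δ := by linarith

end Tauber

/-! ### Fractional noise -/

section FractionalNoise

variable {H : Type*} [NormedAddCommGroup H] [InnerProductSpace ℝ H] [CompleteSpace H]
  {ε W : ℤ → H} {σ2 : ℝ} {s : ℕ} {d D : ℝ}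

/-- `W = ∇^{(-d,-D)} ε`. -/
def IsFracNoise (s : ℕ) (d D : ℝ) (ε W : ℤ → H) : Prop :=
  ∀ t, Tendsto (fun n => ∑ k ∈ Finset.range n, nablaCoeff s (-d) (-D) k • ε (t - k)) atTop (𝓝 (W t))

lemma exists_isFracNoise (h : OrthoNoise ε σ2) (h0 : 0 < σ2) (hs : 0 < s)
    (h1 : |d + D| < 1 / 2) (h2 : |D| < 1 / 2) : ∃ W : ℤ → H, IsFracNoise s d D ε W := by
  have h1' := abs_lt.mp h1
  have h2' := abs_lt.mp h2
  have hsq := h.summable_nablaCoeff_sq (d := -d) (D := -D) h0 hs (by linarith) (by linarith)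
  refine ⟨fun t => ∑' k : ℕ, nablaCoeff s (-d) (-D) k • ε (t - k), fun t => ?_⟩
  exact (h.summable_smul h0 hsq (τ := fun k : ℕ => t - k)
    (fun a b hab => by simpa using hab)).hasSum.tendsto_sum_nat

lemma IsFracNoise.abelFilt (hW : IsFracNoise s d D ε W) : AbelFilt s (-d) (-D) ε W :=
  abelFilt_of_tendsto hW

/-- The spectral measure of fractional noise. -/
def fracMeasure (s : ℕ) (d D σ2 : ℝ) : Measure Circle :=
  (noiseMeasure σ2).withDensity fun z => ENNReal.ofReal (‖nabla s (-d) (-D) z‖ ^ 2)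

lemma IsFracNoise.hasSpec (hW : IsFracNoise s d D ε W) (h : OrthoNoise ε σ2) (h0 : 0 ≤ σ2)
    (hs : 0 < s) : HasSpec W (fracMeasure s d D σ2) :=
  hW.abelFilt.hasSpec hs (h.hasSpec h0) (noiseMeasure_unitRoots hs)

lemma isFiniteMeasure_fracMeasure (hs : 0 < s) (h1 : |d + D| < 1 / 2) (h2 : |D| < 1 / 2) :
    IsFiniteMeasure (fracMeasure s d D σ2) := by
  refine isFiniteMeasure_withDensity_ofReal ?_
  exact ((integrable_nabla_inv_sq hs h1 h2).smul_measure ENNReal.ofReal_ne_top).hasFiniteIntegral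

lemma fracMeasure_unitRoots (hs : 0 < s) : fracMeasure s d D σ2 (unitRoots s) = 0 :=
  withDensity_absolutelyContinuous _ _ (noiseMeasure_unitRoots hs)

lemma IsFracNoise.bddSeq (hW : IsFracNoise s d D ε W) (h : OrthoNoise ε σ2) (h0 : 0 ≤ σ2)
    (hs : 0 < s) : BddSeq W := (hW.hasSpec h h0 hs).bddSeq

/-- Transfers norms of partial sums to the weighted integrals of `exists_partialSymb_bound`. -/
lemma IsFracNoise.norm_sum_sq (hW : IsFracNoise s d D ε W) (h : OrthoNoise ε σ2) (h0 : 0 ≤ σ2)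
    (hs : 0 < s) (h1 : |d + D| < 1 / 2) (h2 : |D| < 1 / 2) (c : ℕ → ℝ) (n : ℕ) (t : ℤ) :
    ‖∑ k ∈ Finset.range n, c k • W (t - k)‖ ^ 2 = σ2 / (2 * Real.pi) *
      ∫ z, ‖partialSymb c n z‖ ^ 2 * ‖nabla s (-d) (-D) z‖ ^ 2 ∂arcLength := by
  have := isFiniteMeasure_fracMeasure (σ2 := σ2) hs h1 h2
  rw [← filt_trunc, (hW.hasSpec h h0 hs).norm_filt_sq (summable_extNat.mpr (summable_trunc _ _))]
  simp_rw [symb_trunc]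
  have hm : Measurable fun z : Circle => ‖nabla s (-d) (-D) z‖ ^ 2 :=
    (measurable_nabla s (-d) (-D)).norm.pow_const 2
  rw [fracMeasure, integral_withDensity_eq_integral_toReal_smul (by fun_prop)
    (Eventually.of_forall fun _ => ENNReal.ofReal_lt_top), integral_noiseMeasure h0, smul_eq_mul]
  congr 2; ext z
  rw [ENNReal.toReal_ofReal (sq_nonneg _), smul_eq_mul, mul_comm, partialSymb]

/-- The partial sums of `∇^{(d,D)} W` converge to `ε`. -/
theorem IsFracNoise.tendsto (hW : IsFracNoise s d D ε W) (h : OrthoNoise ε σ2) (h0 : 0 ≤ σ2)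
    (hs : 0 < s) (h1 : |d + D| < 1 / 2) (h2 : |D| < 1 / 2) (t : ℤ) :
    Tendsto (fun n => ∑ k ∈ Finset.range n, nablaCoeff s d D k • W (t - k)) atTop (𝓝 (ε t)) := by
  obtain ⟨K, hK, hb⟩ := exists_partialSymb_bound hs h1 h2
  -- Inversion gives only Abel summability to `ε`; the uniform bound on truncations upgrades it to
  -- convergence.
  have hinv := hW.abelFilt.inv hs (h.hasSpec h0) (noiseMeasure_unitRoots hs)
  rw [neg_neg, neg_neg] at hinv
  refine tendsto_of_abel_of_bound (K := √K) (Real.sqrt_nonneg K) ?_ ?_ ?_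
  · intro c n m hnm
    have hpi := Real.pi_pos
    have e : ‖∑ k ∈ Finset.range n, c k • W (t - k)‖ ^ 2 ≤
        (√K * ‖∑ k ∈ Finset.range m, c k • W (t - k)‖) ^ 2 := by
      rw [mul_pow, Real.sq_sqrt hK.le, hW.norm_sum_sq h h0 hs h1 h2,
        hW.norm_sum_sq h h0 hs h1 h2, mul_left_comm]
      exact mul_le_mul_of_nonneg_left (hb c n m hnm) (by positivity)
    exact (sq_le_sq₀ (norm_nonneg _) (by positivity)).mp e
  · intro r k0 k1
    have h5 := (summable_filt (summable_radSeq hs d D k0 k1) (hW.bddSeq h h0 hs) t).comp_injective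
      (i := ((↑) : ℕ → ℤ)) Nat.cast_injective
    simpa [Function.comp_def, radSeq, radCoeff] using h5
  · refine (hinv t).congr fun r => ?_
    rw [radSeq, filt_extNat]
    rfl

end FractionalNoise

/-! ### Laurent expansions of rational functions -/

/-- `F` has a Laurent expansion in an annulus around the unit circle. -/
def HasLaurent (F : ℂ → ℂ) : Prop :=
  ∃ (ψ : ℤ → ℂ) (r R : ℝ), 0 ≤ r ∧ r < 1 ∧ 1 < R ∧
    ∀ z : ℂ, r < ‖z‖ → ‖z‖ < R → HasSum (fun j : ℤ => ψ j * z ^ j) (F z)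

lemma hasSum_laurent_mul {ψ χ : ℤ → ℂ} {z A B : ℂ} (hz : z ≠ 0)
    (hA : HasSum (fun j : ℤ => ψ j * z ^ j) A) (hB : HasSum (fun j : ℤ => χ j * z ^ j) B) :
    HasSum (fun m : ℤ => (∑' i, ψ (m - i) * χ i) * z ^ m) (A * B) := by
  set f : ℤ → ℂ := fun j => ψ j * z ^ j with hf
  set g : ℤ → ℂ := fun j => χ j * z ^ j with hg
  have hs : Summable fun p : ℤ × ℤ => f p.1 * g p.2 :=
    summable_mul_of_summable_norm hA.summable.norm hB.summable.norm
  have h1 : HasSum (fun p : ℤ × ℤ => f p.1 * g p.2) (A * B) := HasSum.mul hA hB hs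
  have h2 := shearEquiv.hasSum_iff.mpr h1
  refine h2.prod_fiberwise fun m => ?_
  have h3 := (h2.summable.prod_factor m).hasSum
  have h4 : (∑' i, ψ (m - i) * χ i) * z ^ m =
      ∑' i, ((fun p : ℤ × ℤ => f p.1 * g p.2) ∘ shearEquiv) (m, i) := by
    rw [← tsum_mul_right]
    congr 1; ext i
    have : z ^ m = z ^ (m - i) * z ^ i := by
      rw [← zpow_add₀ hz]; congr 1; ring
    simp only [Function.comp, shearEquiv, Equiv.coe_fn_mk, hf, hg]
    rw [this]; ring
  rw [h4]
  exact h3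

lemma HasLaurent.mul {F G : ℂ → ℂ} (hF : HasLaurent F) (hG : HasLaurent G) :
    HasLaurent fun z => F z * G z := by
  obtain ⟨ψ, r, R, h0, h1, h2, hψ⟩ := hF
  obtain ⟨χ, r', R', h0', h1', h2', hχ⟩ := hG
  refine ⟨fun m => ∑' i, ψ (m - i) * χ i, max r r', min R R', h0.trans (le_max_left _ _), max_lt h1 h1', lt_min h2 h2',
    fun z hz1 hz2 => ?_⟩
  have hz : z ≠ 0 := by
    rw [← norm_pos_iff]
    exact (h0.trans (le_max_left _ _)).trans_lt hz1
  exact hasSum_laurent_mul hz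
    (hψ z ((le_max_left _ _).trans_lt hz1) (hz2.trans_le (min_le_left _ _)))
    (hχ z ((le_max_right _ _).trans_lt hz1) (hz2.trans_le (min_le_right _ _)))

lemma hasSum_int_of_nat {f : ℤ → ℂ} {a : ℂ} {g : ℕ → ℤ} (hg : Function.Injective g)
    (hf : ∀ j, j ∉ Set.range g → f j = 0) (h : HasSum (fun n => f (g n)) a) : HasSum f a :=
  (hg.hasSum_iff hf).mp h

lemma hasLaurent_polynomial (p : ℂ[X]) : HasLaurent fun z => p.eval z := by
  refine ⟨fun j => if 0 ≤ j then p.coeff j.toNat else 0, 0, 2, le_rfl, one_pos, one_lt_two,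
    fun z _ _ => ?_⟩
  refine hasSum_int_of_nat (g := ((↑) : ℕ → ℤ)) Nat.cast_injective (fun j hj => ?_) ?_
  · beta_reduce
    rw [if_neg, zero_mul]
    intro h
    exact hj ⟨j.toNat, by omega⟩
  · beta_reduce
    rw [eval_eq_sum_range]
    have : (fun n : ℕ => (if 0 ≤ (n : ℤ) then p.coeff (n : ℤ).toNat else 0) * z ^ (n : ℤ)) =
        fun n => p.coeff n * z ^ n := by ext n; simp
    rw [this]
    exact hasSum_sum_of_ne_finset_zero fun k hk => by
      rw [Finset.mem_range, not_lt] at hk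
      rw [coeff_eq_zero_of_natDegree_lt (by omega), zero_mul]

/-- A pole inside the disc is expanded in negative powers, a pole outside in nonnegative powers,
each by a geometric series. -/
lemma hasLaurent_inv_sub {w : ℂ} (hw : ‖w‖ ≠ 1) : HasLaurent fun z => (z - w)⁻¹ := by
  rcases lt_or_gt_of_ne hw with h | h
  · refine ⟨fun j => if j < 0 then w ^ (-j - 1).toNat else 0, ‖w‖, 2, norm_nonneg _, h, one_lt_two,
      fun z hz _ => ?_⟩
    have hz0 : z ≠ 0 := norm_pos_iff.mp ((norm_nonneg _).trans_lt hz)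
    refine hasSum_int_of_nat (g := fun n : ℕ => -(n : ℤ) - 1)
      (fun a b hab => by simpa using hab) (fun j hj => ?_) ?_
    · beta_reduce
      rw [if_neg, zero_mul]
      intro h
      exact hj ⟨(-j - 1).toNat, by simp only; omega⟩
    · have h1 : ‖w / z‖ < 1 := by
        rw [norm_div, div_lt_one (norm_pos_iff.mpr hz0)]; exact hz
      have h2 := (hasSum_geometric_of_norm_lt_one h1).mul_left z⁻¹
      have h3 : z⁻¹ * (1 - w / z)⁻¹ = (z - w)⁻¹ := by
        rw [← mul_inv]; congr 1; field_simp
      rw [h3] at h2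
      refine (congrArg (HasSum · ((z - w)⁻¹)) (funext fun n => ?_)).mp h2
      have e1 : (-(-(n : ℤ) - 1) - 1).toNat = n := by omega
      have e2 : -(n : ℤ) - 1 = -((n + 1 : ℕ) : ℤ) := by push_cast; ring
      simp only
      rw [if_pos (by omega), e1, e2, zpow_neg, zpow_natCast, div_pow, pow_succ]
      field_simp
  · refine ⟨fun j => if 0 ≤ j then -(w⁻¹) ^ (j.toNat + 1) else 0, 0, ‖w‖, le_rfl, one_pos, h,
      fun z _ hz => ?_⟩
    have hw0 : w ≠ 0 := norm_pos_iff.mp ((norm_nonneg _).trans_lt hz)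
    refine hasSum_int_of_nat (g := ((↑) : ℕ → ℤ)) Nat.cast_injective (fun j hj => ?_) ?_
    · beta_reduce
      rw [if_neg, zero_mul]
      intro h
      exact hj ⟨j.toNat, by omega⟩
    · have h1 : ‖z / w‖ < 1 := by
        rw [norm_div, div_lt_one (norm_pos_iff.mpr hw0)]; exact hz
      have h2 := (hasSum_geometric_of_norm_lt_one h1).mul_left (-w⁻¹)
      have h3 : -w⁻¹ * (1 - z / w)⁻¹ = (z - w)⁻¹ := by
        have : z - w = -(w * (1 - z / w)) := by field_simp; ring
        rw [this, inv_neg, mul_inv, neg_mul]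
      rw [h3] at h2
      refine (congrArg (HasSum · ((z - w)⁻¹)) (funext fun n => ?_)).mp h2
      simp only
      rw [if_pos (by omega), Int.toNat_natCast, zpow_natCast, div_pow, pow_succ, inv_pow]
      field_simp

lemma hasLaurent_inv_prod (m : Multiset ℂ) (h : ∀ w ∈ m, ‖w‖ ≠ 1) :
    HasLaurent fun z => ((m.map fun w => z - w).prod)⁻¹ := by
  induction m using Multiset.induction_on with
  | empty => simpa using hasLaurent_polynomial 1
  | cons w m ih =>
    simp only [Multiset.map_cons, Multiset.prod_cons, mul_inv]
    exact (hasLaurent_inv_sub (h w (Multiset.mem_cons_self w m))).mul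
      (ih fun w' hw' => h w' (Multiset.mem_cons_of_mem hw'))

lemma hasLaurent_div {p q : ℂ[X]} (hq : ∀ z : ℂ, ‖z‖ = 1 → q.eval z ≠ 0) :
    HasLaurent fun z => p.eval z / q.eval z := by
  have hq0 : q ≠ 0 := by
    rintro rfl
    exact hq 1 norm_one (by simp)
  have h1 := hasLaurent_inv_prod q.roots fun w hw hw1 => hq w hw1 (isRoot_of_mem_roots hw)
  have h2 := ((hasLaurent_polynomial p).mul h1).mul (hasLaurent_polynomial (C q.leadingCoeff⁻¹))
  convert h2 using 2 with z
  have h3 : q.eval z = q.leadingCoeff * (q.roots.map fun w => z - w).prod := by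
    conv_lhs => rw [(IsAlgClosed.splits q).eq_prod_roots]
    rw [eval_mul, eval_C, eval_multiset_prod, Multiset.map_map]
    simp
  rw [h3, eval_C, div_eq_mul_inv, mul_inv]
  ring

/-- Averaging the expansion with its conjugate shows that the coefficients of a function real on the
real axis may be taken real. -/
lemma hasSum_re {ψ : ℤ → ℂ} {z A : ℂ} (h1 : HasSum (fun j : ℤ => ψ j * z ^ j) A)
    (h2 : HasSum (fun j : ℤ => ψ j * (starRingEnd ℂ z) ^ j) (starRingEnd ℂ A)) :
    HasSum (fun j : ℤ => ((ψ j).re : ℂ) * z ^ j) A := by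
  have h3 := (Complex.hasSum_conj'.mpr h2)
  rw [Complex.conj_conj] at h3
  have h4 := (h1.add h3).div_const 2
  rw [add_self_div_two] at h4
  refine (congrArg (HasSum · A) (funext fun j => ?_)).mp h4
  rw [map_mul, map_zpow₀, Complex.conj_conj, ← add_mul, Complex.add_conj]
  push_cast
  ring

/-- A rational function without poles on the unit circle has a Laurent expansion. -/
theorem exists_isLaurentExpansion (p q : ℝ[X]) (hq : ∀ z : ℂ, ‖z‖ = 1 → aeval z q ≠ 0) :
    ∃ ψ : ℤ → ℝ, IsLaurentExpansion ψ (fun z => aeval z p / aeval z q) := by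
  have e : ∀ (p : ℝ[X]) (z : ℂ), (p.map (algebraMap ℝ ℂ)).eval z = aeval z p := fun p z => by
    rw [eval_map_algebraMap]
  obtain ⟨ψ, r, R, h0, h1, h2, hψ⟩ := hasLaurent_div (p := p.map (algebraMap ℝ ℂ))
    (q := q.map (algebraMap ℝ ℂ)) (fun z hz => by rw [e]; exact hq z hz)
  simp only [e] at hψ
  refine ⟨fun j => (ψ j).re, r, R, h0, h1, h2, fun z hz1 hz2 => ?_⟩
  refine hasSum_re (hψ z hz1 hz2) ?_
  have := hψ (starRingEnd ℂ z) (by rwa [RCLike.norm_conj]) (by rwa [RCLike.norm_conj])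
  rwa [aeval_conj, aeval_conj, ← map_div₀] at this

lemma IsLaurentExpansion.summable {ψ : ℤ → ℝ} {F : ℂ → ℂ} (h : IsLaurentExpansion ψ F) :
    Summable ψ := by
  obtain ⟨r, R, h0, h1, h2, hψ⟩ := h
  have := (hψ 1 (by simpa using h1) (by simpa using h2)).summable
  simp only [one_zpow, mul_one] at this
  exact Complex.summable_ofReal.mp this

lemma IsLaurentExpansion.symb_eq {ψ : ℤ → ℝ} {F : ℂ → ℂ} (h : IsLaurentExpansion ψ F)
    (z : Circle) : symb ψ z = F z := by
  obtain ⟨r, R, h0, h1, h2, hψ⟩ := h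
  exact (hψ z (by rwa [Circle.norm_coe]) (by rwa [Circle.norm_coe])).tsum_eq

/-- A rational function without poles in the closed unit disc has a power series expansion. -/
theorem exists_powerSeries (p q : ℝ[X]) (hq : ∀ z : ℂ, ‖z‖ ≤ 1 → aeval z q ≠ 0) :
    ∃ c : ℕ → ℝ, ∀ z : ℂ, ‖z‖ ≤ 1 →
      HasSum (fun k : ℕ => (c k : ℂ) * z ^ k) (aeval z p / aeval z q) := by
  have hopen : IsOpen {z : ℂ | aeval z q ≠ 0} :=
    isOpen_ne_fun (by fun_prop) continuous_const
  have hsub : Metric.closedBall (0 : ℂ) 1 ⊆ {z : ℂ | aeval z q ≠ 0} := fun z hz =>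
    hq z (by simpa using hz)
  -- By compactness the denominator has no zero on a slightly larger disc, so the Taylor series also
  -- converges on `|z| = 1`.
  obtain ⟨δ, hδ, hδ'⟩ := (isCompact_closedBall (0 : ℂ) 1).exists_thickening_subset_open hopen hsub
  rw [thickening_closedBall hδ zero_le_one] at hδ'
  set F : ℂ → ℂ := fun z => aeval z p / aeval z q with hF
  obtain ⟨R, hR⟩ : ∃ R : NNReal, (R : ℝ) = 1 + δ / 2 :=
    ⟨(1 + δ / 2).toNNReal, Real.coe_toNNReal _ (by positivity)⟩
  have hRpos : 0 < R := by rw [← NNReal.coe_pos, hR]; positivity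
  have hd : DifferentiableOn ℂ F (Metric.closedBall 0 R) := by
    intro z hz
    have hz' : aeval z q ≠ 0 := by
      apply hδ'
      rw [Metric.mem_closedBall, hR] at hz
      rw [Metric.mem_ball]
      linarith
    have hdiff : ∀ p : ℝ[X], DifferentiableAt ℂ (fun z : ℂ => aeval z p) z := fun p =>
      p.differentiable_aeval.differentiableAt
    exact ((hdiff p).div (hdiff q) hz').differentiableWithinAt
  have hps := hd.hasFPowerSeriesOnBall hRpos
  have hsum : ∀ z : ℂ, ‖z‖ ≤ 1 →
      HasSum (fun k : ℕ => (cauchyPowerSeries F 0 R).coeff k * z ^ k) (F z) := by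
    intro z hz
    have h1 := hps.hasSum (y := z) (by
      rw [Metric.eball_coe, Metric.mem_ball, dist_zero_right, hR]
      linarith)
    rw [zero_add] at h1
    refine (congrArg (HasSum · (F z)) (funext fun k => ?_)).mp h1
    rw [FormalMultilinearSeries.apply_eq_pow_smul_coeff, smul_eq_mul, mul_comm]
  refine ⟨fun k => ((cauchyPowerSeries F 0 R).coeff k).re, fun z hz => ?_⟩
  have h1 := hsum z hz
  have h2 := hsum (starRingEnd ℂ z) (by rwa [RCLike.norm_conj])
  have h3 : F (starRingEnd ℂ z) = starRingEnd ℂ (F z) := by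
    simp only [hF]
    rw [aeval_conj, aeval_conj, ← map_div₀]
  rw [h3] at h2
  have h4 := (Complex.hasSum_conj'.mpr h2)
  rw [Complex.conj_conj] at h4
  have h5 := (h1.add h4).div_const 2
  rw [add_self_div_two] at h5
  refine (congrArg (HasSum · (F z)) (funext fun k => ?_)).mp h5
  rw [map_mul, map_pow, Complex.conj_conj, ← add_mul, Complex.add_conj]
  push_cast
  ring

lemma summable_of_hasSum_one {c : ℕ → ℝ} {F : ℂ → ℂ}
    (h : ∀ z : ℂ, ‖z‖ ≤ 1 → HasSum (fun k : ℕ => (c k : ℂ) * z ^ k) (F z)) : Summable c := by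
  have := (h 1 (by simp)).summable
  simp only [one_pow, mul_one] at this
  exact Complex.summable_ofReal.mp this

lemma symb_extNat_of_hasSum {c : ℕ → ℝ} {F : ℂ → ℂ}
    (h : ∀ z : ℂ, ‖z‖ ≤ 1 → HasSum (fun k : ℕ => (c k : ℂ) * z ^ k) (F z)) (z : Circle) :
    symb (extNat c) z = F z := by
  rw [symb_extNat, (h z z.norm_coe.le).tsum_eq]

/-- The Laurent expansion is causal if there are no poles in the closed unit disc. -/
lemma IsLaurentExpansion.eq_zero_of_neg {p q : ℝ[X]} {ψ : ℤ → ℝ}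
    (h : IsLaurentExpansion ψ (fun z => aeval z p / aeval z q))
    (hq : ∀ z : ℂ, ‖z‖ ≤ 1 → aeval z q ≠ 0) {j : ℤ} (hj : j < 0) : ψ j = 0 := by
  obtain ⟨c, hc⟩ := exists_powerSeries p q hq
  have : ψ = extNat c := eq_of_symb_eq h.summable (summable_extNat.mpr (summable_of_hasSum_one hc))
    fun z => by rw [h.symb_eq, symb_extNat_of_hasSum hc]
  rw [this, extNat_of_neg c hj]

/-! ### Ergodicity of the Bernoulli shift -/

section Shift

/-- The shift on real paths by `k` steps. -/
def shift (k : ℤ) (x : ℤ → ℝ) (t : ℤ) : ℝ := x (t + k)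

lemma measurable_shift (k : ℤ) : Measurable (shift k) :=
  measurable_pi_lambda _ fun _ => measurable_pi_apply _

lemma shift_comp (k l : ℤ) : shift k ∘ shift l = shift (k + l) := by
  ext x t
  simp only [Function.comp, shift]
  congr 1; ring

lemma hasSum_measureReal_iUnion {α : Type*} [MeasurableSpace α] {P : Measure α} [IsFiniteMeasure P]
    {A : ℕ → Set α} (hd : Pairwise (Function.onFun Disjoint A)) (hA : ∀ i, MeasurableSet (A i)) :
    HasSum (fun i => P.real (A i)) (P.real (⋃ i, A i)) := by
  have h1 := measure_iUnion (μ := P) hd hA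
  have h2 : ∑' i, P (A i) ≠ ⊤ := h1 ▸ measure_ne_top _ _
  simp only [measureReal_def]
  rw [h1, ENNReal.tsum_toReal_eq fun i => measure_ne_top _ _]
  exact ENNReal.hasSum_toReal h2

variable (ν : Measure ℝ) [IsProbabilityMeasure ν]

/-- The law of an i.i.d. sequence. -/
abbrev bernoulliLaw : Measure (ℤ → ℝ) := Measure.infinitePi fun _ : ℤ => ν

lemma shift_preimage_pi (k : ℤ) (S : Finset ℤ) (t : ℤ → Set ℝ) :
    shift k ⁻¹' (Set.pi S t) = Set.pi (S.map (Equiv.addRight k).toEmbedding)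
      fun i => t (i - k) := by
  ext x
  simp only [Set.mem_preimage, Set.mem_pi, Finset.mem_coe, Finset.mem_map, shift,
    Equiv.toEmbedding_apply, Equiv.coe_addRight]
  constructor
  · rintro h _ ⟨i, hi, rfl⟩
    simpa using h i hi
  · intro h i hi
    simpa using h (i + k) ⟨i, hi, rfl⟩

lemma measurePreserving_shift (k : ℤ) :
    MeasurePreserving (shift k) (bernoulliLaw ν) (bernoulliLaw ν) := by
  refine ⟨measurable_shift k, Measure.eq_infinitePi _ fun S t ht => ?_⟩
  rw [Measure.map_apply (measurable_shift k) (MeasurableSet.pi S.countable_toSet fun i _ => ht i),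
    shift_preimage_pi, Measure.infinitePi_pi _ fun i _ => ht _]
  simp

/-- Finite-dimensional rectangles. -/
def rectangles : Set (Set (ℤ → ℝ)) :=
  {A | ∃ (S : Finset ℤ) (t : ℤ → Set ℝ), (∀ i, MeasurableSet (t i)) ∧ A = Set.pi S t}

lemma isPiSystem_rectangles : IsPiSystem rectangles := by
  classical
  rintro _ ⟨S, t, ht, rfl⟩ _ ⟨S', t', ht', rfl⟩ -
  refine ⟨S ∪ S', fun i => (if i ∈ S then t i else Set.univ) ∩ (if i ∈ S' then t' i else Set.univ),
    fun i => ?_, ?_⟩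
  · refine MeasurableSet.inter ?_ ?_
    · split_ifs
      exacts [ht i, .univ]
    · split_ifs
      exacts [ht' i, .univ]
  · ext x
    simp only [Set.mem_inter_iff, Set.mem_pi, Finset.coe_union, Set.mem_union, Finset.mem_coe]
    constructor
    · rintro ⟨h1, h2⟩ i -
      constructor
      · split_ifs with h
        exacts [h1 i h, trivial]
      · split_ifs with h
        exacts [h2 i h, trivial]
    · intro h
      refine ⟨fun i hi => ?_, fun i hi => ?_⟩
      · have := (h i (Or.inl hi)).1
        rwa [if_pos hi] at this
      · have := (h i (Or.inr hi)).2
        rwa [if_pos hi] at this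

lemma measurableSet_rectangle {A : Set (ℤ → ℝ)} (hA : A ∈ rectangles) : MeasurableSet A := by
  obtain ⟨S, t, ht, rfl⟩ := hA
  exact MeasurableSet.pi S.countable_toSet fun i _ => ht i

lemma generateFrom_rectangles :
    (MeasurableSpace.pi : MeasurableSpace (ℤ → ℝ)) = MeasurableSpace.generateFrom rectangles := by
  classical
  refine le_antisymm (iSup_le fun i => ?_)
    (MeasurableSpace.generateFrom_le fun A hA => measurableSet_rectangle hA)
  rw [MeasurableSpace.comap_le_iff_le_map]
  intro B hB
  refine MeasurableSpace.measurableSet_generateFrom ⟨{i}, fun _ => B, fun _ => hB, ?_⟩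
  ext x
  simp

/-- After a long enough shift the two finite coordinate sets are disjoint, and independence is
exact. -/
lemma rectangles_mixing {A B : Set (ℤ → ℝ)} (hA : A ∈ rectangles) (hB : B ∈ rectangles) :
    ∀ᶠ n : ℕ in atTop, bernoulliLaw ν (A ∩ shift n ⁻¹' B) = bernoulliLaw ν A * bernoulliLaw ν B := by
  classical
  obtain ⟨S, t, ht, rfl⟩ := hA
  obtain ⟨S', t', ht', rfl⟩ := hB
  obtain ⟨a, ha⟩ := S.bddAbove
  obtain ⟨b, hb⟩ := S'.bddBelow
  filter_upwards [eventually_gt_atTop (a - b).toNat] with n hn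
  rw [← (measurePreserving_shift ν n).measure_preimage
    (MeasurableSet.pi S'.countable_toSet fun i _ => ht' i).nullMeasurableSet, shift_preimage_pi]
  set S2 := S'.map (Equiv.addRight (n : ℤ)).toEmbedding with hS2
  have hdisj : Disjoint S S2 := by
    rw [Finset.disjoint_left]
    intro i hi hi'
    rw [hS2, Finset.mem_map] at hi'
    obtain ⟨j, hj, rfl⟩ := hi'
    have h1 := ha hi
    have h2 := hb hj
    simp only [Equiv.toEmbedding_apply, Equiv.coe_addRight] at h1
    omega
  have h1 : Set.pi S t ∩ Set.pi S2 (fun i => t' (i - n)) =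
      Set.pi ((S ∪ S2 : Finset ℤ) : Set ℤ) (fun i => if i ∈ S then t i else t' (i - n)) := by
    ext x
    simp only [Set.mem_inter_iff, Set.mem_pi, Finset.coe_union, Set.mem_union, Finset.mem_coe]
    constructor
    · rintro ⟨h1, h2⟩ i hi
      split_ifs with h
      · exact h1 i h
      · exact h2 i (hi.resolve_left h)
    · intro h
      refine ⟨fun i hi => ?_, fun i hi => ?_⟩
      · simpa [hi] using h i (Or.inl hi)
      · have := h i (Or.inr hi)
        rwa [if_neg (Finset.disjoint_right.mp hdisj hi)] at this
  rw [h1, Measure.infinitePi_pi _ fun i _ => by split_ifs; exacts [ht i, ht' _],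
    Measure.infinitePi_pi _ fun i _ => ht i, Measure.infinitePi_pi _ fun i _ => ht' _,
    Finset.prod_union hdisj]
  congr 1
  · exact Finset.prod_congr rfl fun i hi => by rw [if_pos hi]
  · exact Finset.prod_congr rfl fun i hi => by rw [if_neg (Finset.disjoint_right.mp hdisj hi)]

/-- `A` and the shifts of `B` are asymptotically independent. -/
def MixingPair (A B : Set (ℤ → ℝ)) : Prop :=
  Tendsto (fun n : ℕ => (bernoulliLaw ν).real (A ∩ shift n ⁻¹' B)) atTop
    (𝓝 ((bernoulliLaw ν).real A * (bernoulliLaw ν).real B))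

variable {ν}

lemma MixingPair.compl_right {A B : Set (ℤ → ℝ)} (hB : MeasurableSet B)
    (h : MixingPair ν A B) : MixingPair ν A Bᶜ := by
  unfold MixingPair at *
  rw [probReal_compl_eq_one_sub hB, mul_sub, mul_one]
  refine (tendsto_const_nhds.sub h).congr fun n => ?_
  have h1 := measureReal_inter_add_sdiff (μ := bernoulliLaw ν) (s := A) (measurable_shift n hB)
  rw [Set.preimage_compl, ← Set.sdiff_eq]
  linarith

lemma MixingPair.compl_left {A B : Set (ℤ → ℝ)} (hA : MeasurableSet A) (hB : MeasurableSet B)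
    (h : MixingPair ν A B) : MixingPair ν Aᶜ B := by
  unfold MixingPair at *
  rw [probReal_compl_eq_one_sub hA, sub_mul, one_mul]
  refine (tendsto_const_nhds.sub h).congr fun n => ?_
  have h1 := measureReal_inter_add_sdiff (μ := bernoulliLaw ν) (s := shift n ⁻¹' B) hA
  rw [measureReal_def (s := shift n ⁻¹' B),
    (measurePreserving_shift ν n).measure_preimage hB.nullMeasurableSet, ← measureReal_def] at h1
  rw [Set.inter_comm, Set.inter_comm Aᶜ, ← Set.sdiff_eq]
  linarith

lemma MixingPair.iUnion_right {A : Set (ℤ → ℝ)} {B : ℕ → Set (ℤ → ℝ)} (hA : MeasurableSet A)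
    (hd : Pairwise (Function.onFun Disjoint B)) (hB : ∀ i, MeasurableSet (B i))
    (h : ∀ i, MixingPair ν A (B i)) : MixingPair ν A (⋃ i, B i) := by
  unfold MixingPair at *
  have h1 : HasSum (fun i => (bernoulliLaw ν).real (B i)) ((bernoulliLaw ν).real (⋃ i, B i)) :=
    hasSum_measureReal_iUnion hd hB
  rw [← h1.tsum_eq, ← tsum_mul_left]
  have h2 : ∀ n : ℕ, ∑' i, (bernoulliLaw ν).real (A ∩ shift n ⁻¹' B i) =
      (bernoulliLaw ν).real (A ∩ shift n ⁻¹' ⋃ i, B i) := fun n => by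
    rw [Set.preimage_iUnion, Set.inter_iUnion]
    refine (hasSum_measureReal_iUnion (fun i j hij => ?_) fun i =>
      hA.inter (measurable_shift n (hB i))).tsum_eq
    exact ((hd hij).preimage _).mono Set.inter_subset_right Set.inter_subset_right
  refine (tendsto_tsum_of_dominated_convergence h1.summable h (.of_forall fun n i => ?_)).congr h2
  rw [Real.norm_of_nonneg measureReal_nonneg]
  refine (measureReal_mono Set.inter_subset_right).trans ?_
  rw [measureReal_def, (measurePreserving_shift ν n).measure_preimage (hB i).nullMeasurableSet,
    ← measureReal_def]

lemma MixingPair.iUnion_left {B : Set (ℤ → ℝ)} {A : ℕ → Set (ℤ → ℝ)} (hB : MeasurableSet B)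
    (hd : Pairwise (Function.onFun Disjoint A)) (hA : ∀ i, MeasurableSet (A i))
    (h : ∀ i, MixingPair ν (A i) B) : MixingPair ν (⋃ i, A i) B := by
  unfold MixingPair at *
  have h1 : HasSum (fun i => (bernoulliLaw ν).real (A i)) ((bernoulliLaw ν).real (⋃ i, A i)) :=
    hasSum_measureReal_iUnion hd hA
  rw [← h1.tsum_eq, ← tsum_mul_right]
  have h2 : ∀ n : ℕ, ∑' i, (bernoulliLaw ν).real (A i ∩ shift n ⁻¹' B) =
      (bernoulliLaw ν).real ((⋃ i, A i) ∩ shift n ⁻¹' B) := fun n => by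
    rw [Set.iUnion_inter]
    refine (hasSum_measureReal_iUnion (fun i j hij => ?_) fun i =>
      (hA i).inter (measurable_shift n hB)).tsum_eq
    exact (hd hij).mono Set.inter_subset_left Set.inter_subset_left
  refine (tendsto_tsum_of_dominated_convergence h1.summable h (.of_forall fun n i => ?_)).congr h2
  rw [Real.norm_of_nonneg measureReal_nonneg]
  exact measureReal_mono Set.inter_subset_left

variable (ν)

/-- The π-λ argument, once in each variable. Countable disjoint unions pass to the limit by
dominated convergence, since the probabilities of the pieces are summable. -/
theorem mixingPair {A B : Set (ℤ → ℝ)} (hA : MeasurableSet A) (hB : MeasurableSet B) :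
    MixingPair ν A B := by
  refine MeasurableSpace.induction_on_inter (C := fun A _ => MixingPair ν A B)
    generateFrom_rectangles isPiSystem_rectangles (by simp [MixingPair]) (fun A hA => ?_)
    (fun A hA h => h.compl_left hA hB) (fun A hd hA h => MixingPair.iUnion_left hB hd hA h) A hA
  refine MeasurableSpace.induction_on_inter (C := fun B _ => MixingPair ν A B)
    generateFrom_rectangles isPiSystem_rectangles (by simp [MixingPair]) (fun B hB => ?_)
    (fun B hB h => h.compl_right hB)
    (fun B hd hB h => MixingPair.iUnion_right (measurableSet_rectangle hA) hd hB h) B hB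
  refine tendsto_const_nhds.congr' ?_
  filter_upwards [rectangles_mixing ν hA hB] with n hn
  rw [measureReal_def, measureReal_def, measureReal_def, hn, ENNReal.toReal_mul]

/-- The Bernoulli shift is ergodic. -/
theorem ergodic_shift : Ergodic (shift 1) (bernoulliLaw ν) where
  toMeasurePreserving := measurePreserving_shift ν 1
  aeconst_set A hA hinv := by
    have h1 : ∀ n : ℕ, shift n ⁻¹' A = A := by
      intro n
      induction n with
      | zero =>
        have : shift ((0 : ℕ) : ℤ) = id := by ext x t; simp [shift]
        rw [this, Set.preimage_id]
      | succ n ih =>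
        rw [Nat.cast_succ, ← shift_comp, Set.preimage_comp, ih, hinv]
    -- For an invariant set the mixing sequence is constant, so its probability is `0` or `1`.
    have h2 : (bernoulliLaw ν).real A = (bernoulliLaw ν).real A * (bernoulliLaw ν).real A := by
      refine tendsto_nhds_unique (tendsto_const_nhds (f := (atTop : Filter ℕ))) ?_
      refine (mixingPair ν hA hA).congr fun n => ?_
      rw [h1, Set.inter_self]
    rw [eventuallyConst_set']
    have h3 : (bernoulliLaw ν).real A = 0 ∨ (bernoulliLaw ν).real A = 1 := by
      rcases eq_or_ne ((bernoulliLaw ν).real A) 0 with h | h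
      · exact Or.inl h
      · exact Or.inr (mul_left_cancel₀ h (by rw [mul_one]; exact h2.symm))
    rcases h3 with h | h
    · left
      rw [ae_eq_empty]
      exact (measureReal_eq_zero_iff (measure_ne_top _ _)).mp h
    · right
      rw [ae_eq_univ, ← measureReal_eq_zero_iff (measure_ne_top _ _),
        probReal_compl_eq_one_sub hA, h, sub_self]

end Shift

/-! ### Factors of a process -/

section Factors

variable {Ω : Type*} [MeasurableSpace Ω] {μ : Measure Ω}

/-- `Y_t` is the same measurable function of `(ξ_{t+u})_u` for all `t`. -/
def IsFactor (μ : Measure Ω) (ξ Y : ℤ → Ω → ℝ) : Prop :=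
  ∃ G : (ℤ → ℝ) → ℝ, Measurable G ∧ ∀ t, Y t =ᵐ[μ] fun ω => G fun u => ξ (u + t) ω

lemma isFactor_self (ξ : ℤ → Ω → ℝ) : IsFactor μ ξ ξ :=
  ⟨fun x => x 0, measurable_pi_apply 0, fun t => by simp⟩

lemma isFactor_const (ξ : ℤ → Ω → ℝ) (c : ℝ) : IsFactor μ ξ fun _ _ => c :=
  ⟨fun _ => c, measurable_const, fun _ => .rfl⟩

variable {ξ Y Z : ℤ → Ω → ℝ}

lemma IsFactor.congr (h : IsFactor μ ξ Y) (hYZ : ∀ t, Z t =ᵐ[μ] Y t) : IsFactor μ ξ Z := by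
  obtain ⟨G, hG, h⟩ := h
  exact ⟨G, hG, fun t => (hYZ t).trans (h t)⟩

lemma IsFactor.lag (h : IsFactor μ ξ Y) (k : ℤ) : IsFactor μ ξ fun t => Y (t - k) := by
  obtain ⟨G, hG, h⟩ := h
  refine ⟨fun x => G (shift (-k) x), hG.comp (measurable_shift _), fun t => ?_⟩
  refine (h (t - k)).trans (.of_eq ?_)
  ext ω
  congr 1; ext u
  simp only [shift]
  congr 1; ring

lemma IsFactor.map₂ (h : IsFactor μ ξ Y) (h' : IsFactor μ ξ Z) {f : ℝ → ℝ → ℝ}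
    (hf : Measurable (Function.uncurry f)) : IsFactor μ ξ fun t ω => f (Y t ω) (Z t ω) := by
  obtain ⟨G, hG, h⟩ := h
  obtain ⟨G', hG', h'⟩ := h'
  refine ⟨fun x => f (G x) (G' x), hf.comp (hG.prodMk hG'), fun t => ?_⟩
  filter_upwards [h t, h' t] with ω h1 h2
  rw [h1, h2]

lemma IsFactor.add (h : IsFactor μ ξ Y) (h' : IsFactor μ ξ Z) :
    IsFactor μ ξ fun t ω => Y t ω + Z t ω := h.map₂ h' measurable_add

lemma IsFactor.mul (h : IsFactor μ ξ Y) (h' : IsFactor μ ξ Z) :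
    IsFactor μ ξ fun t ω => Y t ω * Z t ω := h.map₂ h' measurable_mul

lemma IsFactor.const_mul (h : IsFactor μ ξ Y) (c : ℝ) :
    IsFactor μ ξ fun t ω => c * Y t ω := (isFactor_const ξ c).mul h

lemma isFactor_sum {ι : Type*} (S : Finset ι) {Y : ι → ℤ → Ω → ℝ} (h : ∀ i, IsFactor μ ξ (Y i)) :
    IsFactor μ ξ fun t ω => ∑ i ∈ S, Y i t ω := by
  classical
  induction S using Finset.induction_on with
  | empty => simpa using isFactor_const ξ 0
  | insert i S hi ih => simpa only [Finset.sum_insert hi] using (h i).add ih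

/-- The map `x ↦ (G (shift t x))_t` intertwines the shifts and carries the law of `ξ` to that of
`Y`, so both properties descend. -/
lemma isStrictlyStationary_and_isErgodic (hξ : ∀ t, Measurable (ξ t))
    (herg : Ergodic (shift 1) (pathLaw μ ξ))
    (hst : ∀ k, MeasurePreserving (shift k) (pathLaw μ ξ) (pathLaw μ ξ)) (h : IsFactor μ ξ Y) :
    IsStrictlyStationary μ Y ∧ IsErgodic μ Y := by
  obtain ⟨G, hG, h⟩ := h
  have hπ : Measurable fun ω t => ξ t ω := measurable_pi_lambda _ hξ
  have haem : ∀ t, AEMeasurable (Y t) μ := fun t =>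
    ⟨_, hG.comp (measurable_pi_lambda _ fun u => hξ (u + t)), h t⟩
  set g : (ℤ → ℝ) → ℤ → ℝ := fun x t => G (shift t x) with hg
  have hgm : Measurable g := measurable_pi_lambda _ fun t => hG.comp (measurable_shift t)
  have hlaw : ∀ k : ℤ, pathLaw μ (fun t => Y (t + k)) = (pathLaw μ ξ).map (g ∘ shift k) := by
    intro k
    rw [pathLaw, pathLaw, Measure.map_map (hgm.comp (measurable_shift k)) hπ]
    refine Measure.map_congr ?_
    filter_upwards [ae_all_iff.mpr h] with ω hω
    ext t
    simp only [hg, Function.comp, hω]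
    congr 1; ext u
    simp only [shift]
    congr 1; ring
  have hlaw0 : pathLaw μ Y = (pathLaw μ ξ).map g := by
    have h1 := hlaw 0
    have h2 : shift 0 = id := by ext x t; simp [shift]
    simpa [h2] using h1
  refine ⟨⟨haem, fun k => ?_⟩, haem, ?_⟩
  · rw [hlaw, hlaw0, ← Measure.map_map hgm (measurable_shift k), (hst k).map_eq]
  · rw [hlaw0]
    refine MeasurePreserving.ergodic_of_ergodic_semiconj (g := g) ⟨hgm, rfl⟩ herg
      (measurable_shift 1) fun x => ?_
    ext t
    change G (shift t (shift 1 x)) = G (shift (t + 1) x)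
    rw [← shift_comp]
    rfl

/-- A limit function on path space is built from an a.e. convergent subsequence at time `0`.
Stationarity of `ξ` carries its a.e. convergence to every time, so one function serves all `t`. -/
lemma IsFactor.tendsto [IsFiniteMeasure μ] {Yn : ℕ → ℤ → Ω → ℝ} (hξ : ∀ t, Measurable (ξ t))
    (hst : ∀ k, MeasurePreserving (shift k) (pathLaw μ ξ) (pathLaw μ ξ))
    (hn : ∀ n, IsFactor μ ξ (Yn n)) (h : ∀ t, TendstoInMeasure μ (fun n => Yn n t) atTop (Y t)) :
    IsFactor μ ξ Y := by
  choose G hG hYG using hn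
  have hπ : Measurable fun ω t => ξ t ω := measurable_pi_lambda _ hξ
  obtain ⟨ns, hns, hlim⟩ := (h 0).exists_seq_tendsto_ae
  have h1 : ∀ᵐ x ∂pathLaw μ ξ, ∃ l, Tendsto (fun n => G (ns n) x) atTop (𝓝 l) := by
    rw [pathLaw, ae_map_iff hπ.aemeasurable
      (measurableSet_exists_tendsto fun n => hG (ns n))]
    filter_upwards [hlim, ae_all_iff.mpr fun n => hYG n 0] with ω h2 h3
    refine ⟨Y 0 ω, h2.congr fun n => ?_⟩
    rw [h3]
    simp
  obtain ⟨G0, hG0, hG0lim⟩ := measurable_limit_of_tendsto_metrizable_ae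
    (fun n => (hG (ns n)).aemeasurable) h1
  refine ⟨G0, hG0, fun t => ?_⟩
  have h2 : ∀ᵐ ω ∂μ, Tendsto (fun n => G (ns n) fun u => ξ (u + t) ω) atTop
      (𝓝 (G0 fun u => ξ (u + t) ω)) :=
    (MeasurePreserving.comp (hst t) ⟨hπ, rfl⟩).quasiMeasurePreserving.ae hG0lim
  have h3 : ∀ᵐ ω ∂μ, Tendsto (fun n => Yn (ns n) t ω) atTop
      (𝓝 (G0 fun u => ξ (u + t) ω)) := by
    filter_upwards [h2, ae_all_iff.mpr fun n => hYG n t] with ω h4 h5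
    exact h4.congr fun n => (h5 (ns n)).symm
  refine tendstoInMeasure_ae_unique ((h t).comp hns.tendsto_atTop)
    (tendstoInMeasure_of_tendsto_ae (fun n => ?_) h3)
  exact AEMeasurable.aestronglyMeasurable
    ⟨_, (hG _).comp (measurable_pi_lambda _ fun u => hξ (u + t)), hYG _ t⟩

end Factors

/-! ### The innovations of a GARCH process -/

section Garch

variable {Ω : Type*} [MeasurableSpace Ω] {μ : Measure Ω} {m r : ℕ} {α0 : ℝ} {α : Fin m → ℝ}
  {β : Fin r → ℝ} {ν : Measure ℝ} {ε h : ℤ → Ω → ℝ}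

/-- The standardized innovations. -/
def innov (ε h : ℤ → Ω → ℝ) (t : ℤ) (ω : Ω) : ℝ := ε t ω / √(h t ω)

lemma past_le (hε : ∀ t, Measurable (ε t)) (t : ℤ) : past ε t ≤ ‹MeasurableSpace Ω› :=
  iSup_le fun u => (hε u).comap_le

omit [MeasurableSpace Ω] in
lemma past_mono (ε : ℤ → Ω → ℝ) {t u : ℤ} (htu : t ≤ u) : past ε t ≤ past ε u :=
  iSup_le fun v => le_iSup (fun u : {v : ℤ // v < u} => MeasurableSpace.comap (ε u) inferInstance)
    ⟨v, v.2.trans_le htu⟩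

omit [MeasurableSpace Ω] in
lemma measurable_past (ε : ℤ → Ω → ℝ) {t u : ℤ} (htu : t < u) : Measurable[past ε u] (ε t) :=
  (comap_measurable (ε t)).mono
    (le_iSup (fun v : {v : ℤ // v < u} => MeasurableSpace.comap (ε v) inferInstance) ⟨t, htu⟩) le_rfl

/-- Approximations of the conditional variance. -/
def volApprox (α0 : ℝ) (α : Fin m → ℝ) (β : Fin r → ℝ) (ξ : ℤ → Ω → ℝ) :
    ℕ → ℤ → Ω → ℝ
  | 0, _, _ => 0
  | n + 1, t, ω => α0 + ∑ i : Fin m, α i * (volApprox α0 α β ξ n (t - ((i : ℕ) + 1)) ω *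
      (ξ (t - ((i : ℕ) + 1)) ω * ξ (t - ((i : ℕ) + 1)) ω)) +
      ∑ j : Fin r, β j * volApprox α0 α β ξ n (t - ((j : ℕ) + 1)) ω

lemma isFactor_volApprox (ξ : ℤ → Ω → ℝ) (n : ℕ) : IsFactor μ ξ (volApprox α0 α β ξ n) := by
  induction n with
  | zero => exact isFactor_const ξ 0
  | succ n ih =>
    exact ((isFactor_const ξ α0).add (isFactor_sum _ fun i : Fin m =>
      ((ih.lag _).mul (((isFactor_self ξ).lag _).mul ((isFactor_self ξ).lag _))).const_mul (α i))).add
      (isFactor_sum _ fun j : Fin r => (ih.lag _).const_mul (β j))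

namespace IsGARCH

variable (hg : IsGARCH μ α0 α β ν ε h)
include hg

lemma measurable_h (t : ℤ) : Measurable (h t) := (hg.h_adapted t).mono (past_le hg.measurable t) le_rfl

lemma innov_past {t u : ℤ} (htu : t < u) : Measurable[past ε u] (innov ε h t) :=
  (measurable_past ε htu).div ((hg.h_adapted t).mono (past_mono ε htu.le) le_rfl).sqrt

lemma measurable_innov (t : ℤ) : Measurable (innov ε h t) :=
  (hg.innov_past (lt_add_one t)).mono (past_le hg.measurable _) le_rfl

lemma le_h (hα : ∀ i, 0 ≤ α i) (hβ : ∀ j, 0 ≤ β j) (t : ℤ) : ∀ᵐ ω ∂μ, α0 ≤ h t ω := by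
  filter_upwards [hg.recursion t, ae_all_iff.mpr hg.h_nonneg] with ω h1 h2
  rw [h1]
  have h3 : 0 ≤ ∑ i : Fin m, α i * ε (t - ((i : ℕ) + 1)) ω ^ 2 :=
    Finset.sum_nonneg fun i _ => mul_nonneg (hα i) (sq_nonneg _)
  have h4 : 0 ≤ ∑ j : Fin r, β j * h (t - ((j : ℕ) + 1)) ω :=
    Finset.sum_nonneg fun j _ => mul_nonneg (hβ j) (h2 _)
  linarith

variable (hα0 : 0 < α0) (hα : ∀ i, 0 ≤ α i) (hβ : ∀ j, 0 ≤ β j)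
include hα0 hα hβ

lemma eq_sqrt_mul_innov (t : ℤ) : ∀ᵐ ω ∂μ, ε t ω = √(h t ω) * innov ε h t ω := by
  filter_upwards [hg.le_h hα hβ t] with ω h1
  rw [innov, mul_div_cancel₀]
  exact (Real.sqrt_pos.mpr (hα0.trans_le h1)).ne'

/-- Since `h ≥ α0 > 0`, the variable `η` of `conditional_law` agrees a.e. with `innov`, and law and
independence transfer. Unlike `η`, `innov` is by construction a function of `ε` up to time `t`. -/
lemma innov_spec (t : ℤ) : μ.map (innov ε h t) = ν ∧
    Indep (MeasurableSpace.comap (innov ε h t) inferInstance) (past ε t) μ := by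
  obtain ⟨η, hη, hν, hind, he⟩ := hg.conditional_law t
  have hae : innov ε h t =ᵐ[μ] η := by
    filter_upwards [he, hg.le_h hα hβ t] with ω h1 h2
    rw [innov, h1, mul_div_cancel_left₀]
    exact (Real.sqrt_pos.mpr (hα0.trans_le h2)).ne'
  refine ⟨(Measure.map_congr hae).trans hν, ?_⟩
  rw [Indep_iff] at hind ⊢
  rintro _ A ⟨B, hB, rfl⟩ hA
  have h1 : innov ε h t ⁻¹' B =ᵐ[μ] η ⁻¹' B := hae.preimage B
  rw [measure_congr h1, measure_congr (h1.inter (ae_eq_refl A))]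
  exact hind _ A ⟨B, hB, rfl⟩ hA

variable [IsProbabilityMeasure μ]

/-- Induction on the largest index: all earlier innovations are measurable with respect to the past
of which the last one is independent. -/
lemma iIndepFun_innov : iIndepFun (innov ε h) μ := by
  classical
  rw [iIndepFun_iff_measure_inter_preimage_eq_mul]
  intro S
  induction S using Finset.induction_on_max with
  | empty => simp
  | insert a s ha ih =>
    intro sets hsets
    have hnot : a ∉ s := fun h => lt_irrefl a (ha a h)
    rw [Finset.prod_insert hnot, ← ih fun i hi => hsets i (Finset.mem_insert_of_mem hi),
      Finset.set_biInter_insert]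
    refine (Indep_iff _ _ _).mp (hg.innov_spec hα0 hα hβ a).2 _ _
      ⟨sets a, hsets a (Finset.mem_insert_self a s), rfl⟩ ?_
    exact MeasurableSet.biInter s.countable_toSet fun i hi =>
      hg.innov_past (ha i hi) (hsets i (Finset.mem_insert_of_mem hi))

lemma isProbabilityMeasure_law : IsProbabilityMeasure ν := by
  rw [← (hg.innov_spec hα0 hα hβ 0).1]
  exact Measure.isProbabilityMeasure_map (hg.measurable_innov 0).aemeasurable

lemma pathLaw_innov : pathLaw μ (innov ε h) = bernoulliLaw ν := by
  rw [pathLaw, (hg.iIndepFun_innov hα0 hα hβ).map_fun_eq_infinitePi_map hg.measurable_innov]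
  congr 1
  ext1 t
  exact (hg.innov_spec hα0 hα hβ t).1

omit [IsProbabilityMeasure μ] in
-- The squared innovation has mean one and is independent of the past.
lemma lintegral_innov_sq_mul {t : ℤ} {f : Ω → ENNReal} (hf : Measurable[past ε t] f) :
    ∫⁻ ω, ‖innov ε h t ω ^ 2‖ₑ * f ω ∂μ = ∫⁻ ω, f ω ∂μ := by
  obtain ⟨hν, hind⟩ := hg.innov_spec hα0 hα hβ t
  rw [lintegral_mul_eq_lintegral_mul_lintegral_of_independent_measurableSpace
    (hg.measurable_innov t).comap_le (past_le hg.measurable t) hind _ hf]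
  · have h1 : ∫⁻ ω, ‖innov ε h t ω ^ 2‖ₑ ∂μ = ∫⁻ x, ‖x ^ 2‖ₑ ∂ν := by
      rw [← hν, lintegral_map (by fun_prop) (hg.measurable_innov t)]
    have h2 : ∫⁻ x, ‖x ^ 2‖ₑ ∂ν = 1 := by
      have h3 := ofReal_integral_norm_eq_lintegral_enorm hg.law_memLp.integrable_sq
      rw [← h3]
      simp only [norm_pow, Real.norm_eq_abs, sq_abs, hg.law_var, ENNReal.ofReal_one]
    rw [h1, h2, one_mul]
  · exact measurable_enorm.comp ((comap_measurable (innov ε h t)).pow_const 2)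

omit hα0 hα hβ [IsProbabilityMeasure μ] in
lemma volApprox_past (n : ℕ) (t : ℤ) :
    Measurable[past ε t] (volApprox α0 α β (innov ε h) n t) := by
  induction n generalizing t with
  | zero => exact measurable_const
  | succ n ih =>
    refine (measurable_const.add (Finset.measurable_fun_sum _ fun i _ => ?_)).add
      (Finset.measurable_fun_sum _ fun j _ => ?_)
    · have h1 := hg.innov_past (t := t - ((i : ℕ) + 1)) (u := t) (by omega)
      have h2 := (ih (t - ((i : ℕ) + 1))).mono (past_mono ε (u := t) (by omega)) le_rfl
      exact (h2.mul (h1.mul h1)).const_mul _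
    · exact ((ih (t - ((j : ℕ) + 1))).mono (past_mono ε (u := t) (by omega)) le_rfl).const_mul _

omit [IsProbabilityMeasure μ] in
lemma lintegral_h {σ2 : ℝ} (hε : IsWhiteNoise μ ε σ2) (t : ℤ) :
    ∫⁻ ω, ‖h t ω‖ₑ ∂μ = ENNReal.ofReal σ2 := by
  rw [← hg.lintegral_innov_sq_mul hα0 hα hβ (f := fun ω => ‖h t ω‖ₑ)
    (measurable_enorm.comp (hg.h_adapted t))]
  have h1 : ∫⁻ ω, ‖innov ε h t ω ^ 2‖ₑ * ‖h t ω‖ₑ ∂μ = ∫⁻ ω, ‖ε t ω ^ 2‖ₑ ∂μ := by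
    refine lintegral_congr_ae ?_
    filter_upwards [hg.eq_sqrt_mul_innov hα0 hα hβ t, hg.h_nonneg t] with ω h2 h3
    rw [← enorm_mul, h2, mul_pow, Real.sq_sqrt h3, mul_comm]
  rw [h1, ← ofReal_integral_norm_eq_lintegral_enorm (hε.memLp t).integrable_sq]
  simp only [norm_pow, Real.norm_eq_abs, sq_abs]
  have h2 := hε.var t
  rw [variance_eq_integral (hε.memLp t).aemeasurable, hε.mean t] at h2
  simp only [sub_zero] at h2
  rw [h2]

lemma variance_pos {σ2 : ℝ} (hε : IsWhiteNoise μ ε σ2) : 0 < σ2 := by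
  have h1 := hg.lintegral_h hα0 hα hβ hε 0
  have h2 : ENNReal.ofReal α0 ≤ ∫⁻ ω, ‖h 0 ω‖ₑ ∂μ := by
    calc ENNReal.ofReal α0 = ∫⁻ _, ENNReal.ofReal α0 ∂μ := by simp
      _ ≤ _ := lintegral_mono_ae (by
        filter_upwards [hg.le_h hα hβ 0] with ω h3
        rw [← ofReal_norm]
        exact ENNReal.ofReal_le_ofReal (h3.trans (le_abs_self _)))
  rw [h1] at h2
  exact ENNReal.ofReal_pos.mp ((ENNReal.ofReal_pos.mpr hα0).trans_le h2)

omit [IsProbabilityMeasure μ] in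
-- Substituting `ε² = h η²` makes the recursion linear in `h`. Each squared innovation multiplies a
-- function of its past and drops out in mean, so one iteration contracts the `L¹` error by `∑ α + ∑
-- β`.
lemma lintegral_h_sub_volApprox {σ2 : ℝ} (hε : IsWhiteNoise μ ε σ2) (n : ℕ) (t : ℤ) :
    ∫⁻ ω, ‖h t ω - volApprox α0 α β (innov ε h) n t ω‖ₑ ∂μ ≤
      ENNReal.ofReal (∑ i, α i + ∑ j, β j) ^ n * ENNReal.ofReal σ2 := by
  induction n generalizing t with
  | zero =>
    simp only [volApprox, sub_zero, pow_zero, one_mul]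
    exact (hg.lintegral_h hα0 hα hβ hε t).le
  | succ n ih =>
    set E : ℤ → Ω → ENNReal := fun t ω => ‖h t ω - volApprox α0 α β (innov ε h) n t ω‖ₑ with hE
    have hEm : ∀ t, Measurable[past ε t] (E t) := fun t =>
      measurable_enorm.comp ((hg.h_adapted t).sub (hg.volApprox_past n t))
    have hEm' : ∀ t, Measurable (E t) := fun t => (hEm t).mono (past_le hg.measurable t) le_rfl
    have hsq : ∀ t, Measurable fun ω => ‖innov ε h t ω ^ 2‖ₑ := fun t =>
      ((hg.measurable_innov t).pow_const 2).enorm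
    have hprod : ∀ t, Measurable fun ω => ‖innov ε h t ω ^ 2‖ₑ * E t ω := fun t =>
      (hsq t).mul (hEm' t)
    calc ∫⁻ ω, ‖h t ω - volApprox α0 α β (innov ε h) (n + 1) t ω‖ₑ ∂μ
        ≤ ∫⁻ ω, ∑ i : Fin m, ENNReal.ofReal (α i) * (‖innov ε h (t - ((i : ℕ) + 1)) ω ^ 2‖ₑ *
            E (t - ((i : ℕ) + 1)) ω) +
          ∑ j : Fin r, ENNReal.ofReal (β j) * E (t - ((j : ℕ) + 1)) ω ∂μ := by
          refine lintegral_mono_ae ?_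
          filter_upwards [hg.recursion t, ae_all_iff.mpr (hg.eq_sqrt_mul_innov hα0 hα hβ),
            ae_all_iff.mpr hg.h_nonneg] with ω h1 h2 h3
          have h4 : h t ω - volApprox α0 α β (innov ε h) (n + 1) t ω =
              ∑ i : Fin m, α i * (innov ε h (t - ((i : ℕ) + 1)) ω ^ 2 *
                (h (t - ((i : ℕ) + 1)) ω - volApprox α0 α β (innov ε h) n (t - ((i : ℕ) + 1)) ω)) +
              ∑ j : Fin r, β j * (h (t - ((j : ℕ) + 1)) ω -
                volApprox α0 α β (innov ε h) n (t - ((j : ℕ) + 1)) ω) := by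
            rw [h1, volApprox]
            have h5 : ∑ i : Fin m, α i * ε (t - ((i : ℕ) + 1)) ω ^ 2 = ∑ i : Fin m, α i *
                (h (t - ((i : ℕ) + 1)) ω * innov ε h (t - ((i : ℕ) + 1)) ω ^ 2) :=
              Finset.sum_congr rfl fun i _ => by
                rw [h2 (t - ((i : ℕ) + 1)), mul_pow, Real.sq_sqrt (h3 _)]
            rw [h5]
            simp only [mul_sub, Finset.sum_sub_distrib]
            have h6 : ∀ i : Fin m, α i * (innov ε h (t - ((i : ℕ) + 1)) ω ^ 2 *
                h (t - ((i : ℕ) + 1)) ω) = α i * (h (t - ((i : ℕ) + 1)) ω *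
                innov ε h (t - ((i : ℕ) + 1)) ω ^ 2) := fun i => by ring
            have h7 : ∀ i : Fin m, α i * (innov ε h (t - ((i : ℕ) + 1)) ω ^ 2 *
                volApprox α0 α β (innov ε h) n (t - ((i : ℕ) + 1)) ω) =
                α i * (volApprox α0 α β (innov ε h) n (t - ((i : ℕ) + 1)) ω *
                (innov ε h (t - ((i : ℕ) + 1)) ω * innov ε h (t - ((i : ℕ) + 1)) ω)) :=
              fun i => by ring
            simp only [h6, h7]
            ring
          rw [h4]
          refine (enorm_add_le _ _).trans (add_le_add ?_ ?_)
          · refine (enorm_sum_le _ _).trans (Finset.sum_le_sum fun i _ => ?_)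
            rw [enorm_mul, enorm_mul, Real.enorm_of_nonneg (hα i)]
          · refine (enorm_sum_le _ _).trans (Finset.sum_le_sum fun j _ => ?_)
            rw [enorm_mul, Real.enorm_of_nonneg (hβ j)]
      _ = ∑ i : Fin m, ENNReal.ofReal (α i) * ∫⁻ ω, E (t - ((i : ℕ) + 1)) ω ∂μ +
          ∑ j : Fin r, ENNReal.ofReal (β j) * ∫⁻ ω, E (t - ((j : ℕ) + 1)) ω ∂μ := by
          rw [lintegral_add_left (Finset.measurable_fun_sum _ fun i _ =>
              (hprod _).const_mul _),
            lintegral_finsetSum _ fun i _ => (hprod _).const_mul _,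
            lintegral_finsetSum _ fun j _ => (hEm' _).const_mul _]
          congr 1
          · refine Finset.sum_congr rfl fun i _ => ?_
            rw [lintegral_const_mul _ (hprod _),
              hg.lintegral_innov_sq_mul hα0 hα hβ (hEm _)]
          · exact Finset.sum_congr rfl fun j _ => lintegral_const_mul _ (hEm' _)
      _ ≤ ∑ i : Fin m, ENNReal.ofReal (α i) *
            (ENNReal.ofReal (∑ i, α i + ∑ j, β j) ^ n * ENNReal.ofReal σ2) +
          ∑ j : Fin r, ENNReal.ofReal (β j) *
            (ENNReal.ofReal (∑ i, α i + ∑ j, β j) ^ n * ENNReal.ofReal σ2) := by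
          gcongr <;> exact ih _
      _ = _ := by
          rw [← Finset.sum_mul, ← Finset.sum_mul, ← add_mul,
            ← ENNReal.ofReal_sum_of_nonneg fun i _ => hα i,
            ← ENNReal.ofReal_sum_of_nonneg fun j _ => hβ j,
            ← ENNReal.ofReal_add (Finset.sum_nonneg fun i _ => hα i)
              (Finset.sum_nonneg fun j _ => hβ j), pow_succ]
          ring

theorem isFactor_innov (hαβ : ∑ i, α i + ∑ j, β j < 1) {σ2 : ℝ} (hε : IsWhiteNoise μ ε σ2) :
    IsFactor μ (innov ε h) ε := by
  have := hg.isProbabilityMeasure_law hα0 hα hβ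
  have hst : ∀ k, MeasurePreserving (shift k) (pathLaw μ (innov ε h)) (pathLaw μ (innov ε h)) := by
    rw [hg.pathLaw_innov hα0 hα hβ]
    exact measurePreserving_shift ν
  have h1 : IsFactor μ (innov ε h) h := by
    refine IsFactor.tendsto hg.measurable_innov hst
      (isFactor_volApprox (α0 := α0) (α := α) (β := β) (innov ε h)) fun t => ?_
    refine tendstoInMeasure_of_tendsto_eLpNorm one_ne_zero (fun n => ?_)
      (hg.measurable_h t).aestronglyMeasurable ?_
    · exact ((hg.volApprox_past n t).mono (past_le hg.measurable t) le_rfl).aestronglyMeasurable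
    · have h2 : Tendsto (fun n : ℕ => ENNReal.ofReal (∑ i, α i + ∑ j, β j) ^ n *
          ENNReal.ofReal σ2) atTop (𝓝 0) := by
        have h3 : ENNReal.ofReal (∑ i, α i + ∑ j, β j) < 1 := by
          rw [← ENNReal.ofReal_one]
          exact (ENNReal.ofReal_lt_ofReal_iff one_pos).mpr hαβ
        have h4 := ENNReal.Tendsto.mul_const (b := ENNReal.ofReal σ2)
          (ENNReal.tendsto_pow_atTop_nhds_zero_of_lt_one h3) (Or.inr ENNReal.ofReal_ne_top)
        rwa [zero_mul] at h4
      refine tendsto_of_tendsto_of_tendsto_of_le_of_le tendsto_const_nhds h2 (fun _ => zero_le)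
        fun n => ?_
      rw [eLpNorm_one_eq_lintegral_enorm]
      refine le_trans (le_of_eq (lintegral_congr fun ω => ?_))
        (hg.lintegral_h_sub_volApprox hα0 hα hβ hε n t)
      rw [Pi.sub_apply, ← enorm_neg, neg_sub]
  refine IsFactor.congr (h1.map₂ (isFactor_self _) (f := fun x y => √x * y) ?_)
    (hg.eq_sqrt_mul_innov hα0 hα hβ)
  exact measurable_fst.sqrt.mul measurable_snd

/-- Factors of the innovations are strictly stationary and ergodic. -/
theorem isStrictlyStationary_and_isErgodic {Y : ℤ → Ω → ℝ} (hY : IsFactor μ (innov ε h) Y) :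
    IsStrictlyStationary μ Y ∧ IsErgodic μ Y := by
  have := hg.isProbabilityMeasure_law hα0 hα hβ
  refine SarfimaGarch.isStrictlyStationary_and_isErgodic hg.measurable_innov ?_ ?_ hY
  · rw [hg.pathLaw_innov hα0 hα hβ]
    exact ergodic_shift ν
  · rw [hg.pathLaw_innov hα0 hα hβ]
    exact measurePreserving_shift ν

/-- Mean-square limits of factors of the innovations are factors. -/
theorem isFactor_of_tendsto {Y : ℤ → Ω → ℝ} {Yn : ℕ → ℤ → Ω → ℝ}
    (hn : ∀ n, IsFactor μ (innov ε h) (Yn n)) (hm : ∀ n t, AEStronglyMeasurable (Yn n t) μ)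
    (hY : ∀ t, AEStronglyMeasurable (Y t) μ)
    (hlim : ∀ t, Tendsto (fun n => eLpNorm (fun ω => Yn n t ω - Y t ω) 2 μ) atTop (𝓝 0)) :
    IsFactor μ (innov ε h) Y := by
  have := hg.isProbabilityMeasure_law hα0 hα hβ
  refine IsFactor.tendsto hg.measurable_innov ?_ hn fun t =>
    tendstoInMeasure_of_tendsto_eLpNorm two_ne_zero (fun n => hm n t) (hY t) (hlim t)
  rw [hg.pathLaw_innov hα0 hα hβ]
  exact measurePreserving_shift ν

end IsGARCH

end Garch

/-! ### Fractionally integrated seasonal ARMA sequences in a Hilbert space -/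

section Hilbert

variable {H : Type*} [NormedAddCommGroup H] [InnerProductSpace ℝ H]

/-- `U = ∇^{(d, D)} X`. -/
def IsNabla (s : ℕ) (d D : ℝ) (X U : ℤ → H) : Prop :=
  ∀ t, Tendsto (fun n => ∑ k ∈ Finset.range n, nablaCoeff s d D k • X (t - k)) atTop (𝓝 (U t))

omit [InnerProductSpace ℝ H] in
lemma tendsto_Icc_of_hasSum {f : ℤ → H} {a : H} (h : HasSum f a) :
    Tendsto (fun n : ℕ => ∑ j ∈ Finset.Icc (-(n : ℤ)) n, f j) atTop (𝓝 a) := by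
  have h1 : Tendsto (fun n : ℕ => Finset.Icc (-(n : ℤ)) n) atTop atTop := by
    refine tendsto_atTop_finset_of_monotone (fun a b hab => ?_) fun x => ⟨x.natAbs, ?_⟩
    · exact Finset.Icc_subset_Icc (by omega) (by omega)
    · rw [Finset.mem_Icc]
      omega
  have h2 : Tendsto (fun S : Finset ℤ => ∑ j ∈ S, f j) atTop (𝓝 a) := by
    simpa [HasSum] using h
  exact h2.comp h1

variable [CompleteSpace H] {F : Measure Circle} [IsFiniteMeasure F] {s : ℕ} {d D : ℝ}
  {X U : ℤ → H}

lemma IsNabla.abelFilt (h : IsNabla s d D X U) : AbelFilt s d D X U := abelFilt_of_tendsto h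

lemma IsNabla.exists_bound (h : IsNabla s d D X U) (hX : HasSpec X F) :
    ∃ M, ∀ (n : ℕ) (t : ℤ), ‖∑ k ∈ Finset.range n, nablaCoeff s d D k • X (t - k)‖ ≤ M := by
  obtain ⟨M, hM⟩ := (h 0).norm.bddAbove_range
  refine ⟨M, fun n t => ?_⟩
  rw [← filt_trunc, hX.norm_filt_eq (summable_extNat.mpr (summable_trunc _ _)), filt_trunc]
  exact hM ⟨n, rfl⟩

lemma IsNabla.bddSeq (h : IsNabla s d D X U) (hX : HasSpec X F) : BddSeq U := by
  obtain ⟨M, hM⟩ := h.exists_bound hX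
  exact ⟨M, fun t => le_of_tendsto (h t).norm (.of_forall fun n => hM n t)⟩

/-- Finite truncations commute with `a`, and the partial sums are bounded uniformly in time by
stationarity, so a summable filter passes through a conditionally convergent difference. -/
lemma IsNabla.tendsto_filt_filt (h : IsNabla s d D X U) (hX : HasSpec X F) {a : ℤ → ℝ}
    (ha : Summable a) (t : ℤ) :
    Tendsto (fun n => ∑ k ∈ Finset.range n, nablaCoeff s d D k • filt a X (t - k)) atTop
      (𝓝 (filt a U t)) := by
  obtain ⟨M, hM⟩ := h.exists_bound hX
  refine (tendsto_filt ha (.of_forall hM) h t).congr fun n => ?_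
  have h1 : (fun t => ∑ k ∈ Finset.range n, nablaCoeff s d D k • X (t - k)) =
      filt (extNat (trunc n (nablaCoeff s d D))) X := by
    ext t
    rw [filt_trunc]
  rw [h1, filt_comm ha (summable_extNat.mpr (summable_trunc _ _)) hX.bddSeq, filt_trunc]

/-- The bounded solution of an ARMA equation. -/
lemma eq_filt_of_arma {A T : ℝ[X]} (hA : ∀ z : ℂ, ‖z‖ = 1 → aeval z A ≠ 0) {ψ : ℤ → ℝ}
    (hψ : IsLaurentExpansion ψ fun z => aeval z T / aeval z A) {ε : ℤ → H} (hU : BddSeq U)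
    (hε : BddSeq ε) (h : filt (polySeq A) U = filt (polySeq T) ε) : U = filt ψ ε := by
  obtain ⟨χ, hχ⟩ := exists_isLaurentExpansion 1 A hA
  have h1 : filt χ (filt (polySeq A) U) = U := by
    rw [filt_filt hχ.summable (summable_polySeq A) summable_unitSeq (fun z => ?_) hU, filt_unitSeq]
    rw [hχ.symb_eq, symb_polySeq, symb_unitSeq, map_one, one_div,
      inv_mul_cancel₀ (hA z z.norm_coe)]
  rw [← h1, h]
  refine filt_filt hχ.summable (summable_polySeq T) hψ.summable (fun z => ?_) hε
  rw [hχ.symb_eq, symb_polySeq, hψ.symb_eq, map_one]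
  ring

lemma filt_arma {A T : ℝ[X]} (hA : ∀ z : ℂ, ‖z‖ = 1 → aeval z A ≠ 0) {ψ : ℤ → ℝ}
    (hψ : IsLaurentExpansion ψ fun z => aeval z T / aeval z A) {ε : ℤ → H} (hε : BddSeq ε) :
    filt (polySeq A) (filt ψ ε) = filt (polySeq T) ε := by
  refine filt_filt (summable_polySeq A) hψ.summable (summable_polySeq T) (fun z => ?_) hε
  rw [hψ.symb_eq, symb_polySeq, symb_polySeq, mul_div_cancel₀ _ (hA z z.norm_coe)]

omit [IsFiniteMeasure F] in
lemma withDensity_unitRoots {f : Circle → ENNReal} (hF : F (unitRoots s) = 0) :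
    F.withDensity f (unitRoots s) = 0 :=
  withDensity_absolutelyContinuous F f hF

lemma isFiniteMeasure_filt (F : Measure Circle) [IsFiniteMeasure F] {a : ℤ → ℝ} (ha : Summable a) :
    IsFiniteMeasure (F.withDensity fun z => ENNReal.ofReal (‖symb a z‖ ^ 2)) := by
  have hc : Continuous fun z => ‖symb a z‖ ^ 2 := (continuous_symb ha).norm.pow 2
  exact isFiniteMeasure_withDensity_ofReal (integrable_of_continuous hc).hasFiniteIntegral

/-- A stationary solution is determined by its fractional difference if it has no component of
period `s`. -/
lemma IsNabla.unique (hs : 0 < s) {F' : Measure Circle} [IsFiniteMeasure F'] {Y : ℤ → H}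
    (h : IsNabla s d D X U) (hX : HasSpec X F) (hF : F (unitRoots s) = 0)
    (h' : IsNabla s d D Y U) (hY : HasSpec Y F') (hF' : F' (unitRoots s) = 0) : X = Y :=
  (h.abelFilt.inv hs hX hF).unique (h'.abelFilt.inv hs hY hF')

/-- The spectral measure of `X` does not charge the `s`-th roots of unity. -/
lemma IsNabla.unitRoots_eq_zero (hs : 0 < s) (h : IsNabla s d D X U) (hX : HasSpec X F)
    (hper : 0 < D ∨ 0 < d + D → NoPeriodic s X) (hU : NoPeriodic s U) : F (unitRoots s) = 0 := by
  by_cases hc : 0 < D ∨ 0 < d + D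
  · exact hX.unitRoots_eq_zero (hper hc)
  · rw [not_or, not_lt, not_lt] at hc
    exact h.abelFilt.unitRoots_eq_zero hs hc.2 hc.1 hX hU

/-! ### Uniqueness of the moving average weights -/

variable {ε W : ℤ → H} {σ2 : ℝ}

omit [CompleteSpace H] in
lemma IsFracNoise.inner_shift (hW : IsFracNoise s d D ε W) (h : OrthoNoise ε σ2) (t u : ℤ)
    (k : ℤ) : inner ℝ (W (t - k)) (ε u) = inner ℝ (W t) (ε (u + k)) := by
  refine tendsto_nhds_unique ((hW (t - k)).inner tendsto_const_nhds)
    (((hW t).inner tendsto_const_nhds).congr fun n => ?_)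
  simp only [sum_inner, inner_smul_left]
  refine Finset.sum_congr rfl fun l _ => ?_
  rw [h, h]
  congr 2
  exact propext ⟨fun h => by omega, fun h => by omega⟩

/-- The vector is the adjoint fractional difference of the noise, running forward in time from `u`.
Moving the lags onto `W` gives `⟨W_t, e⟩ = ⟨∇^{(d,D)} W_t, ε_u⟩ = ⟨ε_t, ε_u⟩`. -/
lemma exists_dual (hs : 0 < s) (h1 : |d + D| < 1 / 2) (h2 : |D| < 1 / 2)
    (hW : IsFracNoise s d D ε W) (h : OrthoNoise ε σ2) (h0 : 0 < σ2) (u : ℤ) :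
    ∃ e : H, ∀ t, inner ℝ (W t) e = if t = u then σ2 else 0 := by
  have hsum := h.summable_smul h0 (h.summable_nablaCoeff_sq h0 hs (neg_lt_of_abs_lt h1)
    (neg_lt_of_abs_lt h2)) (τ := fun l : ℕ => u + l) (fun a b hab => by simpa using hab)
  refine ⟨∑' l : ℕ, nablaCoeff s d D l • ε (u + l), fun t => ?_⟩
  rw [← h t u]
  refine tendsto_nhds_unique (tendsto_const_nhds.inner hsum.hasSum.tendsto_sum_nat)
    (((hW.tendsto h h0.le hs h1 h2 t).inner tendsto_const_nhds).congr fun n => ?_)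
  simp only [sum_inner, inner_sum, inner_smul_left, inner_smul_right]
  refine Finset.sum_congr rfl fun l _ => ?_
  rw [hW.inner_shift h]
  rfl

/-- Pairing `X_t` with the dual vector at time `0` reads off `ψ t * σ2`; no summability of the
weights is needed. -/
lemma IsFracNoise.eq_of_tendsto (hs : 0 < s) (h1 : |d + D| < 1 / 2) (h2 : |D| < 1 / 2)
    (hW : IsFracNoise s d D ε W) (h : OrthoNoise ε σ2) (h0 : 0 < σ2) {ψ ψ' : ℤ → ℝ}
    (hψ : ∀ t, Tendsto (fun n : ℕ => ∑ j ∈ Finset.Icc (-(n : ℤ)) n, ψ j • W (t - j)) atTop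
      (𝓝 (X t)))
    (hψ' : ∀ t, Tendsto (fun n : ℕ => ∑ j ∈ Finset.Icc (-(n : ℤ)) n, ψ' j • W (t - j)) atTop
      (𝓝 (X t))) : ψ' = ψ := by
  obtain ⟨e, he⟩ := exists_dual hs h1 h2 hW h h0 0
  have key : ∀ ψ : ℤ → ℝ, (∀ t, Tendsto (fun n : ℕ => ∑ j ∈ Finset.Icc (-(n : ℤ)) n,
      ψ j • W (t - j)) atTop (𝓝 (X t))) → ∀ t, inner ℝ (X t) e = ψ t * σ2 := by
    intro ψ hψ t
    refine tendsto_nhds_unique ((hψ t).inner tendsto_const_nhds) (tendsto_const_nhds.congr' ?_)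
    filter_upwards [eventually_ge_atTop t.natAbs] with n hn
    simp only [sum_inner, inner_smul_left, he]
    rw [Finset.sum_eq_single t]
    · simp
    · intro j _ hj
      rw [if_neg (by omega), mul_zero]
    · intro ht
      exact absurd (Finset.mem_Icc.mpr (by omega)) ht
  ext t
  exact mul_right_cancel₀ h0.ne' ((key ψ' hψ' t).symm.trans (key ψ hψ t))

/-! ### Invertibility -/

omit [CompleteSpace H] in
lemma exists_norm_sub_sum_lt {x : ℕ → H} {y : H}
    (hy : y ∈ (Submodule.span ℝ (Set.range x)).topologicalClosure) {δ : ℝ} (hδ : 0 < δ) :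
    ∃ (n : ℕ) (c : ℕ → ℝ), ‖y - ∑ j ∈ Finset.range n, c j • x j‖ < δ := by
  rw [← SetLike.mem_coe, Submodule.topologicalClosure_coe, Metric.mem_closure_iff] at hy
  obtain ⟨v, hv, hv'⟩ := hy δ hδ
  rw [SetLike.mem_coe, Finsupp.mem_span_range_iff_exists_finsupp] at hv
  obtain ⟨c, rfl⟩ := hv
  refine ⟨c.support.sup id + 1, c, ?_⟩
  rw [dist_eq_norm] at hv'
  have hsum : ∑ j ∈ Finset.range (c.support.sup id + 1), c j • x j = c.sum fun i a => a • x i := by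
    symm
    refine Finset.sum_subset (fun j hj => ?_) fun j _ hj => ?_
    · rw [Finset.mem_range]
      exact Nat.lt_succ_of_le (Finset.le_sup (f := id) hj)
    · simp only [Finsupp.notMem_support_iff.mp hj, zero_smul]
  rwa [hsum]

lemma filt_extNat_mem_closure {c : ℕ → ℝ} (hc : Summable c) (hX : BddSeq X) (t : ℤ) (l : ℕ) :
    filt (extNat c) X (t - l) ∈
      (Submodule.span ℝ (Set.range fun k : ℕ => X (t - k))).topologicalClosure := by
  have h1 := hasSum_filt (summable_extNat.mpr hc) hX (t - l)
  refine (Submodule.isClosed_topologicalClosure _).mem_of_tendsto h1 (.of_forall fun S => ?_)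
  refine Submodule.sum_mem _ fun j _ => ?_
  rcases lt_or_ge j 0 with hj | hj
  · rw [extNat_of_neg c hj, zero_smul]
    exact Submodule.zero_mem _
  · refine Submodule.smul_mem _ _ (Submodule.le_topologicalClosure _
      (Submodule.subset_span ⟨l + j.toNat, ?_⟩))
    change X _ = X _
    congr 1
    push_cast
    omega

lemma mem_closure_of_nabla {c : ℕ → ℝ} (hc : Summable c) (hX : BddSeq X)
    (h : IsNabla s d D (filt (extNat c) X) ε) (t : ℤ) :
    ε t ∈ (Submodule.span ℝ (Set.range fun k : ℕ => X (t - k))).topologicalClosure :=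
  (Submodule.isClosed_topologicalClosure _).mem_of_tendsto (h t) (.of_forall fun _ =>
    Submodule.sum_mem _ fun l _ => Submodule.smul_mem _ _ (filt_extNat_mem_closure hc hX t l))

lemma filt_inverse_arma {A T : ℝ[X]} (hT : ∀ z : ℂ, ‖z‖ ≤ 1 → aeval z T ≠ 0) {c : ℕ → ℝ}
    (hc : ∀ z : ℂ, ‖z‖ ≤ 1 → HasSum (fun k : ℕ => (c k : ℂ) * z ^ k) (aeval z A / aeval z T))
    (hU : BddSeq U) (hε : BddSeq ε) (h : filt (polySeq A) U = filt (polySeq T) ε) :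
    filt (extNat c) U = ε := by
  obtain ⟨b, hb⟩ := exists_powerSeries 1 T hT
  have hbs := summable_extNat.mpr (summable_of_hasSum_one hb)
  have hcs := summable_extNat.mpr (summable_of_hasSum_one hc)
  have h1 : filt (extNat b) (filt (polySeq A) U) = filt (extNat c) U :=
    filt_filt hbs (summable_polySeq A) hcs (fun z => by
      rw [symb_extNat_of_hasSum hb, symb_extNat_of_hasSum hc, symb_polySeq, map_one]
      ring) hU
  have h2 : filt (extNat b) (filt (polySeq T) ε) = filt unitSeq ε :=
    filt_filt hbs (summable_polySeq T) summable_unitSeq (fun z => by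
      rw [symb_extNat_of_hasSum hb, symb_polySeq, symb_unitSeq, map_one, one_div,
        inv_mul_cancel₀ (hT z z.norm_coe.le)]) hε
  rw [← h1, h, h2, filt_unitSeq]

end Hilbert

/-! ### The weights of the fractional difference -/

lemma fracCoeff_zero_right (x : ℝ) : fracCoeff x 0 = 1 := by
  simp [fracCoeff]

lemma fracCoeff_succ (x : ℝ) (l : ℕ) :
    fracCoeff x (l + 1) = (l - x) / (l + 1) * fracCoeff x l := by
  have h1 : Ring.choose x (l + 1) = (x - l) / (l + 1) * Ring.choose x l := by
    rw [Ring.choose_eq_smul, Ring.choose_eq_smul, descPochhammer_succ_right, Polynomial.smeval_mul,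
      Nat.factorial_succ]
    have h2 : (X - (l : ℤ[X])).smeval x = x - l := by
      rw [Polynomial.smeval_sub, Polynomial.smeval_X, pow_one, Polynomial.smeval_natCast, pow_zero,
        nsmul_eq_mul, mul_one]
    rw [h2, smul_eq_mul, smul_eq_mul]
    push_cast
    field_simp
  rw [fracCoeff, fracCoeff, h1, pow_succ]
  field_simp
  ring

/-- Both sequences start at `1` and satisfy the recursion of `fracCoeff_succ`. For `0 < |x| < 1` no
Gamma value is taken at a pole. -/
lemma piCoeff_eq_fracCoeff {x : ℝ} (hx : |x| < 1) (l : ℕ) : piCoeff x l = fracCoeff x l := by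
  have hx' := abs_lt.mp hx
  rcases eq_or_ne x 0 with rfl | h0
  · rw [piCoeff, if_pos rfl]
    induction l with
    | zero => rw [if_pos rfl, fracCoeff_zero_right]
    | succ l ih =>
      rw [if_neg l.succ_ne_zero, fracCoeff_succ, ← ih]
      rcases eq_or_ne l 0 with rfl | hl
      · simp
      · rw [if_neg hl, mul_zero]
  · rw [piCoeff, if_neg h0]
    have hne : ∀ l : ℕ, (l : ℝ) - x ≠ 0 := fun l => by
      rcases Nat.eq_zero_or_pos l with rfl | hl
      · simpa using h0
      · have : (1 : ℝ) ≤ l := by exact_mod_cast hl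
        exact (by linarith : (0 : ℝ) < l - x).ne'
    have hΓ : Real.Gamma (-x) ≠ 0 := by
      refine Real.Gamma_ne_zero fun m hm => ?_
      have hxm : x = m := by linarith
      exact hne m (by rw [hxm, sub_self])
    induction l with
    | zero =>
      rw [fracCoeff_zero_right]
      simp only [Nat.cast_zero, zero_sub, zero_add, Real.Gamma_one, one_mul]
      exact div_self hΓ
    | succ l ih =>
      have e1 : ((l + 1 : ℕ) : ℝ) - x = (l - x) + 1 := by push_cast; ring
      have h1 : (l : ℝ) + 1 ≠ 0 := by positivity
      rw [fracCoeff_succ, ← ih, e1, Real.Gamma_add_one (hne l), Nat.cast_succ,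
        Real.Gamma_add_one h1]
      have h2 : Real.Gamma ((l : ℝ) + 1) ≠ 0 := (Real.Gamma_pos_of_pos (by positivity)).ne'
      field_simp

lemma psiStar_eq_nablaCoeff {s : ℕ} (hs : 0 < s) {d D : ℝ} (hd : |d| < 1) (hD : |D| < 1) :
    psiStar s d D = nablaCoeff s d D := by
  ext j
  have h1 : nablaCoeff s d D j = ∑ i ∈ Finset.range (j / s + 1),
      fracCoeff D i * fracCoeff d (j - i * s) := by
    rw [nablaCoeff, mul_comm, PowerSeries.coeff_mul]
    simp only [PowerSeries.coeff_mk]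
    rw [Finset.Nat.sum_antidiagonal_eq_sum_range_succ
      (fun k l => (if s ∣ k then fracCoeff D (k / s) else 0) * fracCoeff d l)]
    simp only [ite_mul, zero_mul]
    rw [← Finset.sum_filter]
    refine Finset.sum_bij' (fun k _ => k / s) (fun i _ => i * s) ?_ ?_ ?_ ?_ ?_
    · intro k hk
      rw [Finset.mem_filter, Finset.mem_range] at hk
      rw [Finset.mem_range]
      exact Nat.lt_succ_of_le (Nat.div_le_div_right (by omega))
    · intro i hi
      rw [Finset.mem_range] at hi
      rw [Finset.mem_filter, Finset.mem_range]
      exact ⟨Nat.lt_succ_of_le ((Nat.le_div_iff_mul_le hs).mp (by omega)), dvd_mul_left s i⟩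
    · intro k hk
      exact Nat.div_mul_cancel (Finset.mem_filter.mp hk).2
    · intro i _
      exact Nat.mul_div_cancel i hs
    · intro k hk
      rw [Nat.div_mul_cancel (Finset.mem_filter.mp hk).2]
  rw [h1, psiStar, Finset.sum_range_succ', zero_mul, Nat.sub_zero, fracCoeff_zero_right, one_mul,
    add_comm, piCoeff_eq_fracCoeff hd]
  congr 1
  rw [Finset.range_eq_Ico, Finset.sum_Ico_add' (fun i => fracCoeff D i * fracCoeff d (j - i * s))
    0 (j / s) 1, zero_add]
  refine Finset.sum_congr (by ext; simp [Finset.mem_Icc, Finset.mem_Ico])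
    fun i _ => ?_
  rw [piCoeff_eq_fracCoeff hD, piCoeff_eq_fracCoeff hd]

/-! ### Square integrable processes as sequences in `L²` -/

section Bridge

variable {Ω : Type*} [MeasurableSpace Ω] {μ : Measure Ω}

/-- A square integrable process as a sequence in `L²`. -/
def toL2 {Y : ℤ → Ω → ℝ} (hY : ∀ t, MemLp (Y t) 2 μ) (t : ℤ) : Lp ℝ 2 μ := (hY t).toLp (Y t)

/-- A sequence in `L²` as a process. -/
def ofL2 (Y : ℤ → Lp ℝ 2 μ) (t : ℤ) : Ω → ℝ := Y t

lemma memLp_ofL2 (Y : ℤ → Lp ℝ 2 μ) (t : ℤ) : MemLp (ofL2 Y t) 2 μ := Lp.memLp _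

lemma toL2_ofL2 (Y : ℤ → Lp ℝ 2 μ) : toL2 (memLp_ofL2 Y) = Y :=
  funext fun _ => Lp.toLp_coeFn _ _

lemma memLp_sum_mul {ι : Type*} {f : ι → Ω → ℝ} (hf : ∀ i, MemLp (f i) 2 μ) (c : ι → ℝ)
    (S : Finset ι) : MemLp (fun ω => ∑ i ∈ S, c i * f i ω) 2 μ :=
  memLp_finsetSum S fun i _ => (hf i).const_mul (c i)

lemma sum_smul_toLp {ι : Type*} {f : ι → Ω → ℝ} (hf : ∀ i, MemLp (f i) 2 μ) (c : ι → ℝ)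
    (S : Finset ι) : ∑ i ∈ S, c i • (hf i).toLp (f i) =
      (memLp_sum_mul hf c S).toLp fun ω => ∑ i ∈ S, c i * f i ω := by
  classical
  induction S using Finset.induction_on with
  | empty =>
    simp only [Finset.sum_empty]
    exact (MemLp.toLp_zero _).symm
  | insert i S hi ih =>
    rw [Finset.sum_insert hi, ih, ← MemLp.toLp_const_smul, ← MemLp.toLp_add]
    refine (MemLp.toLp_eq_toLp_iff _ _).mpr (.of_eq ?_)
    ext ω
    simp [Finset.sum_insert hi]

/-- The dictionary between mean-square limits of random variables and limits in `L²`. The weights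
may depend on `n` so that averages are covered as well as series. -/
lemma tendsto_sum_toLp_iff {ι : Type*} {f : ι → Ω → ℝ} (hf : ∀ i, MemLp (f i) 2 μ)
    (c : ℕ → ι → ℝ) (S : ℕ → Finset ι) {g : Ω → ℝ} (hg : MemLp g 2 μ) :
    Tendsto (fun n => ∑ i ∈ S n, c n i • (hf i).toLp (f i)) atTop (𝓝 (hg.toLp g)) ↔
      Tendsto (fun n => eLpNorm (fun ω => (∑ i ∈ S n, c n i * f i ω) - g ω) 2 μ) atTop (𝓝 0) := by
  simp only [sum_smul_toLp]
  exact Lp.tendsto_Lp_iff_tendsto_eLpNorm'' _ _ _ _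

variable {Y Z V : ℤ → Ω → ℝ} (hY : ∀ t, MemLp (Y t) 2 μ) (hZ : ∀ t, MemLp (Z t) 2 μ)
  (hV : ∀ t, MemLp (V t) 2 μ)

lemma IsFilterOf.tendsto {a : ℕ → ℝ} (h : IsFilterOf μ a Y V) (t : ℤ) :
    Tendsto (fun n => ∑ k ∈ Finset.range n, a k • toL2 hY (t - k)) atTop (𝓝 (toL2 hV t)) :=
  (tendsto_sum_toLp_iff (fun k : ℕ => hY (t - k)) (fun _ => a) Finset.range (hV t)).mpr (h t).2

lemma isFilterOf {a : ℕ → ℝ} (h : ∀ t, Tendsto (fun n => ∑ k ∈ Finset.range n,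
    a k • toL2 hY (t - k)) atTop (𝓝 (toL2 hV t))) : IsFilterOf μ a Y V := fun t =>
  ⟨hV t, (tendsto_sum_toLp_iff (fun k : ℕ => hY (t - k)) (fun _ => a) Finset.range (hV t)).mp (h t)⟩

lemma isTwoSidedFilterOf_iff {a : ℤ → ℝ} : IsTwoSidedFilterOf μ a Y V ↔
    ∀ t, Tendsto (fun n : ℕ => ∑ k ∈ Finset.Icc (-(n : ℤ)) n, a k • toL2 hY (t - k)) atTop
      (𝓝 (toL2 hV t)) := by
  have key : ∀ t, _ := fun t => tendsto_sum_toLp_iff (fun k : ℤ => hY (t - k)) (fun _ => a)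
    (fun n : ℕ => Finset.Icc (-(n : ℤ)) n) (hV t)
  exact ⟨fun h t => (key t).mpr (h t).2, fun h t => ⟨hV t, (key t).mp (h t)⟩⟩

lemma hasNoPeriodicComponent_iff {s : ℕ} :
    HasNoPeriodicComponent μ s Y ↔ NoPeriodic s (toL2 hY) := by
  refine forall_congr' fun t => ?_
  have key := tendsto_sum_toLp_iff (fun k : ℕ => hY (t - (s : ℤ) * k)) (fun n _ => (n : ℝ)⁻¹)
    Finset.range (g := 0) MemLp.zero
  rw [MemLp.toLp_zero] at key
  simp only [← Finset.smul_sum, ← Finset.mul_sum, Pi.zero_apply, sub_zero] at key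
  exact key.symm

lemma polyBack_ae_eq_iff (P Q : ℝ[X]) :
    (∀ t, ∀ᵐ ω ∂μ, polyBack P Y t ω = polyBack Q Z t ω) ↔
      filt (polySeq P) (toL2 hY) = filt (polySeq Q) (toL2 hZ) := by
  rw [funext_iff]
  refine forall_congr' fun t => ?_
  rw [filt_polySeq, filt_polySeq]
  unfold toL2
  rw [sum_smul_toLp fun k : ℕ => hY (t - k), sum_smul_toLp fun k : ℕ => hZ (t - k),
    MemLp.toLp_eq_toLp_iff]
  rfl

lemma inner_toL2 (t u : ℤ) : inner ℝ (toL2 hY t) (toL2 hZ u) = ∫ ω, Y t ω * Z u ω ∂μ := by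
  rw [L2.inner_def]
  refine integral_congr_ae ?_
  filter_upwards [(hY t).coeFn_toLp, (hZ u).coeFn_toLp] with ω h1 h2
  rw [toL2, toL2, h1, h2]
  simp [mul_comm]

lemma inner_toL2_eq_covariance (hYm : ∀ t, ∫ ω, Y t ω ∂μ = 0) (t u : ℤ) :
    inner ℝ (toL2 hY t) (toL2 hY u) = covariance (Y t) (Y u) μ := by
  rw [inner_toL2, covariance, hYm, hYm]
  simp

lemma IsWhiteNoise.orthoNoise {σ2 : ℝ} (h : IsWhiteNoise μ Y σ2) :
    OrthoNoise (toL2 h.memLp) σ2 := by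
  intro t u
  rw [inner_toL2_eq_covariance _ h.mean]
  split_ifs with htu
  · rw [htu, covariance_self (h.memLp u).aemeasurable, h.var]
  · exact h.uncorrelated t u htu

lemma IsSecondOrderStationary.exists_hasSpec (h : IsSecondOrderStationary μ Y)
    (hYm : ∀ t, ∫ ω, Y t ω ∂μ = 0) :
    ∃ F : Measure Circle, IsFiniteMeasure F ∧ HasSpec (toL2 hY) F := by
  refine SarfimaGarch.exists_hasSpec (γ := fun k => covariance (Y k) (Y 0) μ) fun t u => ?_
  rw [inner_toL2_eq_covariance hY hYm, ← h.cov u (t - u), add_sub_cancel]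

lemma isSecondOrderStationary_of_hasSpec {F : Measure Circle} (h : HasSpec (toL2 hY) F)
    (hYm : ∀ t, ∫ ω, Y t ω ∂μ = 0) : IsSecondOrderStationary μ Y := by
  refine ⟨hY, fun t => by rw [hYm, hYm], fun t k => ?_⟩
  rw [← inner_toL2_eq_covariance hY hYm, ← inner_toL2_eq_covariance hY hYm]
  have h1 := h (t + k) t
  have h2 := h k 0
  rw [add_sub_cancel_left] at h1
  rw [sub_zero, ← h1] at h2
  exact_mod_cast h2.symm

variable [IsProbabilityMeasure μ]

omit hY in
-- The mean is the inner product with the constant `1`, hence continuous in `L²`.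
lemma integral_eq_zero_of_tendsto {ι : Type*} {f : ι → Ω → ℝ} (hf : ∀ i, MemLp (f i) 2 μ)
    (hf0 : ∀ i, ∫ ω, f i ω ∂μ = 0) {c : ι → ℝ} {S : ℕ → Finset ι} {g : Ω → ℝ} (hg : MemLp g 2 μ)
    (h : Tendsto (fun n => ∑ i ∈ S n, c i • (hf i).toLp (f i)) atTop (𝓝 (hg.toLp g))) :
    ∫ ω, g ω ∂μ = 0 := by
  have hone : ∀ {f : Ω → ℝ} (hf : MemLp f 2 μ), inner ℝ (hf.toLp f)
      ((memLp_const (1 : ℝ) : MemLp (fun _ : Ω => (1 : ℝ)) 2 μ).toLp fun _ => 1) =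
        ∫ ω, f ω ∂μ := fun {f} hf => by
    have := inner_toL2 (Y := fun _ => f) (Z := fun _ _ => 1) (fun _ => hf)
      (fun _ => memLp_const (μ := μ) (1 : ℝ)) 0 0
    simpa [toL2] using this
  have h1 := h.inner (tendsto_const_nhds (x := (memLp_const (1 : ℝ) :
    MemLp (fun _ : Ω => (1 : ℝ)) 2 μ).toLp fun _ => 1)) (𝕜 := ℝ)
  simp only [sum_inner, inner_smul_left, hone, hf0, mul_zero, Finset.sum_const_zero] at h1
  exact (tendsto_nhds_unique h1 tendsto_const_nhds)

omit hY in
lemma integral_eq_zero_of_nabla {a : ℕ → ℝ} (h : IsFilterOf μ a Y V) (hY : ∀ t, MemLp (Y t) 2 μ)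
    (hYm : ∀ t, ∫ ω, Y t ω ∂μ = 0) (t : ℤ) : ∫ ω, V t ω ∂μ = 0 :=
  integral_eq_zero_of_tendsto (fun k : ℕ => hY (t - k)) (fun k => hYm (t - k)) (h t).1
    (h.tendsto hY (fun t => (h t).1) t)

omit hY in
lemma IsTwoSidedFilterOf.integral_eq_zero {a : ℤ → ℝ} (h : IsTwoSidedFilterOf μ a Y V)
    (hY : ∀ t, MemLp (Y t) 2 μ) (hYm : ∀ t, ∫ ω, Y t ω ∂μ = 0) (t : ℤ) : ∫ ω, V t ω ∂μ = 0 :=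
  integral_eq_zero_of_tendsto (fun k : ℤ => hY (t - k)) (fun k => hYm (t - k)) (h t).1
    ((isTwoSidedFilterOf_iff hY fun t => (h t).1).mp h t)

end Bridge

/-! ### Spectral densities -/

lemma coe_exp_zpow (x : ℝ) (k : ℤ) :
    ((Circle.exp x : Circle) : ℂ) ^ k = Complex.exp (Complex.I * k * x) := by
  rw [Circle.coe_exp, ← Complex.exp_int_mul]
  congr 1; ring

lemma norm_nabla_exp_sq (s : ℕ) (d D x : ℝ) :
    ‖nabla s (-d) (-D) (Circle.exp x : Circle)‖ ^ 2 =
      |2 * Real.sin (s * x / 2)| ^ (-2 * D) * |2 * Real.sin (x / 2)| ^ (-2 * d) := by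
  rw [nabla, norm_mul, Complex.norm_cpow_real, Complex.norm_cpow_real, norm_one_sub_exp,
    coe_exp_pow, norm_one_sub_exp, mul_pow, mul_comm]
  have key : ∀ (a e : ℝ), 0 ≤ a → (a ^ (-e)) ^ 2 = a ^ (-2 * e) := fun a e ha => by
    rw [← Real.rpow_natCast, ← Real.rpow_mul ha]
    congr 1; push_cast; ring
  rw [key _ _ (abs_nonneg _), key _ _ (abs_nonneg _)]

/-- The measure on the circle with density `f` in terms of the angle. -/
def angleMeasure (f : ℝ → ℝ) : Measure Circle :=
  ((volume.restrict (Set.Icc (-Real.pi) Real.pi)).withDensity fun x => ENNReal.ofReal (f x)).map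
    Circle.exp

lemma isFiniteMeasure_angleMeasure {f : ℝ → ℝ}
    (hf : IntegrableOn f (Set.Icc (-Real.pi) Real.pi)) : IsFiniteMeasure (angleMeasure f) := by
  have := isFiniteMeasure_withDensity_ofReal hf.hasFiniteIntegral
  exact Measure.isFiniteMeasure_map _ _

lemma angleMeasure_unitRoots {s : ℕ} (hs : 0 < s) (f : ℝ → ℝ) :
    angleMeasure f (unitRoots s) = 0 := by
  rw [angleMeasure, Measure.map_apply Circle.exp.continuous.measurable (measurableSet_unitRoots s)]
  refine withDensity_absolutelyContinuous _ _ ?_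
  exact (unitRoots_preimage_countable hs).measure_zero _

lemma integral_angleMeasure {f : ℝ → ℝ} (hf : IntegrableOn f (Set.Icc (-Real.pi) Real.pi))
    (h0 : ∀ x ∈ Set.Icc (-Real.pi) Real.pi, 0 ≤ f x) {g : Circle → ℂ} (hg : Measurable g) :
    ∫ z, g z ∂(angleMeasure f) =
      ∫ x in Set.Icc (-Real.pi) Real.pi, g (Circle.exp x) * (f x : ℂ) := by
  rw [angleMeasure, integral_map Circle.exp.continuous.measurable.aemeasurable
    hg.aestronglyMeasurable, integral_withDensity_eq_integral_toReal_smul₀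
    hf.aestronglyMeasurable.aemeasurable.ennreal_ofReal (.of_forall fun x => ENNReal.ofReal_lt_top)]
  refine setIntegral_congr_fun measurableSet_Icc fun x hx => ?_
  simp only [ENNReal.toReal_ofReal (h0 x hx), Complex.real_smul, mul_comm]

lemma integrableOn_of_angleMeasure {f : ℝ → ℝ} (hf : IntegrableOn f (Set.Icc (-Real.pi) Real.pi))
    (h0 : ∀ x ∈ Set.Icc (-Real.pi) Real.pi, 0 ≤ f x) {g : Circle → ℝ} (hg : Measurable g)
    (h : Integrable g (angleMeasure f)) :
    IntegrableOn (fun x => f x * g (Circle.exp x)) (Set.Icc (-Real.pi) Real.pi) := by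
  rw [angleMeasure, integrable_map_measure hg.aestronglyMeasurable
    Circle.exp.continuous.measurable.aemeasurable, integrable_withDensity_iff_integrable_smul₀'
    hf.aestronglyMeasurable.aemeasurable.ennreal_ofReal
    (.of_forall fun x => ENNReal.ofReal_lt_top)] at h
  refine IntegrableOn.congr_fun h (fun x hx => ?_) measurableSet_Icc
  simp only [ENNReal.toReal_ofReal (h0 x hx), smul_eq_mul, Function.comp_apply]

section Processes

variable {Ω : Type*} [MeasurableSpace Ω] {μ : Measure Ω}

lemma IsSpectralDensity.hasSpec {Y : ℤ → Ω → ℝ} {f : ℝ → ℝ} (h : IsSpectralDensity μ Y f)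
    (hY : ∀ t, MemLp (Y t) 2 μ) (hYm : ∀ t, ∫ ω, Y t ω ∂μ = 0) :
    HasSpec (toL2 hY) (angleMeasure f) := by
  intro t u
  have h1 := h.cov u (t - u)
  rw [add_sub_cancel] at h1
  rw [inner_toL2_eq_covariance hY hYm, h1, integral_angleMeasure h.integrable h.nonneg
    (continuous_coe_zpow _).measurable]
  simp only [coe_exp_zpow]

variable {s : ℕ} {d D : ℝ} {p q P Q : ℕ} {φ : Fin p → ℝ} {θ : Fin q → ℝ} {Φ : Fin P → ℝ}
  {Θ : Fin Q → ℝ} {ε X U : ℤ → Ω → ℝ} {σ2 : ℝ}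

/-! ### SARFIMA processes -/

namespace IsSARFIMA

lemma memLp_diff (h : IsSARFIMA μ s d D φ θ Φ Θ ε X U) (t : ℤ) : MemLp (U t) 2 μ := (h.diff t).1

lemma isNabla (h : IsSARFIMA μ s d D φ θ Φ Θ ε X U) :
    IsNabla s d D (toL2 h.memLp) (toL2 h.memLp_diff) :=
  h.diff.tendsto h.memLp h.memLp_diff

lemma arma (h : IsSARFIMA μ s d D φ θ Φ Θ ε X U) (hε : ∀ t, MemLp (ε t) 2 μ) :
    filt (polySeq (seasonalPoly s Φ φ)) (toL2 h.memLp_diff) =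
      filt (polySeq (seasonalPoly s Θ θ)) (toL2 hε) :=
  (polyBack_ae_eq_iff h.memLp_diff hε _ _).mp h.sarma

variable [IsProbabilityMeasure μ]

lemma mean_diff (h : IsSARFIMA μ s d D φ θ Φ Θ ε X U) (t : ℤ) : ∫ ω, U t ω ∂μ = 0 :=
  integral_eq_zero_of_nabla h.diff h.memLp h.mean t

omit [IsProbabilityMeasure μ] in
lemma diff_eq_filt (h : IsSARFIMA μ s d D φ θ Φ Θ ε X U) (hX : IsSecondOrderStationary μ X)
    (hε : IsWhiteNoise μ ε σ2) (h0 : 0 < σ2)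
    (hA : ∀ z : ℂ, ‖z‖ = 1 → aeval z (seasonalPoly s Φ φ) ≠ 0) {ψ : ℤ → ℝ}
    (hψ : IsLaurentExpansion ψ
      fun z => aeval z (seasonalPoly s Θ θ) / aeval z (seasonalPoly s Φ φ)) :
    toL2 h.memLp_diff = filt ψ (toL2 hε.memLp) := by
  obtain ⟨F, hF, hspec⟩ := hX.exists_hasSpec h.memLp h.mean
  exact eq_filt_of_arma hA hψ (h.isNabla.bddSeq hspec) (hε.orthoNoise.hasSpec h0.le).bddSeq
    (h.arma hε.memLp)

end IsSARFIMA

variable [IsProbabilityMeasure μ]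

lemma exists_isSpectralDensity_diff (h : IsSARFIMA μ s d D φ θ Φ Θ ε X U)
    (hX : IsSecondOrderStationary μ X) (hε : IsWhiteNoise μ ε σ2) (h0 : 0 < σ2)
    (hA : ∀ z : ℂ, ‖z‖ = 1 → aeval z (seasonalPoly s Φ φ) ≠ 0) :
    ∃ fU : ℝ → ℝ, IsSpectralDensity μ U fU := by
  obtain ⟨ψ, hψ⟩ := exists_isLaurentExpansion (seasonalPoly s Θ θ) (seasonalPoly s Φ φ) hA
  have hU := h.diff_eq_filt hX hε h0 hA hψ
  have hc : Continuous fun x : ℝ => ‖symb ψ (Circle.exp x)‖ ^ 2 :=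
    ((continuous_symb hψ.summable).comp Circle.exp.continuous).norm.pow 2
  have hc' : Continuous fun z : Circle => ‖symb ψ z‖ ^ 2 := (continuous_symb hψ.summable).norm.pow 2
  have h2π : 0 < 2 * Real.pi := Real.two_pi_pos
  refine ⟨fun x => σ2 / (2 * Real.pi) * ‖symb ψ (Circle.exp x)‖ ^ 2, fun x _ => by positivity,
    (continuous_const.mul hc).continuousOn.integrableOn_Icc, fun t k => ?_⟩
  have hg : Continuous fun z : Circle => (z : ℂ) ^ (t + k - t) * ((‖symb ψ z‖ ^ 2 : ℝ) : ℂ) :=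
    (continuous_coe_zpow _).mul (Complex.continuous_ofReal.comp hc')
  rw [← inner_toL2_eq_covariance h.memLp_diff h.mean_diff, hU,
    (hε.orthoNoise.hasSpec h0.le).inner_filt_self hψ.summable, integral_noiseMeasure h0.le,
    integral_arcLength _ hg.aestronglyMeasurable, ← integral_smul]
  refine integral_congr_ae (.of_forall fun x => ?_)
  simp only [add_sub_cancel_left, coe_exp_zpow, Complex.real_smul]
  push_cast
  ring

/-- A spectral measure of `U` with a density does not charge the roots of unity, and then neither
does that of `X`. Inversion presents `X` as the Abel filter `∇^{(-d,-D)} U`, whose spectral measure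
is known. -/
lemma isSpectralDensity_of_diff (hs : 0 < s) (h : IsSARFIMA μ s d D φ θ Φ Θ ε X U)
    (hX : IsSecondOrderStationary μ X)
    (hper : 0 < D ∨ 0 < d + D → HasNoPeriodicComponent μ s X) {fU : ℝ → ℝ}
    (hfU : IsSpectralDensity μ U fU) :
    IsSpectralDensity μ X fun x =>
      fU x * |2 * Real.sin (s * x / 2)| ^ (-2 * D) * |2 * Real.sin (x / 2)| ^ (-2 * d) := by
  obtain ⟨F, hF, hspec⟩ := hX.exists_hasSpec h.memLp h.mean
  have hFU := isFiniteMeasure_angleMeasure hfU.integrable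
  have hUspec := hfU.hasSpec h.memLp_diff h.mean_diff
  have hU0 := angleMeasure_unitRoots hs fU
  have hF0 : F (unitRoots s) = 0 := h.isNabla.unitRoots_eq_zero hs hspec
    (fun hc => (hasNoPeriodicComponent_iff h.memLp).mp (hper hc)) (hUspec.noPeriodic hU0)
  have hinv := h.isNabla.abelFilt.inv hs hspec hF0
  have hm : Measurable fun z : Circle => ‖nabla s (-d) (-D) z‖ ^ 2 :=
    (measurable_nabla s (-d) (-D)).norm.pow_const 2
  have e : (fun x => fU x * |2 * Real.sin (s * x / 2)| ^ (-2 * D) *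
      |2 * Real.sin (x / 2)| ^ (-2 * d)) =
        fun x => fU x * ‖nabla s (-d) (-D) (Circle.exp x : Circle)‖ ^ 2 := by
    ext x
    rw [norm_nabla_exp_sq, mul_assoc]
  rw [e]
  refine ⟨fun x hx => mul_nonneg (hfU.nonneg x hx) (by positivity),
    integrableOn_of_angleMeasure hfU.integrable hfU.nonneg hm (hinv.integrable hs hUspec hU0),
    fun t k => ?_⟩
  have hg : Measurable fun z : Circle =>
      (z : ℂ) ^ (t + k - t) * ((‖nabla s (-d) (-D) z‖ ^ 2 : ℝ) : ℂ) :=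
    (continuous_coe_zpow _).measurable.mul (Complex.measurable_ofReal.comp hm)
  rw [← inner_toL2_eq_covariance h.memLp h.mean, hinv.inner_eq hs hUspec hU0,
    integral_angleMeasure hfU.integrable hfU.nonneg hg]
  refine integral_congr_ae (.of_forall fun x => ?_)
  simp only [add_sub_cancel_left, coe_exp_zpow]
  push_cast
  ring

omit [IsProbabilityMeasure μ] in
-- The causal filter `c` commutes with the difference, so `∇^{(d,D)} (c(B) X) = c(B) U = ε`. Only
-- convergence of `∇^{(d,D)} X` itself is used, so periodic components of `X` are harmless.
lemma isInvertible_and_exists_filter (hs : 0 < s) (hdD : |d + D| < 1 / 2) (hD : |D| < 1 / 2)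
    (hε : IsWhiteNoise μ ε σ2) (h0 : 0 < σ2)
    (hT : ∀ z : ℂ, ‖z‖ ≤ 1 → aeval z (seasonalPoly s Θ θ) ≠ 0)
    (h : IsSARFIMA μ s d D φ θ Φ Θ ε X U) (hX : IsSecondOrderStationary μ X) :
    IsInvertible μ X ε ∧
      ∃ (c : ℕ → ℝ) (V : ℤ → Ω → ℝ),
        (∀ z : ℂ, ‖z‖ ≤ 1 → HasSum (fun k : ℕ => (c k : ℂ) * z ^ k)
          (aeval z (seasonalPoly s Φ φ) / aeval z (seasonalPoly s Θ θ))) ∧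
        IsFilterOf μ c X V ∧
        IsFilterOf μ (psiStar s d D) V ε := by
  obtain ⟨F, hF, hspec⟩ := hX.exists_hasSpec h.memLp h.mean
  obtain ⟨c, hc⟩ := exists_powerSeries (seasonalPoly s Φ φ) (seasonalPoly s Θ θ) hT
  have hcs : Summable c := summable_of_hasSum_one hc
  have hd : |d| < 1 := by
    have h1 : d = (d + D) - D := by ring
    rw [h1]
    exact (abs_sub _ _).trans_lt (by linarith)
  set V : ℤ → Lp ℝ 2 μ := filt (extNat c) (toL2 h.memLp) with hV
  have hnab : IsNabla s d D V (toL2 hε.memLp) := by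
    have h1 := h.isNabla.tendsto_filt_filt hspec (summable_extNat.mpr hcs)
    rwa [filt_inverse_arma hT hc (h.isNabla.bddSeq hspec) (hε.orthoNoise.hasSpec h0.le).bddSeq
      (h.arma hε.memLp)] at h1
  refine ⟨fun t δ hδ => ?_, c, ofL2 V, hc, ?_, ?_⟩
  · obtain ⟨δ', hδ'0, hδ'⟩ : ∃ δ' : ℝ, 0 < δ' ∧ ENNReal.ofReal δ' ≤ δ := by
      rcases eq_or_ne δ ⊤ with rfl | hδt
      · exact ⟨1, one_pos, le_top⟩
      · exact ⟨δ.toReal, ENNReal.toReal_pos hδ.ne' hδt, ENNReal.ofReal_toReal_le⟩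
    obtain ⟨n, b, hb⟩ := exists_norm_sub_sum_lt
      (mem_closure_of_nabla hcs hspec.bddSeq hnab t) hδ'0
    refine ⟨n, b, lt_of_lt_of_le ?_ hδ'⟩
    unfold toL2 at hb
    rw [sum_smul_toLp (fun j : ℕ => h.memLp (t - j)), ← MemLp.toLp_sub, Lp.norm_toLp] at hb
    exact (ENNReal.lt_ofReal_iff_toReal_lt
      ((hε.memLp t).sub (memLp_sum_mul (fun j : ℕ => h.memLp (t - j)) _ _)).eLpNorm_ne_top).mpr hb
  · refine isFilterOf h.memLp (memLp_ofL2 V) fun t => ?_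
    have h1 := (Nat.cast_injective.hasSum_iff (extNat_eq_zero c · · ▸ zero_smul ℝ _)).mpr
      (hasSum_filt (summable_extNat.mpr hcs) hspec.bddSeq t)
    rw [toL2_ofL2]
    refine (h1.tendsto_sum_nat).congr fun n => ?_
    simp only [Function.comp_apply, extNat_natCast]
  · refine isFilterOf (memLp_ofL2 V) hε.memLp ?_
    rw [toL2_ofL2, psiStar_eq_nablaCoeff hs hd (hD.trans (by norm_num))]
    exact hnab

end Processes

/-! ### Existence, uniqueness and ergodicity of the stationary solution -/

section Existence

variable {Ω : Type*} [MeasurableSpace Ω] {μ : Measure Ω} [IsProbabilityMeasure μ]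
  {m r : ℕ} {α0 : ℝ} {α : Fin m → ℝ} {β : Fin r → ℝ} {ν : Measure ℝ} {ε h : ℤ → Ω → ℝ}

lemma IsGARCH.isFactor_filter (hg : IsGARCH μ α0 α β ν ε h) (hα0 : 0 < α0) (hα : ∀ i, 0 ≤ α i)
    (hβ : ∀ j, 0 ≤ β j) {Y V : ℤ → Ω → ℝ} (hY : ∀ t, MemLp (Y t) 2 μ) {a : ℕ → ℝ}
    (hf : IsFilterOf μ a Y V) (hfac : IsFactor μ (innov ε h) Y) : IsFactor μ (innov ε h) V :=
  hg.isFactor_of_tendsto hα0 hα hβ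
    (fun n => isFactor_sum (Finset.range n) fun j : ℕ => (hfac.lag j).const_mul (a j))
    (fun n t => (memLp_sum_mul (fun j : ℕ => hY (t - j)) a (Finset.range n)).aestronglyMeasurable)
    (fun t => (hf t).1.aestronglyMeasurable) fun t => (hf t).2

lemma IsGARCH.isFactor_twoSidedFilter (hg : IsGARCH μ α0 α β ν ε h) (hα0 : 0 < α0)
    (hα : ∀ i, 0 ≤ α i) (hβ : ∀ j, 0 ≤ β j) {Y V : ℤ → Ω → ℝ} (hY : ∀ t, MemLp (Y t) 2 μ)
    {a : ℤ → ℝ} (hf : IsTwoSidedFilterOf μ a Y V) (hfac : IsFactor μ (innov ε h) Y) :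
    IsFactor μ (innov ε h) V :=
  hg.isFactor_of_tendsto hα0 hα hβ
    (fun n => isFactor_sum (Finset.Icc (-(n : ℤ)) n) fun j => (hfac.lag j).const_mul (a j))
    (fun _ t => (memLp_sum_mul (fun j : ℤ => hY (t - j)) a _).aestronglyMeasurable)
    (fun t => (hf t).1.aestronglyMeasurable) fun t => (hf t).2

variable {σ2 : ℝ} {s : ℕ} {d D : ℝ} {p q P Q : ℕ} {φ : Fin p → ℝ} {θ : Fin q → ℝ}
  {Φ : Fin P → ℝ} {Θ : Fin Q → ℝ}

/-- Existence and properties of the stationary solution. -/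
theorem exists_stationary_solution (hs : 0 < s) (hα0 : 0 < α0) (hα : ∀ i, 0 ≤ α i)
    (hβ : ∀ j, 0 ≤ β j) (hαβ : ∑ i, α i + ∑ j, β j < 1) (hε : IsWhiteNoise μ ε σ2)
    (hgarch : IsGARCH μ α0 α β ν ε h) (hdD : |d + D| < 1 / 2) (hD : |D| < 1 / 2)
    (hA : ∀ z : ℂ, ‖z‖ = 1 → aeval z (seasonalPoly s Φ φ) ≠ 0) :
    ∃ X U : ℤ → Ω → ℝ,
      IsSARFIMA μ s d D φ θ Φ Θ ε X U ∧
      IsSecondOrderStationary μ X ∧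
      HasNoPeriodicComponent μ s X ∧
      (∀ Y V : ℤ → Ω → ℝ, IsSARFIMA μ s d D φ θ Φ Θ ε Y V → IsSecondOrderStationary μ Y →
        (0 < D ∨ 0 < d + D → HasNoPeriodicComponent μ s Y) → ∀ t, Y t =ᵐ[μ] X t) ∧
      (∃ (W : ℤ → Ω → ℝ) (ψ : ℤ → ℝ),
        IsFilterOf μ (nablaCoeff s (-d) (-D)) ε W ∧
        IsLaurentExpansion ψ
          (fun z => aeval z (seasonalPoly s Θ θ) / aeval z (seasonalPoly s Φ φ)) ∧
        IsTwoSidedFilterOf μ ψ W X ∧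
        (∀ ψ' : ℤ → ℝ, IsTwoSidedFilterOf μ ψ' W X → ψ' = ψ) ∧
        ((∀ z : ℂ, ‖z‖ ≤ 1 → aeval z (seasonalPoly s Φ φ) ≠ 0) → ∀ j < 0, ψ j = 0)) ∧
      IsStrictlyStationary μ X ∧
      IsErgodic μ X := by
  have h0 : 0 < σ2 := hgarch.variance_pos hα0 hα hβ hε
  have hnoise := hε.orthoNoise
  have hnspec := hnoise.hasSpec h0.le
  obtain ⟨ψ, hψ⟩ := exists_isLaurentExpansion (seasonalPoly s Θ θ) (seasonalPoly s Φ φ) hA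
  obtain ⟨W, hW⟩ := exists_isFracNoise hnoise h0 hs hdD hD
  have hfin : IsFiniteMeasure (fracMeasure s d D σ2) := isFiniteMeasure_fracMeasure hs hdD hD
  have hWspec := hW.hasSpec hnoise h0.le hs
  have hWnab : IsNabla s d D W (toL2 hε.memLp) := hW.tendsto hnoise h0.le hs hdD hD
  set X : ℤ → Lp ℝ 2 μ := filt ψ W with hX
  set U : ℤ → Lp ℝ 2 μ := filt ψ (toL2 hε.memLp) with hU
  have hXspec := hWspec.hasSpec_filt hψ.summable
  have hXfin := isFiniteMeasure_filt (fracMeasure s d D σ2) hψ.summable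
  have hX0 := withDensity_unitRoots (f := fun z => ENNReal.ofReal (‖symb ψ z‖ ^ 2))
    (fracMeasure_unitRoots (d := d) (D := D) (σ2 := σ2) hs)
  have hUspec := hnspec.hasSpec_filt hψ.summable
  have hUfin := isFiniteMeasure_filt (noiseMeasure σ2) hψ.summable
  have hU0 := withDensity_unitRoots (f := fun z => ENNReal.ofReal (‖symb ψ z‖ ^ 2))
    (noiseMeasure_unitRoots (σ2 := σ2) hs)
  have hXnab : IsNabla s d D X U := hWnab.tendsto_filt_filt hWspec hψ.summable
  have hWfilt : IsFilterOf μ (nablaCoeff s (-d) (-D)) ε (ofL2 W) :=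
    isFilterOf hε.memLp (memLp_ofL2 W) (by rw [toL2_ofL2]; exact hW)
  have hXlim : ∀ t, Tendsto (fun n : ℕ => ∑ j ∈ Finset.Icc (-(n : ℤ)) n, ψ j • W (t - j)) atTop
      (𝓝 (X t)) := fun t => tendsto_Icc_of_hasSum (hasSum_filt hψ.summable hWspec.bddSeq t)
  have htwo : ∀ ψ' : ℤ → ℝ, IsTwoSidedFilterOf μ ψ' (ofL2 W) (ofL2 X) ↔ ∀ t,
      Tendsto (fun n : ℕ => ∑ j ∈ Finset.Icc (-(n : ℤ)) n, ψ' j • W (t - j)) atTop (𝓝 (X t)) := by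
    intro ψ'
    rw [isTwoSidedFilterOf_iff (memLp_ofL2 W) (memLp_ofL2 X), toL2_ofL2, toL2_ofL2]
  have hXfilt := (htwo ψ).mpr hXlim
  have hWm := integral_eq_zero_of_nabla hWfilt hε.memLp hε.mean
  have hXm := hXfilt.integral_eq_zero (memLp_ofL2 W) hWm
  have hsarfima : IsSARFIMA μ s d D φ θ Φ Θ ε (ofL2 X) (ofL2 U) :=
    { memLp := memLp_ofL2 X
      mean := hXm
      diff := isFilterOf (memLp_ofL2 X) (memLp_ofL2 U) (by rw [toL2_ofL2, toL2_ofL2]; exact hXnab)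
      sarma := (polyBack_ae_eq_iff (memLp_ofL2 U) hε.memLp _ _).mpr (by
        rw [toL2_ofL2]; exact filt_arma hA hψ hnspec.bddSeq) }
  have hfactor : IsFactor μ (innov ε h) (ofL2 X) :=
    hgarch.isFactor_twoSidedFilter hα0 hα hβ (memLp_ofL2 W) hXfilt
      (hgarch.isFactor_filter hα0 hα hβ hε.memLp hWfilt
        (hgarch.isFactor_innov hα0 hα hβ hαβ hε))
  refine ⟨ofL2 X, ofL2 U, hsarfima, ?_, ?_, fun Y V hY hYst hper t => ?_,
    ⟨ofL2 W, ψ, hWfilt, hψ, hXfilt, fun ψ' hψ' => ?_, fun hA' j hj => hψ.eq_zero_of_neg hA' hj⟩,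
    hgarch.isStrictlyStationary_and_isErgodic hα0 hα hβ hfactor⟩
  · exact isSecondOrderStationary_of_hasSpec (memLp_ofL2 X) (by rw [toL2_ofL2]; exact hXspec) hXm
  · rw [hasNoPeriodicComponent_iff (memLp_ofL2 X), toL2_ofL2]
    exact hXspec.noPeriodic hX0
  · obtain ⟨F, hF, hYspec⟩ := hYst.exists_hasSpec hY.memLp hY.mean
    -- The ARMA equation has only one bounded solution, so a competitor has the same fractional
    -- difference as `X`; inverting it gives equality.
    have hVU : toL2 hY.memLp_diff = U := hY.diff_eq_filt hYst hε h0 hA hψ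
    have hYnab : IsNabla s d D (toL2 hY.memLp) U := hVU ▸ hY.isNabla
    have hF0 := hYnab.unitRoots_eq_zero hs hYspec
      (fun hc => (hasNoPeriodicComponent_iff hY.memLp).mp (hper hc)) (hUspec.noPeriodic hU0)
    have heq : toL2 hY.memLp = X := IsNabla.unique hs hYnab hYspec hF0 hXnab hXspec hX0
    rw [ofL2, ← heq]
    exact (hY.memLp t).coeFn_toLp.symm
  · exact hW.eq_of_tendsto hs hdD hD hnoise h0 hXlim ((htwo ψ').mp hψ')

end Existence

end SarfimaGarch

end

/-! ### Assembly of the three statements -/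

open SarfimaGarch in
theorem proposition1 {Ω : Type*} [MeasurableSpace Ω] (μ : Measure Ω) [IsProbabilityMeasure μ]
    {p q P Q m r : ℕ} (s : ℕ) (hs : 0 < s) (d D : ℝ)
    (φ : Fin p → ℝ) (θ : Fin q → ℝ) (Φ : Fin P → ℝ) (Θ : Fin Q → ℝ)
    (α0 : ℝ) (α : Fin m → ℝ) (β : Fin r → ℝ) (ν : Measure ℝ) (σ2 : ℝ) (ε h : ℤ → Ω → ℝ)
    (hα0 : 0 < α0) (hα : ∀ i, 0 ≤ α i) (hβ : ∀ j, 0 ≤ β j)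
    (hαβ : ∑ i, α i + ∑ j, β j < 1)
    (hε : IsWhiteNoise μ ε σ2) (hgarch : IsGARCH μ α0 α β ν ε h)
    (hcommon : ∀ z : ℂ, ¬ (aeval z (seasonalPoly s Φ φ) = 0 ∧ aeval z (seasonalPoly s Θ θ) = 0))
    (hdD : |d + D| < 1 / 2) (hD : |D| < 1 / 2) :
    -- part (a)
    ((∀ z : ℂ, ‖z‖ = 1 → aeval z (seasonalPoly s Φ φ) ≠ 0) →
      ∃ X U : ℤ → Ω → ℝ,
        IsSARFIMA μ s d D φ θ Φ Θ ε X U ∧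
        IsSecondOrderStationary μ X ∧
        HasNoPeriodicComponent μ s X ∧
        (∀ Y V : ℤ → Ω → ℝ, IsSARFIMA μ s d D φ θ Φ Θ ε Y V → IsSecondOrderStationary μ Y →
          (0 < D ∨ 0 < d + D → HasNoPeriodicComponent μ s Y) → ∀ t, Y t =ᵐ[μ] X t) ∧
        (∃ (W : ℤ → Ω → ℝ) (ψ : ℤ → ℝ),
          IsFilterOf μ (nablaCoeff s (-d) (-D)) ε W ∧
          IsLaurentExpansion ψ
            (fun z => aeval z (seasonalPoly s Θ θ) / aeval z (seasonalPoly s Φ φ)) ∧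
          IsTwoSidedFilterOf μ ψ W X ∧
          (∀ ψ' : ℤ → ℝ, IsTwoSidedFilterOf μ ψ' W X → ψ' = ψ) ∧
          ((∀ z : ℂ, ‖z‖ ≤ 1 → aeval z (seasonalPoly s Φ φ) ≠ 0) → ∀ j < 0, ψ j = 0)) ∧
        IsStrictlyStationary μ X ∧
        IsErgodic μ X) ∧
    -- part (b)
    ((∀ z : ℂ, ‖z‖ ≤ 1 → aeval z (seasonalPoly s Θ θ) ≠ 0) →
      ∀ X U : ℤ → Ω → ℝ, IsSARFIMA μ s d D φ θ Φ Θ ε X U → IsSecondOrderStationary μ X →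
        IsInvertible μ X ε ∧
        ∃ (c : ℕ → ℝ) (V : ℤ → Ω → ℝ),
          (∀ z : ℂ, ‖z‖ ≤ 1 → HasSum (fun k : ℕ => (c k : ℂ) * z ^ k)
            (aeval z (seasonalPoly s Φ φ) / aeval z (seasonalPoly s Θ θ))) ∧
          IsFilterOf μ c X V ∧
          IsFilterOf μ (psiStar s d D) V ε) ∧
    -- part (c)
    (∀ X U : ℤ → Ω → ℝ, IsSARFIMA μ s d D φ θ Φ Θ ε X U → IsSecondOrderStationary μ X →
      (0 < D ∨ 0 < d + D → HasNoPeriodicComponent μ s X) →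
      ((∀ z : ℂ, ‖z‖ = 1 → aeval z (seasonalPoly s Φ φ) ≠ 0) →
        ∃ fU : ℝ → ℝ, IsSpectralDensity μ U fU) ∧
      ∀ fU : ℝ → ℝ, IsSpectralDensity μ U fU →
        IsSpectralDensity μ X (fun x =>
          fU x * |2 * Real.sin (s * x / 2)| ^ (-2 * D) * |2 * Real.sin (x / 2)| ^ (-2 * d))) := by
  have h0 : 0 < σ2 := hgarch.variance_pos hα0 hα hβ hε
  exact ⟨fun hA => exists_stationary_solution hs hα0 hα hβ hαβ hε hgarch hdD hD hA,
    fun hT X U hXU hX => isInvertible_and_exists_filter hs hdD hD hε h0 hT hXU hX,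
    fun X U hXU hX hper => ⟨exists_isSpectralDensity_diff hXU hX hε h0,
      fun fU hfU => isSpectralDensity_of_diff hs hXU hX hper hfU⟩⟩
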